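/- Let $\mathbb T^1=\mathbb R/\mathbb Z$, $\mathbb T^2=\mathbb T^1\times\mathbb T^1$, let $\mu$ be normalized Lebesgue measure on $\mathbb T^2$, let $S_t(x,y)=(x+t,y)$, and let $C$ be the middle-third Cantor set, viewed in $\mathbb T^1$. A diffeomorphism $T$ of $\mathbb T^2$ is said to be constructed by approximation by conjugation, with conjugacies $h_0,h_1,\dots$, if the $h_n$ are $\mu$-preserving $C^\infty$ diffeomorphisms of $\mathbb T^2$ and there are rationals $\alpha_n=p_n/q_n$ (with $q_0\ge 1$ and $p_0,q_0$ coprime) and positive integers $k_n,l_n$ such that $p_{n+1}=k_nl_nq_np_n+1$, $q_{n+1}=k_nl_nq_n^2$, $h_n\circ S_{\alpha_n}=S_{\alpha_n}\circ h_n$, and, with $H_n=h_0\circ\dots\circ h_{n-1}$, the maps $T_n=H_n\circ S_{\alpha_n}\circ H_n^{-1}$ converge to $T$ in the $C^\infty$ topology of diffeomorphisms (the $T_n$ to $T$ and the $T_n^{-1}$ to $T^{-1}$, with all derivatives, uniformly). Theorem C. There is a $\mu$-preserving $C^\infty$ diffeomorphism $T$ of $\mathbb T^2$, constructed by approximation by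 conjugation, such that the set $\mathrm B$ of all $\mu$-generic points of $T$, that is, $$\mathrm B=\Big\{x\in\mathbb T^2:\ \lim_{N\to\infty}\frac1N\sum_{i=0}^{N-1}f(T^ix)=\int f\,d\mu\ \text{ for every continuous } f:\mathbb T^2\to\mathbb R\Big\},$$ satisfies $$\mu(\mathrm B)=0,\qquad \log_3 2\le\dim_H(\mathrm B)\le 1+\log_3 2 .$$ Moreover the conjugacies can be taken such that $$\{0\}\times C\ \subseteq\ \liminf_{n\to\infty}H_n(\mathbb T^1\times C)\ \subseteq\ \mathrm B,$$ where $\liminf_n A_n$ is the set of points that lie in $A_n$ for all but finitely many $n$. -/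

import Mathlib

open MeasureTheory Filter Topology
open scoped ContDiff

namespace AbC

/-- The torus `ℝ/ℤ × ℝ/ℤ`. Its `volume` is normalized Lebesgue measure, and its (sup) metric is
bi-Lipschitz equivalent to the flat one, so that `dimH` is the usual Hausdorff dimension. -/
abbrev Torus : Type := UnitAddCircle × UnitAddCircle

/-- The covering map from the plane to the torus. -/
def proj (x : ℝ × ℝ) : Torus := ((x.1 : UnitAddCircle), (x.2 : UnitAddCircle))

/-- `F` is a lift of the torus map `f` to the plane. -/
def IsLift (F : ℝ × ℝ → ℝ × ℝ) (f : Torus → Torus) : Prop :=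
  ∀ x, proj (F x) = f (proj x)

/-- A torus map is smooth if it has a `C^∞` lift. -/
def IsSmooth (f : Torus → Torus) : Prop :=
  ∃ F : ℝ × ℝ → ℝ × ℝ, ContDiff ℝ ∞ F ∧ IsLift F f

/-- `f` is a smooth diffeomorphism of the torus that preserves Lebesgue measure. -/
structure IsAreaPreservingDiffeo (f : Equiv.Perm Torus) : Prop where
  smooth : IsSmooth f
  smooth_symm : IsSmooth f.symm
  measurePreserving : MeasurePreserving f (volume : Measure Torus) volume

/-- Convergence of smooth torus maps in the `C^∞` topology: suitable lifts converge uniformly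
together with all their derivatives. -/
def TendstoSmooth (f : ℕ → Torus → Torus) (g : Torus → Torus) : Prop :=
  ∃ (F : ℕ → ℝ × ℝ → ℝ × ℝ) (G : ℝ × ℝ → ℝ × ℝ),
    (∀ n, ContDiff ℝ ∞ (F n) ∧ IsLift (F n) (f n)) ∧ ContDiff ℝ ∞ G ∧ IsLift G g ∧
    ∀ k : ℕ, TendstoUniformly (fun n => iteratedFDeriv ℝ k (F n)) (iteratedFDeriv ℝ k G) atTop

/-- The horizontal translation `S_t (x, y) = (x + t, y)`. -/
def shift (t : ℝ) : Equiv.Perm Torus :=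
  (Equiv.addRight (t : UnitAddCircle)).prodCongr (Equiv.refl UnitAddCircle)

/-- The composition `H n = h 0 ∘ h 1 ∘ ⋯ ∘ h (n - 1)` (the product of permutations is
composition). -/
def conj (h : ℕ → Equiv.Perm Torus) : ℕ → Equiv.Perm Torus
  | 0 => 1
  | n + 1 => conj h n * h n

/-- `T` is obtained by approximation by conjugation, with conjugacies `h`: there are rationals
`α n = p n / q n`, with `p (n+1) = k n * l n * q n * p n + 1` and `q (n+1) = k n * l n * q n ^ 2`,
such that `h n` is an area-preserving smooth diffeomorphism which commutes with `S_{α n}`, and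
`T n = H n ∘ S_{α n} ∘ (H n)⁻¹` tends to `T` in the space of smooth diffeomorphisms. -/
def IsApproxByConj (h : ℕ → Equiv.Perm Torus) (T : Equiv.Perm Torus) : Prop :=
  ∃ (p : ℕ → ℤ) (q k l : ℕ → ℕ),
    0 < q 0 ∧ IsCoprime (p 0) (q 0 : ℤ) ∧
    (∀ n, 0 < k n ∧ 0 < l n) ∧
    (∀ n, p (n + 1) = k n * l n * q n * p n + 1) ∧
    (∀ n, q (n + 1) = k n * l n * q n ^ 2) ∧
    (∀ n, IsAreaPreservingDiffeo (h n)) ∧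
    (∀ n, Commute (h n) (shift ((p n : ℝ) / (q n : ℝ)))) ∧
    TendstoSmooth (fun n => conj h n * shift ((p n : ℝ) / (q n : ℝ)) * (conj h n)⁻¹) T ∧
    TendstoSmooth (fun n => (conj h n * shift ((p n : ℝ) / (q n : ℝ)) * (conj h n)⁻¹).symm) T.symm

/-- The set of generic points of `T` for Lebesgue measure: the points along whose forward orbit
the time averages of every continuous function tend to its integral. -/
def genericPoints (T : Torus → Torus) : Set Torus :=
  {x | ∀ f : C(Torus, ℝ),
    Tendsto (fun N : ℕ => birkhoffAverage ℝ T f N x) atTop (𝓝 (∫ y, f y ∂volume))}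

/-- The middle-third Cantor set, as a subset of the circle `ℝ/ℤ`. -/
def cantorCircle : Set UnitAddCircle := (fun y : ℝ => (y : UnitAddCircle)) '' cantorSet

end AbC

namespace AbC

/-! ### The Cantor set and its lift to the line -/

/-! The whole argument runs on the circle averages `avg H f y`, the mean of `f ∘ H` over the
horizontal circle at height `y`. A conjugacy `h` is given by two functions with `∂P/∂Y = -∂Q/∂c = J
> 0`, through `(P(c,Y)/q, c) ↦ (Q(c,Y)/q, Y)`. Such a map preserves area, commutes with the
translation by `p/q`, and spreads the circle at height `c` over the heights `Y` with density
`J(c,Y)`. Hence, once `f ∘ H` is nearly constant at scale `1/q` along circles, the new average at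
`c` is close to `∫ avg H f Y * J(c,Y) dY` (`abs_avg_comp_sub_le`).

The density is chosen in two incompatible ways, on the Cantor set and away from it
(`exists_generatingPair`). For `c` in the Cantor set, `J(c,·)` is close to `a + (1 - a) E'`, where
`E'` lives near the Cantor set. The uniform part contributes the exact mean, so the deviation of the
averages on the Cantor circles is multiplied by about `1 - a`. With `a = 1/(n+2)` these factors have
product zero, although `a` itself tends to zero. For `c` off a small neighbourhood of the Cantor
set, `J(c,·)` is concentrated near `Y = c`, and the averages hardly change. The interpolation
between the two regimes is possible with little horizontal distortion because the Cantor set is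
null: there is a uniformly small function whose derivative is nearly `1` on it and nearly `0` off a
neighbourhood.

Genericity on the liminf: a point lying on Cantor circles at two successive stages has good averages
at every intermediate time (`abs_birkhoffAverage_sub_le`). Here two features matter. The function
`E` lies above the identity and touches it on the Cantor set, so an orbit started there never spends
too small a share of its time near the Cantor set; and the uniform share `a` is small. The points
`(0, c)` with `c` in the Cantor set are fixed by all conjugacies, so they belong to the liminf, and
the Hölder Cantor function bounds the dimension from below.

Smallness of the generic set: off the neighbourhoods the averages of `cos 2πy` and `sin 2πy` stay
within `1/2` of these functions, which cannot both be small. So a generic point lies in all but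
finitely many tubes, the images of the neighbourhoods (`IsConstruction.eventually_mem_tube`). The
tubes have measure tending to zero. They are contained in images, under Lipschitz maps fixed before
the neighbourhood is chosen, of products of an interval with a neighbourhood of the Cantor set; this
gives covers with exponents tending to `1 + log_3 2`.

Convergence is the usual fast approximation: `h` commutes with the old translation, so the old map
may be written with the new conjugacy, and the new rotation number is taken as close to the old one
as needed. -/

lemma coe_eq_coe_iff {x y : ℝ} : (x : UnitAddCircle) = (y : UnitAddCircle) ↔ ∃ k : ℤ, x = y + k := by
  rw [← sub_eq_zero, ← AddCircle.coe_sub, AddCircle.coe_eq_zero_iff]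
  refine exists_congr fun k => ?_
  simp only [zsmul_eq_mul, mul_one]
  constructor <;> intro h <;> linarith

/-- The preimage in `ℝ` of the Cantor set of the circle. -/
def cantorLift : Set ℝ := {y | (y : UnitAddCircle) ∈ cantorCircle}

lemma mem_cantorLift {y : ℝ} : y ∈ cantorLift ↔ ∃ k : ℤ, y - k ∈ cantorSet := by
  constructor
  · rintro ⟨c, hc, hcy⟩
    obtain ⟨k, hk⟩ := coe_eq_coe_iff.1 hcy
    exact ⟨-k, by push_cast; rwa [sub_neg_eq_add, ← hk]⟩
  · rintro ⟨k, hk⟩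
    refine ⟨y - k, hk, coe_eq_coe_iff.2 ⟨-k, by push_cast; ring⟩⟩

lemma cantorSet_subset_lift : cantorSet ⊆ cantorLift := fun c hc => mem_cantorLift.2 ⟨0, by simpa⟩

lemma add_int_mem_cantorLift {y : ℝ} (k : ℤ) : y + k ∈ cantorLift ↔ y ∈ cantorLift := by
  simp [cantorLift]

lemma fract_mem_cantorLift {y : ℝ} : Int.fract y ∈ cantorLift ↔ y ∈ cantorLift := by
  have := add_int_mem_cantorLift (y := Int.fract y) ⌊y⌋
  rw [Int.fract_add_floor] at this
  exact this.symm

lemma div_three_mem_cantorSet {c : ℝ} (hc : c ∈ cantorSet) : c / 3 ∈ cantorSet := by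
  rw [cantorSet_eq_union_halves]; exact Or.inl ⟨c, hc, rfl⟩

lemma two_add_div_three_mem_cantorSet {c : ℝ} (hc : c ∈ cantorSet) : (2 + c) / 3 ∈ cantorSet := by
  rw [cantorSet_eq_union_halves]; exact Or.inr ⟨c, hc, rfl⟩

lemma one_mem_cantorSet : (1 : ℝ) ∈ cantorSet := by
  refine Set.mem_iInter.2 fun n => ?_
  induction n with
  | zero => simp
  | succ n ih => rw [preCantorSet_succ]; exact Or.inr ⟨1, ih, by norm_num⟩

lemma mem_cantorSet_of_lift {y : ℝ} (h : y ∈ cantorLift) (h0 : 0 ≤ y) (h1 : y ≤ 1) :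
    y ∈ cantorSet := by
  obtain ⟨k, hk⟩ := mem_cantorLift.1 h
  have h2 := cantorSet_subset_unitInterval hk
  have h3 : (k : ℝ) ≤ 1 := by linarith [h2.1]
  have h4 : (-1 : ℝ) ≤ k := by linarith [h2.2]
  have h5 : k ≤ 1 := by exact_mod_cast h3
  have h6 : -1 ≤ k := by exact_mod_cast h4
  interval_cases k
  · have : y = 0 := by push_cast at h2; linarith [h2.2]
    rw [this]; exact zero_mem_cantorSet
  · simpa using hk
  · have : y = 1 := by push_cast at h2; linarith [h2.1]
    rw [this]; exact one_mem_cantorSet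

/-! ### Sums of rescaled copies of a function over the gaps of the Cantor set -/

/-- The sum over the gaps of the Cantor set of generation at most `N` of copies of `φ` rescaled
to that gap, where each rescaling multiplies the values by `l`. -/
def gapSum (l : ℝ) (φ : ℝ → ℝ) : ℕ → ℝ → ℝ
  | 0, _ => 0
  | N + 1, y => l * (φ (3 * y - 1) + gapSum l φ N (3 * y) + gapSum l φ N (3 * y - 2))

lemma contDiff_gapSum {φ : ℝ → ℝ} (hφ : ContDiff ℝ ∞ φ) (l : ℝ) (N : ℕ) :
    ContDiff ℝ ∞ (gapSum l φ N) := by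
  induction N with
  | zero => exact contDiff_const
  | succ N ih =>
    show ContDiff ℝ ∞ fun y => l * (φ (3 * y - 1) + gapSum l φ N (3 * y) + gapSum l φ N (3 * y - 2))
    fun_prop

/-- `φ` vanishes outside the interval `[η, 1 - η]`. -/
def VanishesNear (η : ℝ) (φ : ℝ → ℝ) : Prop := ∀ y, y ≤ η ∨ 1 - η ≤ y → φ y = 0

/-- Each generation divides the margin at the ends by three. A positive margin is what makes the
periodization through `Int.fract` smooth. -/
lemma vanishesNear_gapSum {φ : ℝ → ℝ} {η : ℝ} (h0 : 0 < η) (h1 : η ≤ 1)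
    (hφ : VanishesNear η φ) (l : ℝ) (N : ℕ) : VanishesNear (η / 3 ^ N) (gapSum l φ N) := by
  induction N with
  | zero => intro y _; rfl
  | succ N ih =>
    have hp : 0 < η / 3 ^ N := by positivity
    have hle : η / 3 ^ N ≤ 1 := (div_le_self h0.le (one_le_pow₀ (by norm_num))).trans h1
    have e : η / 3 ^ (N + 1) = η / 3 ^ N / 3 := by rw [pow_succ]; field_simp
    intro y hy
    rw [e] at hy
    show l * _ = 0
    rcases hy with hy | hy
    · rw [hφ _ (Or.inl (by linarith)), ih _ (Or.inl (by linarith)), ih _ (Or.inl (by linarith))]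
      simp
    · rw [hφ _ (Or.inr (by linarith)), ih _ (Or.inr (by linarith)), ih _ (Or.inr (by linarith))]
      simp

lemma gapSum_of_notMem {φ : ℝ → ℝ} (hφ : VanishesNear 0 φ) (l : ℝ) (N : ℕ) :
    VanishesNear 0 (gapSum l φ N) := by
  induction N with
  | zero => intro y _; rfl
  | succ N ih =>
    intro y hy
    show l * _ = 0
    rcases hy with hy | hy
    · rw [hφ _ (Or.inl (by linarith)), ih _ (Or.inl (by linarith)), ih _ (Or.inl (by linarith))]
      simp
    · rw [hφ _ (Or.inr (by linarith)), ih _ (Or.inr (by linarith)), ih _ (Or.inr (by linarith))]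
      simp

/-- The three rescaled copies live on the three thirds of the interval, so at each point at most one
term survives. -/
lemma gapSum_succ_cases {φ : ℝ → ℝ} (hφ : VanishesNear 0 φ) (l : ℝ) (N : ℕ) (y : ℝ) :
    (y ≤ 1 / 3 ∧ gapSum l φ (N + 1) y = l * gapSum l φ N (3 * y)) ∨
    (1 / 3 ≤ y ∧ y ≤ 2 / 3 ∧ gapSum l φ (N + 1) y = l * φ (3 * y - 1)) ∨
    (2 / 3 ≤ y ∧ gapSum l φ (N + 1) y = l * gapSum l φ N (3 * y - 2)) := by
  have hg := gapSum_of_notMem hφ l N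
  have e : gapSum l φ (N + 1) y =
    l * (φ (3 * y - 1) + gapSum l φ N (3 * y) + gapSum l φ N (3 * y - 2)) := rfl
  rcases le_total y (1 / 3) with h | h
  · left
    rw [e, hφ _ (Or.inl (by linarith)), hg (3 * y - 2) (Or.inl (by linarith))]
    exact ⟨h, by ring⟩
  · rcases le_total y (2 / 3) with h' | h'
    · right; left
      rw [e, hg (3 * y) (Or.inr (by linarith)), hg (3 * y - 2) (Or.inl (by linarith))]
      exact ⟨h, h', by ring⟩
    · right; right
      rw [e, hφ _ (Or.inr (by linarith)), hg (3 * y) (Or.inr (by linarith))]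
      exact ⟨h', by ring⟩

lemma gapSum_eq_zero_of_mem {φ : ℝ → ℝ} (hφ : VanishesNear 0 φ) (l : ℝ) (N : ℕ) :
    ∀ c ∈ cantorSet, gapSum l φ N c = 0 := by
  induction N with
  | zero => intro c _; rfl
  | succ N ih =>
    intro c hc
    have hg := gapSum_of_notMem hφ l N
    show l * (φ (3 * c - 1) + gapSum l φ N (3 * c) + gapSum l φ N (3 * c - 2)) = 0
    rw [cantorSet_eq_union_halves] at hc
    rcases hc with ⟨x, hx, rfl⟩ | ⟨x, hx, rfl⟩
    · have hx' := cantorSet_subset_unitInterval hx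
      have e1 : 3 * (x / 3) = x := by ring
      simp only [e1]
      rw [hφ _ (Or.inl (by linarith [hx'.2])), ih x hx, hg _ (Or.inl (by linarith [hx'.2]))]
      simp
    · have hx' := cantorSet_subset_unitInterval hx
      have e1 : 3 * ((2 + x) / 3) = 2 + x := by ring
      simp only [e1]
      rw [hφ _ (Or.inr (by linarith [hx'.1])), hg _ (Or.inr (by linarith [hx'.1])),
        show 2 + x - 2 = x by ring, ih x hx]
      simp

lemma gapSum_one_mem {φ : ℝ → ℝ} (hφ : VanishesNear 0 φ) {s : Set ℝ} (h0 : (0 : ℝ) ∈ s)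
    (hs : ∀ y, φ y ∈ s) (N : ℕ) : ∀ y, gapSum 1 φ N y ∈ s := by
  induction N with
  | zero => exact fun _ => h0
  | succ N ih =>
    intro y
    rcases gapSum_succ_cases hφ 1 N y with ⟨_, h⟩ | ⟨_, _, h⟩ | ⟨_, h⟩ <;> rw [h, one_mul]
    exacts [ih _, hs _, ih _]

lemma gapSum_nonneg {φ : ℝ → ℝ} (hφ : ∀ y, 0 ≤ φ y) {l : ℝ} (hl : 0 ≤ l) (N : ℕ) :
    ∀ y, 0 ≤ gapSum l φ N y := by
  induction N with
  | zero => exact fun _ => le_rfl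
  | succ N ih =>
    intro y
    exact mul_nonneg hl (add_nonneg (add_nonneg (hφ _) (ih _)) (ih _))

/-- Each level of the recursion contributes a chain rule factor `3`, which the factor `1 / 3`
cancels. -/
lemma hasDerivAt_gapSum {φ φ' : ℝ → ℝ} (hφ : ∀ y, HasDerivAt φ (φ' y) y) (N : ℕ) :
    ∀ y, HasDerivAt (gapSum (1 / 3) φ N) (gapSum 1 φ' N y) y := by
  induction N with
  | zero => exact fun y => hasDerivAt_const y _
  | succ N ih =>
    intro y
    have h3 : HasDerivAt (fun y : ℝ => 3 * y) 3 y := by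
      simpa using (hasDerivAt_id y).const_mul 3
    have h1 := (hφ (3 * y - 1)).comp y (h3.sub_const 1)
    have h2 := (ih (3 * y)).comp y h3
    have h4 := (ih (3 * y - 2)).comp y (h3.sub_const 2)
    have := ((h1.add h2).add h4).const_mul (1 / 3)
    refine this.congr_deriv ?_
    show _ = 1 * (_ + _ + _)
    ring

/-- Away from the Cantor set, a gap sum of a function which is constantly `v` in the middle of the
interval equals `v`. -/
lemma exists_near_of_gapSum_ne {φ : ℝ → ℝ} {η v : ℝ} (hφ : VanishesNear 0 φ)
    (hv : ∀ y, η ≤ y → y ≤ 1 - η → φ y = v) (N : ℕ) :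
    ∀ y, 0 ≤ y → y ≤ 1 → gapSum 1 φ N y ≠ v → ∃ c ∈ cantorSet, |y - c| ≤ max η ((1 / 3) ^ N) := by
  induction N with
  | zero =>
    intro y h0 h1 _
    exact ⟨0, zero_mem_cantorSet, by simp [abs_of_nonneg h0, h1]⟩
  | succ N ih =>
    intro y h0 h1 hne
    have key : ∀ t : ℝ, t ≤ max η ((1 / 3) ^ N) → 0 ≤ t → t / 3 ≤ max η ((1 / 3) ^ (N + 1)) := by
      intro t ht ht0
      rcases le_max_iff.1 ht with h | h
      · exact le_max_of_le_left (by linarith)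
      · refine le_max_of_le_right ?_
        rw [pow_succ]; linarith
    rcases gapSum_succ_cases hφ 1 N y with ⟨h, e⟩ | ⟨h, h', e⟩ | ⟨h, e⟩ <;> rw [e, one_mul] at hne
    · obtain ⟨c, hc, hd⟩ := ih (3 * y) (by linarith) (by linarith) hne
      refine ⟨c / 3, div_three_mem_cantorSet hc, ?_⟩
      have := key _ hd (abs_nonneg _)
      rwa [show |3 * y - c| / 3 = |y - c / 3| by
        rw [show y - c / 3 = (3 * y - c) / 3 by ring, abs_div]; norm_num] at this
    · rcases lt_or_ge (3 * y - 1) η with h2 | h2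
      · refine ⟨1 / 3, div_three_mem_cantorSet one_mem_cantorSet, le_max_of_le_left ?_⟩
        rw [abs_of_nonneg (by linarith)]; linarith
      · rcases lt_or_ge (1 - η) (3 * y - 1) with h3 | h3
        · refine ⟨2 / 3, by simpa using two_add_div_three_mem_cantorSet zero_mem_cantorSet,
            le_max_of_le_left ?_⟩
          rw [abs_of_nonpos (by linarith)]; linarith
        · exact absurd (hv _ h2 h3) hne
    · obtain ⟨c, hc, hd⟩ := ih (3 * y - 2) (by linarith) (by linarith) hne
      refine ⟨(2 + c) / 3, two_add_div_three_mem_cantorSet hc, ?_⟩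
      have := key _ hd (abs_nonneg _)
      rwa [show |3 * y - 2 - c| / 3 = |y - (2 + c) / 3| by
        rw [show y - (2 + c) / 3 = (3 * y - 2 - c) / 3 by ring, abs_div]; norm_num] at this

/-! ### Periodization -/

/-- The only danger is the jump of the fractional part at an integer; there both sides vanish
because `φ` is zero near both ends of the interval. -/
lemma fract_eventuallyEq {φ : ℝ → ℝ} {η : ℝ} (h0 : 0 < η) (hφ : VanishesNear η φ) (y : ℝ) :
    (fun z => φ (Int.fract z)) =ᶠ[𝓝 y] fun z => φ (z - ⌊y⌋) := by
  have h1 : (⌊y⌋ : ℝ) - η < y := by linarith [Int.floor_le y]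
  have h3 : (⌊y⌋ : ℝ) - 1 < y := by linarith [Int.floor_le y]
  filter_upwards [Ioi_mem_nhds h1, Ioi_mem_nhds h3, Iio_mem_nhds (Int.lt_floor_add_one y)]
    with z hz1 hz3 hz2
  simp only [Set.mem_Ioi, Set.mem_Iio] at hz1 hz2 hz3
  rcases le_or_gt (⌊y⌋ : ℝ) z with h | h
  · have : ⌊z⌋ = ⌊y⌋ := Int.floor_eq_iff.2 ⟨h, hz2⟩
    rw [Int.fract, this]
  · have : ⌊z⌋ = ⌊y⌋ - 1 := Int.floor_eq_iff.2 ⟨by push_cast; linarith, by push_cast; linarith⟩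
    rw [Int.fract, this, hφ _ (Or.inr (by push_cast; linarith)), hφ _ (Or.inl (by linarith))]

lemma contDiff_comp_fract {φ : ℝ → ℝ} {η : ℝ} (h0 : 0 < η) (hφ : VanishesNear η φ)
    (h : ContDiff ℝ ∞ φ) : ContDiff ℝ ∞ fun y => φ (Int.fract y) := by
  refine contDiff_iff_contDiffAt.2 fun y => ?_
  have : ContDiff ℝ ∞ fun z => φ (z - ⌊y⌋) := by fun_prop
  exact this.contDiffAt.congr_of_eventuallyEq (fract_eventuallyEq h0 hφ y)

lemma hasDerivAt_comp_fract {φ φ' : ℝ → ℝ} {η : ℝ} (h0 : 0 < η) (hφ : VanishesNear η φ)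
    (h : ∀ y, HasDerivAt φ (φ' y) y) (y : ℝ) :
    HasDerivAt (fun z => φ (Int.fract z)) (φ' (Int.fract y)) y := by
  refine HasDerivAt.congr_of_eventuallyEq ?_ (fract_eventuallyEq h0 hφ y)
  exact (h (Int.fract y)).comp_sub_const y ⌊y⌋

/-! ### Bump functions -/

/-- A smooth plateau function: `1` on `[η, 1 - η]` and `0` outside `(η / 2, 1 - η / 2)`. -/
noncomputable def plateau (η t : ℝ) : ℝ :=
  Real.smoothTransition ((t - η / 2) / (η / 2)) * Real.smoothTransition ((1 - η / 2 - t) / (η / 2))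

lemma contDiff_plateau (η : ℝ) : ContDiff ℝ ∞ (plateau η) := by
  unfold plateau
  have := Real.smoothTransition.contDiff (n := ⊤)
  refine ContDiff.mul (this.comp ?_) (this.comp ?_) <;> fun_prop

lemma plateau_nonneg (η t : ℝ) : 0 ≤ plateau η t :=
  mul_nonneg (Real.smoothTransition.nonneg _) (Real.smoothTransition.nonneg _)

lemma plateau_le_one (η t : ℝ) : plateau η t ≤ 1 :=
  mul_le_one₀ (Real.smoothTransition.le_one _) (Real.smoothTransition.nonneg _)
    (Real.smoothTransition.le_one _)

lemma plateau_eq_one {η t : ℝ} (h : 0 < η) (h1 : η ≤ t) (h2 : t ≤ 1 - η) : plateau η t = 1 := by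
  rw [plateau, Real.smoothTransition.one_of_one_le, Real.smoothTransition.one_of_one_le, one_mul]
  · rw [le_div_iff₀ (by positivity)]; linarith
  · rw [le_div_iff₀ (by positivity)]; linarith

lemma vanishesNear_plateau {η : ℝ} (h : 0 < η) : VanishesNear (η / 2) (plateau η) := by
  rintro t (ht | ht)
  · rw [plateau, Real.smoothTransition.zero_of_nonpos, zero_mul]
    exact div_nonpos_of_nonpos_of_nonneg (by linarith) (by linarith)
  · rw [plateau, mul_comm, Real.smoothTransition.zero_of_nonpos, zero_mul]
    exact div_nonpos_of_nonpos_of_nonneg (by linarith) (by linarith)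

lemma VanishesNear.mono {η η' : ℝ} {φ : ℝ → ℝ} (h : VanishesNear η φ) (hη : η' ≤ η) :
    VanishesNear η' φ := by
  rintro y (hy | hy)
  · exact h y (Or.inl (hy.trans hη))
  · exact h y (Or.inr (by linarith))

lemma integral_pos_of_continuous {f : ℝ → ℝ} (hf : Continuous f) (h0 : ∀ t, 0 ≤ f t) {a b x : ℝ}
    (hx : x ∈ Set.Ioo a b) (hpos : 0 < f x) : 0 < ∫ t in a..b, f t :=
  intervalIntegral.integral_pos (hx.1.trans hx.2) hf.continuousOn (fun t _ => h0 t)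
    ⟨x, Set.Ioo_subset_Icc_self hx, hpos⟩

lemma contDiff_integral {f : ℝ → ℝ} (hf : ContDiff ℝ ∞ f) :
    ContDiff ℝ ∞ fun y => ∫ t in (0 : ℝ)..y, f t := by
  have hd : ∀ y, HasDerivAt (fun y => ∫ t in (0 : ℝ)..y, f t) (f y) y := fun y =>
    intervalIntegral.integral_hasDerivAt_right (hf.continuous.intervalIntegrable _ _)
      hf.continuous.stronglyMeasurable.stronglyMeasurableAtFilter hf.continuous.continuousAt
  rw [contDiff_infty_iff_deriv]
  refine ⟨fun y => (hd y).differentiableAt, ?_⟩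
  rwa [show deriv (fun y => ∫ t in (0 : ℝ)..y, f t) = f from funext fun y => (hd y).deriv]

lemma hasDerivAt_integral {f : ℝ → ℝ} (hf : Continuous f) (y : ℝ) :
    HasDerivAt (fun y => ∫ t in (0 : ℝ)..y, f t) (f y) y :=
  intervalIntegral.integral_hasDerivAt_right (hf.intervalIntegrable _ _)
    hf.stronglyMeasurable.stronglyMeasurableAtFilter hf.continuousAt

/-- A smooth function on a gap which first rises and then descends with slope `-1`. -/
lemma exists_gap_profile {η : ℝ} (h0 : 0 < η) (h1 : η < 1 / 2) :
    ∃ B B' : ℝ → ℝ, ContDiff ℝ ∞ B ∧ (∀ y, HasDerivAt B (B' y) y) ∧ (∀ y, 0 ≤ B y) ∧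
      (∀ y, -1 ≤ B' y) ∧ VanishesNear (η / 4) B ∧ VanishesNear (η / 4) B' ∧
      ∀ y, η ≤ y → y ≤ 1 - η → B' y = -1 := by
  -- The bump `k` lives on `(η/4, η/2)`, to the left of the support of the plateau, so the primitive
  -- rises before it falls.
  set k : ℝ → ℝ := fun t => expNegInvGlue (t - η / 4) * expNegInvGlue (η / 2 - t) with hk
  have hks : ContDiff ℝ ∞ k :=
    (expNegInvGlue.contDiff.comp (by fun_prop)).mul (expNegInvGlue.contDiff.comp (by fun_prop))
  have hk0 : ∀ t, 0 ≤ k t := fun t => mul_nonneg (expNegInvGlue.nonneg _) (expNegInvGlue.nonneg _)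
  have hkl : ∀ t, t ≤ η / 4 → k t = 0 := fun t ht => by
    simp only [hk]; rw [expNegInvGlue.zero_of_nonpos (by linarith), zero_mul]
  have hkr : ∀ t, η / 2 ≤ t → k t = 0 := fun t ht => by
    simp only [hk]; rw [expNegInvGlue.zero_of_nonpos (x := η / 2 - t) (by linarith), mul_zero]
  have hK : 0 < ∫ t in (0 : ℝ)..1, k t :=
    integral_pos_of_continuous hks.continuous hk0 (x := 3 * η / 8)
      ⟨by linarith, by linarith⟩
      (mul_pos (expNegInvGlue.pos_of_pos (by linarith)) (expNegInvGlue.pos_of_pos (by linarith)))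
  set b := plateau η with hb
  have hbs : ContDiff ℝ ∞ b := contDiff_plateau η
  have hbv : VanishesNear (η / 2) b := vanishesNear_plateau h0
  -- This factor gives `M k - b` mean zero, so that its primitive returns to `0` at the right end.
  set M : ℝ := (∫ t in (0 : ℝ)..1, b t) / ∫ t in (0 : ℝ)..1, k t with hM
  have hM0 : 0 ≤ M :=
    div_nonneg (intervalIntegral.integral_nonneg (by norm_num) fun t _ => plateau_nonneg η t) hK.le
  set B' : ℝ → ℝ := fun t => M * k t - b t with hB'
  have hBs : ContDiff ℝ ∞ B' := (contDiff_const.mul hks).sub hbs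
  have hB1 : ∫ t in (0 : ℝ)..1, B' t = 0 := by
    simp only [hB']
    have hMk : IntervalIntegrable (fun t => M * k t) volume 0 1 :=
      (continuous_const.mul hks.continuous).intervalIntegrable _ _
    rw [intervalIntegral.integral_sub hMk
      (hbs.continuous.intervalIntegrable _ _), intervalIntegral.integral_const_mul, hM,
      div_mul_cancel₀ _ hK.ne', sub_self]
  have hii : ∀ a b : ℝ, IntervalIntegrable B' volume a b := fun a b =>
    hBs.continuous.intervalIntegrable a b
  have hB'v : VanishesNear (η / 4) B' := by
    rintro t (ht | ht) <;> simp only [hB']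
    · rw [hkl t ht, hbv t (Or.inl (by linarith))]; simp
    · rw [hkr t (by linarith)]
      rcases le_or_gt (1 - η / 2) t with h | h
      · rw [hbv t (Or.inr h)]; simp
      · exfalso; linarith
  refine ⟨fun y => ∫ t in (0 : ℝ)..y, B' t, B', contDiff_integral hBs,
    fun y => hasDerivAt_integral hBs.continuous y, ?_, ?_, ?_, hB'v, ?_⟩
  · intro y
    rcases le_total y (η / 2) with hy | hy
    · rcases le_total 0 y with hy0 | hy0
      · refine intervalIntegral.integral_nonneg hy0 fun t ht => ?_
        simp only [hB']
        rw [hbv t (Or.inl (by linarith [ht.2]))]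
        simpa using mul_nonneg hM0 (hk0 t)
      · refine le_of_eq ?_
        symm
        show ∫ t in (0 : ℝ)..y, B' t = 0
        rw [intervalIntegral.integral_symm, neg_eq_zero]
        refine intervalIntegral.integral_zero_ae (ae_of_all _ fun t ht => ?_)
        rw [Set.uIoc_of_le hy0] at ht
        exact hB'v t (Or.inl (by linarith [ht.2]))
    -- Right of `η/2` only `-b` remains; since the total integral is zero, the primitive equals the
    -- mass of `b` still to come, which is nonnegative.
    · have e : ∫ t in (0 : ℝ)..y, B' t = ∫ t in y..1, b t := by
        have h3 : ∫ t in y..1, B' t = -∫ t in y..1, b t := by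
          rw [← intervalIntegral.integral_neg]
          refine intervalIntegral.integral_congr_ae (ae_of_all _ fun t ht => ?_)
          simp only [hB']
          rcases le_total y 1 with h | h
          · rw [Set.uIoc_of_le h] at ht
            rw [hkr t (by linarith [ht.1])]; ring
          · rw [Set.uIoc_of_ge h] at ht
            rw [hkr t (by linarith [ht.1])]; ring
        have h4 := intervalIntegral.integral_add_adjacent_intervals (hii 0 y) (hii y 1)
        rw [hB1, h3] at h4
        linarith
      simp only [e]
      rcases le_total y 1 with h | h
      · exact intervalIntegral.integral_nonneg h fun t _ => plateau_nonneg η t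
      · rw [intervalIntegral.integral_symm]
        refine le_of_eq ?_
        symm
        rw [neg_eq_zero]
        refine intervalIntegral.integral_zero_ae (ae_of_all _ fun t ht => ?_)
        rw [Set.uIoc_of_le h] at ht
        exact hbv t (Or.inr (by linarith [ht.1]))
  · intro y
    simp only [hB']
    linarith [mul_nonneg hM0 (hk0 y), plateau_le_one η y]
  · have hv0 : ∀ y, y ≤ η / 4 → ∫ t in (0 : ℝ)..y, B' t = 0 := by
      intro y hy
      refine intervalIntegral.integral_zero_ae (ae_of_all _ fun t ht => ?_)
      refine hB'v t (Or.inl ?_)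
      rcases le_total 0 y with h | h
      · rw [Set.uIoc_of_le h] at ht; linarith [ht.2]
      · rw [Set.uIoc_of_ge h] at ht; linarith [ht.2]
    rintro y (hy | hy)
    · exact hv0 y hy
    · have h4 := intervalIntegral.integral_add_adjacent_intervals (hii 0 y) (hii y 1)
      rw [hB1] at h4
      have h5 : ∫ t in y..1, B' t = 0 := by
        refine intervalIntegral.integral_zero_ae (ae_of_all _ fun t ht => ?_)
        refine hB'v t (Or.inr ?_)
        rcases le_total y 1 with h | h
        · rw [Set.uIoc_of_le h] at ht; linarith [ht.1]
        · rw [Set.uIoc_of_ge h] at ht; linarith [ht.1]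
      simp only
      linarith
  · intro y hy1 hy2
    simp only [hB']
    rw [hkr y (by linarith), hb, plateau_eq_one h0 hy1 hy2]; ring

end AbC

namespace AbC

/-! ### Neighbourhoods of the Cantor set -/

/-- `y` is at distance less than `ρ` from the lifted Cantor set. -/
def NearCantor (ρ y : ℝ) : Prop := ∃ c ∈ cantorLift, |y - c| < ρ

lemma NearCantor.mono {ρ ρ' y : ℝ} (h : NearCantor ρ y) (hρ : ρ ≤ ρ') : NearCantor ρ' y := by
  obtain ⟨c, hc, h⟩ := h
  exact ⟨c, hc, h.trans_le hρ⟩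

lemma nearCantor_add_int {ρ y : ℝ} (k : ℤ) : NearCantor ρ (y + k) ↔ NearCantor ρ y := by
  constructor
  · rintro ⟨c, hc, h⟩
    refine ⟨c - k, ?_, by rwa [show y - (c - k) = y + k - c by ring]⟩
    have := (add_int_mem_cantorLift (y := c) (-k)).2 hc
    push_cast at this
    exact this
  · rintro ⟨c, hc, h⟩
    exact ⟨c + k, (add_int_mem_cantorLift k).2 hc, by rwa [show y + k - (c + k) = y - c by ring]⟩

lemma nearCantor_fract {ρ y : ℝ} : NearCantor ρ (Int.fract y) ↔ NearCantor ρ y := by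
  have := nearCantor_add_int (ρ := ρ) (y := Int.fract y) ⌊y⌋
  rw [Int.fract_add_floor] at this
  exact this.symm

lemma isOpen_nearCantor (ρ : ℝ) : IsOpen {y | NearCantor ρ y} := by
  have : {y | NearCantor ρ y} = ⋃ c ∈ cantorLift, Metric.ball c ρ := by
    ext y; simp [NearCantor, Metric.mem_ball, Real.dist_eq]
  rw [this]
  exact isOpen_biUnion fun _ _ => Metric.isOpen_ball

/-- A point of the unit interval is as near to the Cantor set as to its lift. -/
lemma NearCantor.exists_mem_cantorSet {ρ y : ℝ} (h : NearCantor ρ y) (h0 : 0 ≤ y) (h1 : y ≤ 1) :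
    ∃ c ∈ cantorSet, |y - c| < ρ := by
  obtain ⟨c, hc, h⟩ := h
  rcases lt_or_ge c 0 with hc0 | hc0
  · refine ⟨0, zero_mem_cantorSet, ?_⟩
    rw [abs_of_nonneg (by linarith)] at h ⊢
    linarith
  · rcases lt_or_ge 1 c with hc1 | hc1
    · refine ⟨1, one_mem_cantorSet, ?_⟩
      rw [abs_of_nonpos (by linarith)] at h ⊢
      linarith
    · exact ⟨c, mem_cantorSet_of_lift hc hc0 hc1, h⟩

/-- The Cantor set is covered by `2 ^ N` intervals of length `3 ^ (-N)`. -/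
lemma exists_cantor_cover (N : ℕ) : ∃ S : Finset ℝ, S.card ≤ 2 ^ N ∧
    ∀ c ∈ cantorSet, ∃ a ∈ S, a ≤ c ∧ c ≤ a + (1 / 3) ^ N := by
  classical
  induction N with
  | zero =>
    refine ⟨{0}, by simp, fun c hc => ⟨0, by simp, ?_⟩⟩
    simpa using cantorSet_subset_unitInterval hc
  | succ N ih =>
    obtain ⟨S, hS, hc⟩ := ih
    refine ⟨S.image (fun a => a / 3) ∪ S.image (fun a => (2 + a) / 3), ?_, ?_⟩
    · refine (Finset.card_union_le _ _).trans ?_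
      have h1 := Finset.card_image_le (s := S) (f := fun a => a / 3)
      have h2 := Finset.card_image_le (s := S) (f := fun a => (2 + a) / 3)
      rw [pow_succ]; omega
    · intro c hcc
      rw [cantorSet_eq_union_halves] at hcc
      rcases hcc with ⟨x, hx, rfl⟩ | ⟨x, hx, rfl⟩ <;> obtain ⟨a, ha, h1, h2⟩ := hc x hx
      · refine ⟨a / 3, Finset.mem_union_left _ (Finset.mem_image_of_mem _ ha), ?_, ?_⟩
        · simp only; linarith
        · simp only; rw [pow_succ]; linarith
      · refine ⟨(2 + a) / 3, Finset.mem_union_right _ (Finset.mem_image_of_mem _ ha), ?_, ?_⟩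
        · simp only; linarith
        · simp only; rw [pow_succ]; linarith

/-- The `2 ^ N` covering intervals, enlarged by their own length on both sides, have total length at
most `3 (2/3) ^ N`. -/
lemma volume_nearCantor_le (N : ℕ) {ρ : ℝ} (hρ : ρ ≤ (1 / 3) ^ N) :
    volume ({y | NearCantor ρ y} ∩ Set.Icc 0 1) ≤ ENNReal.ofReal (3 * (2 / 3) ^ N) := by
  obtain ⟨S, hS, hc⟩ := exists_cantor_cover N
  have hsub : {y | NearCantor ρ y} ∩ Set.Icc 0 1 ⊆
      ⋃ a ∈ S, Set.Icc (a - (1 / 3) ^ N) (a + 2 * (1 / 3) ^ N) := by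
    rintro y ⟨hy, hy0, hy1⟩
    obtain ⟨c, hcc, h⟩ := hy.exists_mem_cantorSet hy0 hy1
    obtain ⟨a, ha, h1, h2⟩ := hc c hcc
    rw [abs_lt] at h
    exact Set.mem_biUnion ha ⟨by linarith, by linarith⟩
  refine (measure_mono hsub).trans ((measure_biUnion_finset_le _ _).trans ?_)
  simp only [Real.volume_Icc]
  rw [Finset.sum_congr rfl fun a _ => by
    rw [show a + 2 * (1 / 3 : ℝ) ^ N - (a - (1 / 3) ^ N) = 3 * (1 / 3) ^ N by ring],
    Finset.sum_const, nsmul_eq_mul]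
  rw [← ENNReal.ofReal_natCast, ← ENNReal.ofReal_mul (by positivity)]
  refine ENNReal.ofReal_le_ofReal ?_
  have h2 : (S.card : ℝ) ≤ 2 ^ N := by exact_mod_cast hS
  calc (S.card : ℝ) * (3 * (1 / 3) ^ N) ≤ 2 ^ N * (3 * (1 / 3) ^ N) := by gcongr
    _ = 3 * (2 / 3) ^ N := by rw [div_pow, div_pow]; ring

lemma exists_small_nearCantor {ε : ℝ} (hε : 0 < ε) : ∃ ρ > 0, ∀ ρ' ≤ ρ,
    volume ({y | NearCantor ρ' y} ∩ Set.Icc 0 1) ≤ ENNReal.ofReal ε := by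
  have : Tendsto (fun N : ℕ => 3 * (2 / 3 : ℝ) ^ N) atTop (𝓝 (3 * 0)) :=
    (tendsto_pow_atTop_nhds_zero_of_lt_one (by norm_num) (by norm_num)).const_mul 3
  rw [mul_zero] at this
  obtain ⟨N, hN⟩ := ((tendsto_order.1 this).2 ε hε).exists
  exact ⟨(1 / 3) ^ N, by positivity, fun ρ' h =>
    (volume_nearCantor_le N h).trans (ENNReal.ofReal_le_ofReal hN.le)⟩

/-! ### The one-dimensional functions of the construction -/

/-- A monotone circle map which is tangent to the identity on the Cantor set, lies above the
identity, and is constant away from the Cantor set. -/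
lemma exists_monotone_tangent {w : ℝ} (hw : 0 < w) : ∃ E E' : ℝ → ℝ, ContDiff ℝ ∞ E ∧
    (∀ y, HasDerivAt E (E' y) y) ∧ (∀ y, E (y + 1) = E y + 1) ∧ (∀ y, 0 ≤ E' y) ∧
    (∀ y, y ≤ E y) ∧ (∀ y ∈ cantorLift, E y = y ∧ E' y = 1) ∧
    ∀ y, E' y ≠ 0 → NearCantor w y := by
  obtain ⟨N, hN⟩ := exists_pow_lt_of_lt_one hw (show (1 / 3 : ℝ) < 1 by norm_num)
  set η := min (w / 2) (1 / 4) with hη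
  have hη0 : 0 < η := lt_min (by linarith) (by norm_num)
  have hη1 : η < 1 / 2 := (min_le_right _ _).trans_lt (by norm_num)
  have hηw : η < w := (min_le_left _ _).trans_lt (by linarith)
  obtain ⟨B, B', hB, hd, hB0, hB1, hv, hv', hm⟩ := exists_gap_profile hη0 hη1
  have hv0 := hv.mono (show (0 : ℝ) ≤ η / 4 by positivity)
  have hv0' := hv'.mono (show (0 : ℝ) ≤ η / 4 by positivity)
  have hP := vanishesNear_gapSum (show 0 < η / 4 by positivity) (by linarith) hv (1 / 3) N
  have hpos : 0 < η / 4 / 3 ^ N := by positivity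
  -- The derivative `1 + gapSum 1 B' N` vanishes in the middle of each treated gap because `B' = -1`
  -- there, and `B ≥ 0` puts the function above the identity.
  refine ⟨fun y => y + gapSum (1 / 3) B N (Int.fract y), fun y => 1 + gapSum 1 B' N (Int.fract y),
    contDiff_id.add (contDiff_comp_fract hpos hP (contDiff_gapSum hB _ N)),
    fun y => (hasDerivAt_id y).add (hasDerivAt_comp_fract hpos hP (hasDerivAt_gapSum hd N) y),
    ?_, ?_, ?_, ?_, ?_⟩
  · intro y; simp only [Int.fract_add_one]; ring
  · intro y
    have := gapSum_one_mem hv0' (s := Set.Ici (-1)) (by simp) hB1 N (Int.fract y)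
    simp only [Set.mem_Ici] at this
    linarith
  · intro y
    have := gapSum_nonneg hB0 (show (0 : ℝ) ≤ 1 / 3 by norm_num) N (Int.fract y)
    simp only
    linarith
  · intro y hy
    have hc := mem_cantorSet_of_lift (fract_mem_cantorLift.2 hy) (Int.fract_nonneg y)
      (Int.fract_lt_one y).le
    simp [gapSum_eq_zero_of_mem hv0 _ N _ hc, gapSum_eq_zero_of_mem hv0' _ N _ hc]
  · intro y hy
    have : gapSum 1 B' N (Int.fract y) ≠ -1 := fun h => hy (by simp [h])
    obtain ⟨c, hc, h⟩ := exists_near_of_gapSum_ne hv0' hm N _ (Int.fract_nonneg y)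
      (Int.fract_lt_one y).le this
    exact nearCantor_fract.1 ⟨c, cantorSet_subset_lift hc, h.trans_lt (max_lt hηw hN)⟩

/-- A two-level bound: the large value `M` is paid only on the neighbourhood, of measure at most
`v`, and `ε` elsewhere. -/
lemma integral_le_of_support_near {g : ℝ → ℝ} {ρ ε : ℝ} (hg : Continuous g)
    {M : ℝ} (hM : 0 ≤ M) (h1 : ∀ y, NearCantor ρ y → g y ≤ M)
    (hn : ∀ y, ¬ NearCantor ρ y → g y ≤ ε) (hε : 0 ≤ ε) {v : ℝ} (hv : 0 ≤ v)
    (hvol : volume ({y | NearCantor ρ y} ∩ Set.Icc 0 1) ≤ ENNReal.ofReal v) :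
    ∫ y in (0 : ℝ)..1, g y ≤ M * v + ε := by
  have hmeas : MeasurableSet {y | NearCantor ρ y} := (isOpen_nearCantor ρ).measurableSet
  have hind : IntegrableOn (Set.indicator {y | NearCantor ρ y} fun _ => M) (Set.Icc 0 1) volume :=
    (integrableOn_const (by simp)).indicator hmeas
  have hle : ∫ y in Set.Icc (0 : ℝ) 1, g y ≤
      ∫ y in Set.Icc (0 : ℝ) 1, (Set.indicator {y | NearCantor ρ y} (fun _ => M) y + ε) := by
    refine setIntegral_mono (hg.integrableOn_Icc) (hind.add (integrableOn_const (by simp)))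
      fun y => ?_
    by_cases hy : NearCantor ρ y
    · simp only [Set.indicator, Set.mem_ofPred_eq, hy, if_true]
      linarith [h1 y hy]
    · simp only [Set.indicator, Set.mem_ofPred_eq, hy, if_false]
      linarith [hn y hy]
  rw [intervalIntegral.integral_of_le (by norm_num), ← integral_Icc_eq_integral_Ioc]
  refine hle.trans ?_
  rw [integral_add hind (integrableOn_const (by simp)), integral_indicator hmeas]
  simp only [integral_const, MeasurableSet.univ, measureReal_restrict_apply, Set.univ_inter,
    Real.volume_real_Icc, smul_eq_mul, Measure.restrict_restrict hmeas]
  have : volume.real ({y | NearCantor ρ y} ∩ Set.Icc 0 1) ≤ v := by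
    rw [Measure.real]
    exact ENNReal.toReal_le_of_le_ofReal hv hvol
  norm_num
  nlinarith

/-- A periodic bump on a small neighbourhood of the Cantor set. -/
lemma exists_cantor_bump {ρ m₀ : ℝ} (hρ : 0 < ρ) (hm : 0 < m₀) : ∃ g : ℝ → ℝ, ContDiff ℝ ∞ g ∧
    (∀ y, g (y + 1) = g y) ∧ (∀ y, 0 ≤ g y) ∧ (∀ y, g y ≤ 1) ∧ (∀ y ∈ cantorLift, g y = 1) ∧
    (∀ y, g y ≠ 0 → NearCantor ρ y) ∧ ∫ y in (0 : ℝ)..1, g y ≤ m₀ := by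
  obtain ⟨ρ', hρ'0, hρ'⟩ := exists_small_nearCantor hm
  set w := min ρ ρ' with hw'
  have hw : 0 < w := lt_min hρ hρ'0
  obtain ⟨N, hN⟩ := exists_pow_lt_of_lt_one hw (show (1 / 3 : ℝ) < 1 by norm_num)
  set η := min (w / 2) (1 / 4) with hη
  have hη0 : 0 < η := lt_min (by linarith) (by norm_num)
  have hη1 : η < 1 / 2 := (min_le_right _ _).trans_lt (by norm_num)
  have hηw : η < w := (min_le_left _ _).trans_lt (by linarith)
  have hv := vanishesNear_plateau hη0
  have hv0 := hv.mono (show (0 : ℝ) ≤ η / 2 by positivity)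
  have hP := vanishesNear_gapSum (show 0 < η / 2 by positivity) (by linarith) hv 1 N
  have hpos : 0 < η / 2 / 3 ^ N := by positivity
  have hs : ContDiff ℝ ∞ fun y => 1 - gapSum 1 (plateau η) N (Int.fract y) :=
    contDiff_const.sub (contDiff_comp_fract hpos hP (contDiff_gapSum (contDiff_plateau η) _ N))
  have hmem := fun y => gapSum_one_mem hv0 (s := Set.Icc 0 1) (by simp)
    (fun y => ⟨plateau_nonneg η y, plateau_le_one η y⟩) N (Int.fract y)
  have hnear : ∀ y, 1 - gapSum 1 (plateau η) N (Int.fract y) ≠ 0 → NearCantor w y := by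
    intro y hy
    have : gapSum 1 (plateau η) N (Int.fract y) ≠ 1 := fun h => hy (by simp [h])
    obtain ⟨c, hc, h⟩ := exists_near_of_gapSum_ne hv0
      (fun y h1 h2 => plateau_eq_one hη0 h1 h2) N _ (Int.fract_nonneg y)
      (Int.fract_lt_one y).le this
    exact nearCantor_fract.1 ⟨c, cantorSet_subset_lift hc, h.trans_lt (max_lt hηw hN)⟩
  refine ⟨fun y => 1 - gapSum 1 (plateau η) N (Int.fract y), hs, ?_, ?_, ?_, ?_, ?_, ?_⟩
  · intro y; simp only [Int.fract_add_one]
  · intro y; linarith [(hmem y).2]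
  · intro y; linarith [(hmem y).1]
  · intro y hy
    have hc := mem_cantorSet_of_lift (fract_mem_cantorLift.2 hy) (Int.fract_nonneg y)
      (Int.fract_lt_one y).le
    simp [gapSum_eq_zero_of_mem hv0 _ N _ hc]
  · exact fun y hy => (hnear y hy).mono (min_le_left _ _)
  · have := integral_le_of_support_near (ρ := w) (ε := 0) (M := 1) hs.continuous
      (by norm_num) (fun y _ => by linarith [(hmem y).1])
      (fun y hy => ?_) le_rfl hm.le (hρ' w (min_le_right _ _))
    · linarith
    · by_contra h
      exact hy (hnear y (by intro h'; rw [h'] at h; exact h le_rfl))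

lemma integral_period {f : ℝ → ℝ} (hf : ∀ y, f (y + 1) = f y) (y : ℝ) :
    ∫ t in y..(y + 1), f t = ∫ t in (0 : ℝ)..1, f t := by
  have := Function.Periodic.intervalIntegral_add_eq (f := f) (T := 1) hf y 0
  simpa using this

lemma apply_fract_of_periodic {α : Type*} {f : ℝ → α} (hf : ∀ y, f (y + 1) = f y) (y : ℝ) :
    f (Int.fract y) = f y := by
  have h : Function.Periodic f 1 := hf
  have := h.sub_int_mul_eq (x := y) ⌊y⌋
  rw [mul_one] at this
  exact this

/-- A small periodic function whose derivative nearly vanishes off a neighbourhood of the Cantor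
set, and is nearly `1` on it. -/
lemma exists_small_primitive {ρ m₀ : ℝ} (hρ : 0 < ρ) (hm : 0 < m₀) : ∃ χ χ' : ℝ → ℝ,
    ContDiff ℝ ∞ χ ∧ ContDiff ℝ ∞ χ' ∧ (∀ y, HasDerivAt χ (χ' y) y) ∧ (∀ y, χ (y + 1) = χ y) ∧
    (∀ y, χ' (y + 1) = χ' y) ∧
    (∀ y, |χ y| ≤ m₀) ∧ (∀ y, -m₀ ≤ χ' y ∧ χ' y ≤ 1) ∧ (∀ y ∈ cantorLift, |χ' y - 1| ≤ m₀) ∧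
    ∀ y, ¬ NearCantor ρ y → |χ' y| ≤ m₀ := by
  obtain ⟨g, hg, hper, h0, h1, hC, hn, hint⟩ := exists_cantor_bump hρ hm
  set m := ∫ y in (0 : ℝ)..1, g y with hmdef
  have hii : ∀ a b : ℝ, IntervalIntegrable g volume a b := fun a b =>
    hg.continuous.intervalIntegrable a b
  have hm0 : 0 ≤ m := intervalIntegral.integral_nonneg (by norm_num) fun y _ => h0 y
  have hs : ContDiff ℝ ∞ fun y => g y - m := hg.sub contDiff_const
  have hχ : ∀ y, ∫ t in (0 : ℝ)..y, (g t - m) = (∫ t in (0 : ℝ)..y, g t) - m * y := by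
    intro y
    rw [intervalIntegral.integral_sub (hii _ _) (by simp)]
    simp [mul_comm]
  have hp : ∀ y, ∫ t in (0 : ℝ)..(y + 1), (g t - m) = ∫ t in (0 : ℝ)..y, (g t - m) := by
    intro y
    rw [hχ, hχ, ← intervalIntegral.integral_add_adjacent_intervals (hii 0 y) (hii y (y + 1)),
      integral_period hper]
    ring
  -- Subtracting the mean `m` of the bump makes the primitive periodic. It is bounded by `m ≤ m₀`,
  -- because on a period both `∫ g` and `m y` lie in `[0, m]`.
  refine ⟨fun y => ∫ t in (0 : ℝ)..y, (g t - m), fun y => g y - m, contDiff_integral hs, hs,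
    fun y => hasDerivAt_integral hs.continuous y, hp, fun y => by simp only [hper], ?_, ?_, ?_, ?_⟩
  · intro y
    have := apply_fract_of_periodic (f := fun y => ∫ t in (0 : ℝ)..y, (g t - m)) hp y
    show |∫ t in (0 : ℝ)..y, (g t - m)| ≤ m₀
    rw [← this]
    show |∫ t in (0 : ℝ)..(Int.fract y), (g t - m)| ≤ m₀
    set z := Int.fract y
    have hz0 : 0 ≤ z := Int.fract_nonneg y
    have hz1 : z ≤ 1 := (Int.fract_lt_one y).le
    rw [hχ]
    have e1 : 0 ≤ ∫ t in (0 : ℝ)..z, g t := intervalIntegral.integral_nonneg hz0 fun y _ => h0 y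
    have e2 : 0 ≤ ∫ t in z..1, g t := intervalIntegral.integral_nonneg hz1 fun y _ => h0 y
    have e3 := intervalIntegral.integral_add_adjacent_intervals (hii 0 z) (hii z 1)
    rw [← hmdef] at e3
    have e4 : m * z ≤ m := mul_le_of_le_one_right hm0 hz1
    have e5 : 0 ≤ m * z := mul_nonneg hm0 hz0
    rw [abs_le]
    constructor <;> linarith
  · intro y
    constructor <;> linarith [h0 y, h1 y]
  · intro y hy
    show |g y - m - 1| ≤ m₀
    rw [hC y hy, show (1 : ℝ) - m - 1 = -m by ring, abs_neg, abs_of_nonneg hm0]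
    exact hint
  · intro y hy
    have : g y = 0 := by
      by_contra h
      exact hy (hn y h)
    show |g y - m| ≤ m₀
    rw [this, zero_sub, abs_neg, abs_of_nonneg hm0]
    exact hint

/-- A circle map with derivative `1` at `0` which makes nearly all of its turn near `0`. -/
lemma exists_fast_rotation {δ r : ℝ} (hδ : 0 < δ) (hδ1 : δ < 1) (hr : 0 < r) :
    ∃ R R' : ℝ → ℝ, ContDiff ℝ ∞ R ∧ (∀ y, HasDerivAt R (R' y) y) ∧
    (∀ y, R (y + 1) = R y + 1) ∧ R 0 = 0 ∧ R' 0 = 1 ∧ (∀ y, δ ≤ R' y) ∧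
    ∀ y : ℝ, (∀ k : ℤ, r ≤ |y - k|) → R' y = δ := by
  set η := min r (1 / 4) with hη
  have hη0 : 0 < η := lt_min hr (by norm_num)
  have hηr : η ≤ r := min_le_left _ _
  have hη1 : η ≤ 1 / 4 := min_le_right _ _
  have hv := vanishesNear_plateau hη0
  set β : ℝ → ℝ := fun y => 1 - plateau η (Int.fract y) with hβ
  have hβs : ContDiff ℝ ∞ β := contDiff_const.sub (contDiff_comp_fract (by positivity) hv
    (contDiff_plateau η))
  have hβ0 : ∀ y, 0 ≤ β y := fun y => by simp only [hβ]; linarith [plateau_le_one η (Int.fract y)]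
  have hβ1 : ∀ y, β y ≤ 1 := fun y => by simp only [hβ]; linarith [plateau_nonneg η (Int.fract y)]
  have hβp : ∀ y, β (y + 1) = β y := fun y => by simp only [hβ, Int.fract_add_one]
  have hβz : ∀ y, 0 ≤ y → y < 1 → y ≤ η / 2 → β y = 1 := fun y h0 h1 h => by
    simp only [hβ]
    rw [Int.fract_eq_self.2 ⟨h0, h1⟩, hv _ (Or.inl h), sub_zero]
  have hβr : ∀ y : ℝ, (∀ k : ℤ, r ≤ |y - k|) → β y = 0 := by
    intro y hy
    simp only [hβ]
    have h1 := hy ⌊y⌋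
    have h2 := hy (⌊y⌋ + 1)
    have h3 := Int.fract_nonneg y
    have h4 := Int.fract_lt_one y
    rw [abs_of_nonneg (by linarith [Int.floor_le y])] at h1
    rw [abs_of_nonpos (by push_cast; linarith [Int.lt_floor_add_one y])] at h2
    push_cast at h2
    rw [plateau_eq_one hη0, sub_self]
    · rw [Int.fract]; linarith
    · rw [Int.fract]; linarith
  -- The factor `1 - cos` vanishes at the integers, so adding a multiple of `γ` adjusts the total
  -- integral without changing the derivative at `0`.
  set γ : ℝ → ℝ := fun y => β y * (1 - Real.cos (2 * Real.pi * y)) with hγ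
  have hγs : ContDiff ℝ ∞ γ := hβs.mul (contDiff_const.sub (Real.contDiff_cos.comp (by fun_prop)))
  have hγ0 : ∀ y, 0 ≤ γ y := fun y => mul_nonneg (hβ0 y) (by linarith [Real.cos_le_one (2 * Real.pi * y)])
  have hγp : ∀ y, γ (y + 1) = γ y := fun y => by
    simp only [hγ, hβp]
    rw [mul_add, mul_one, Real.cos_add_two_pi]
  have hγpos : 0 < ∫ y in (0 : ℝ)..1, γ y := by
    refine integral_pos_of_continuous hγs.continuous hγ0 (x := η / 4)
      ⟨by positivity, by linarith⟩ ?_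
    simp only [hγ]
    rw [hβz _ (by positivity) (by linarith) (by linarith), one_mul, sub_pos]
    have : Real.cos (2 * Real.pi * (η / 4)) < Real.cos 0 := by
      refine Real.cos_lt_cos_of_nonneg_of_le_pi le_rfl ?_ (by positivity)
      nlinarith [Real.pi_pos]
    rwa [Real.cos_zero] at this
  have hβi : ∫ y in (0 : ℝ)..1, β y ≤ 1 := by
    have := intervalIntegral.integral_mono_on (by norm_num) (hβs.continuous.intervalIntegrable 0 1)
      (continuous_const.intervalIntegrable (μ := volume) 0 1) fun y _ => hβ1 y
    simpa using this
  -- This makes `β + c γ` of integral `1`, so the mixture with the constant `δ` has degree one.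
  set c := (1 - ∫ y in (0 : ℝ)..1, β y) / ∫ y in (0 : ℝ)..1, γ y with hc
  have hc0 : 0 ≤ c := div_nonneg (by linarith) hγpos.le
  set R' : ℝ → ℝ := fun y => δ + (1 - δ) * (β y + c * γ y) with hR'
  have hR's : ContDiff ℝ ∞ R' :=
    contDiff_const.add (contDiff_const.mul (hβs.add (contDiff_const.mul hγs)))
  have hint : ∫ y in (0 : ℝ)..1, R' y = 1 := by
    have i1 : IntervalIntegrable (fun y => c * γ y) volume 0 1 :=
      (continuous_const.mul hγs.continuous).intervalIntegrable _ _
    have i2 : IntervalIntegrable (fun y => (1 - δ) * (β y + c * γ y)) volume 0 1 :=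
      (continuous_const.mul (hβs.continuous.add
        (continuous_const.mul hγs.continuous))).intervalIntegrable _ _
    simp only [hR']
    rw [intervalIntegral.integral_add (by simp) i2, intervalIntegral.integral_const_mul,
      intervalIntegral.integral_add (hβs.continuous.intervalIntegrable _ _) i1,
      intervalIntegral.integral_const_mul, hc, div_mul_cancel₀ _ hγpos.ne']
    simp
  have hii : ∀ a b : ℝ, IntervalIntegrable R' volume a b := fun a b =>
    hR's.continuous.intervalIntegrable a b
  refine ⟨fun y => ∫ t in (0 : ℝ)..y, R' t, R', contDiff_integral hR's,
    fun y => hasDerivAt_integral hR's.continuous y, ?_, by simp, ?_, ?_, ?_⟩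
  · intro y
    simp only
    rw [← intervalIntegral.integral_add_adjacent_intervals (hii 0 y) (hii y (y + 1)),
      integral_period (fun y => by simp only [hR', hβp, hγp]), hint]
  · have := hβz 0 le_rfl (by norm_num) (by positivity)
    simp only [hR', hγ, this]
    simp
  · intro y
    have : 0 ≤ (1 - δ) * (β y + c * γ y) :=
      mul_nonneg (by linarith) (add_nonneg (hβ0 y) (mul_nonneg hc0 (hγ0 y)))
    simp only [hR']
    linarith
  · intro y hy
    simp only [hR', hγ, hβr y hy]
    simp

end AbC

namespace AbC

/-! ### Maps of the torus and of the plane -/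

lemma proj_eq_iff {x y : ℝ × ℝ} :
    proj x = proj y ↔ ∃ k l : ℤ, x.1 = y.1 + k ∧ x.2 = y.2 + l := by
  simp only [proj, Prod.mk.injEq, coe_eq_coe_iff]
  constructor
  · rintro ⟨⟨k, hk⟩, ⟨l, hl⟩⟩; exact ⟨k, l, hk, hl⟩
  · rintro ⟨k, l, hk, hl⟩; exact ⟨⟨k, hk⟩, ⟨l, hl⟩⟩

@[simp] lemma proj_add_int_left (x y : ℝ) (k : ℤ) : proj (x + k, y) = proj (x, y) := by
  simp [proj]

@[simp] lemma proj_add_int_right (x y : ℝ) (k : ℤ) : proj (x, y + k) = proj (x, y) := by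
  simp [proj]

@[simp] lemma proj_add_one_left (x y : ℝ) : proj (x + 1, y) = proj (x, y) := by
  simpa using proj_add_int_left x y 1

@[fun_prop] lemma continuous_proj : Continuous proj := by
  unfold proj
  exact ((AddCircle.continuous_mk' 1).comp continuous_fst).prodMk
    ((AddCircle.continuous_mk' 1).comp continuous_snd)

lemma exists_proj_eq (z : Torus) : ∃ x : ℝ × ℝ, (0 ≤ x.1 ∧ x.1 < 1 ∧ 0 ≤ x.2 ∧ x.2 < 1) ∧
    proj x = z := by
  obtain ⟨a, ha, h1⟩ := AddCircle.eq_coe_Ico z.1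
  obtain ⟨b, hb, h2⟩ := AddCircle.eq_coe_Ico z.2
  exact ⟨(a, b), ⟨ha.1, ha.2, hb.1, hb.2⟩, Prod.ext h1 h2⟩

lemma proj_surjective : Function.Surjective proj := fun z =>
  let ⟨x, _, h⟩ := exists_proj_eq z
  ⟨x, h⟩

/-- The map of the plane respects the fibres of the covering map. -/
def Descends (L : ℝ × ℝ → ℝ × ℝ) : Prop := ∀ x y, proj x = proj y → proj (L x) = proj (L y)

/-- The torus map induced by a map of the plane. -/
noncomputable def descend (L : ℝ × ℝ → ℝ × ℝ) (z : Torus) : Torus :=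
  proj (L (Function.surjInv proj_surjective z))

lemma descend_proj {L : ℝ × ℝ → ℝ × ℝ} (hL : Descends L) (x : ℝ × ℝ) :
    descend L (proj x) = proj (L x) :=
  hL _ _ (Function.surjInv_eq proj_surjective _)

lemma isLift_descend {L : ℝ × ℝ → ℝ × ℝ} (hL : Descends L) : IsLift L (descend L) :=
  fun x => (descend_proj hL x).symm

lemma IsLift.descends {L : ℝ × ℝ → ℝ × ℝ} {f : Torus → Torus} (h : IsLift L f) : Descends L :=
  fun x y hxy => by rw [h, h, hxy]

lemma descends_of_periods {L : ℝ × ℝ → ℝ × ℝ} (h1 : ∀ x y, proj (L (x + 1, y)) = proj (L (x, y)))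
    (h2 : ∀ x y, proj (L (x, y + 1)) = proj (L (x, y))) : Descends L := by
  have a1 : ∀ y, Function.Periodic (fun x => proj (L (x, y))) 1 := fun y x => h1 x y
  have a2 : ∀ x, Function.Periodic (fun y => proj (L (x, y))) 1 := fun x y => h2 x y
  rintro ⟨x, y⟩ ⟨x', y'⟩ h
  obtain ⟨k, l, hk, hl⟩ := proj_eq_iff.1 h
  simp only at hk hl
  have b1 := (a1 y).int_mul k x'
  have b2 := (a2 x').int_mul l y'
  simp only [mul_one] at b1 b2
  rw [hk, b1, hl, b2]

/-- The permutation of the torus induced by mutually inverse maps of the plane. -/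
noncomputable def descendPerm (L L' : ℝ × ℝ → ℝ × ℝ) (hL : Descends L) (hL' : Descends L')
    (h1 : ∀ x, proj (L' (L x)) = proj x) (h2 : ∀ x, proj (L (L' x)) = proj x) :
    Equiv.Perm Torus where
  toFun := descend L
  invFun := descend L'
  left_inv z := by
    obtain ⟨x, rfl⟩ := proj_surjective z
    rw [descend_proj hL, descend_proj hL', h1]
  right_inv z := by
    obtain ⟨x, rfl⟩ := proj_surjective z
    rw [descend_proj hL', descend_proj hL, h2]

lemma IsSmooth.continuous {f : Torus → Torus} (h : IsSmooth f) : Continuous f := by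
  obtain ⟨F, hF, hl⟩ := h
  have hq : IsOpenQuotientMap proj :=
    (QuotientAddGroup.isOpenQuotientMap_mk (N := AddSubgroup.zmultiples (1 : ℝ))).prodMap
      (QuotientAddGroup.isOpenQuotientMap_mk (N := AddSubgroup.zmultiples (1 : ℝ)))
  rw [hq.isQuotientMap.continuous_iff]
  have : f ∘ proj = proj ∘ F := funext fun x => (hl x).symm
  rw [this]
  exact continuous_proj.comp hF.continuous

lemma shift_proj (t x y : ℝ) : shift t (proj (x, y)) = proj (x + t, y) := by
  simp [shift, proj]

/-! ### Integrals over the torus -/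

lemma integral_torus {f : Torus → ℝ} (hf : Continuous f) :
    ∫ z, f z = ∫ y in (0 : ℝ)..1, ∫ x in (0 : ℝ)..1, f (proj (x, y)) := by
  have hi : Integrable (fun z : Torus => f z) volume :=
    hf.integrable_of_hasCompactSupport (HasCompactSupport.of_compactSpace _)
  rw [Measure.volume_eq_prod] at hi ⊢
  rw [integral_prod_symm _ hi]
  have h1 := UnitAddCircle.intervalIntegral_preimage 0
    (fun y : UnitAddCircle => ∫ x : UnitAddCircle, f (x, y))
  rw [← h1, zero_add]
  refine intervalIntegral.integral_congr fun y _ => ?_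
  have h2 := UnitAddCircle.intervalIntegral_preimage 0 (fun x : UnitAddCircle => f (x, (y : UnitAddCircle)))
  rw [zero_add] at h2
  exact h2.symm

lemma continuous_intervalIntegral {F : ℝ × ℝ → ℝ} (hF : Continuous F) (a b : ℝ) :
    Continuous fun y => ∫ x in a..b, F (x, y) :=
  intervalIntegral.continuous_parametric_intervalIntegral_of_continuous'
    (f := fun y x => F (x, y)) (hF.comp continuous_swap) a b

lemma integral_swap {F : ℝ × ℝ → ℝ} (hF : Continuous F) :
    ∫ y in (0 : ℝ)..1, ∫ x in (0 : ℝ)..1, F (x, y) = ∫ x in (0 : ℝ)..1, ∫ y in (0 : ℝ)..1, F (x, y) := by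
  simp only [intervalIntegral.integral_of_le zero_le_one]
  refine integral_integral_swap (f := fun y x => F (x, y)) ?_
  rw [Measure.prod_restrict]
  have : IntegrableOn (Function.uncurry fun y x => F (x, y)) (Set.Icc 0 1 ×ˢ Set.Icc 0 1)
      (volume.prod volume) :=
    (hF.comp continuous_swap).continuousOn.integrableOn_compact (isCompact_Icc.prod isCompact_Icc)
  exact this.mono_set (Set.prod_mono Set.Ioc_subset_Icc_self Set.Ioc_subset_Icc_self)

lemma sum_integral_div {φ : ℝ → ℝ} (hφ : Continuous φ) {q : ℕ} (hq : 0 < q) :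
    ∫ t in (0 : ℝ)..1, (1 / q : ℝ) * ∑ j ∈ Finset.range q, φ ((t + j) / q) =
      ∫ t in (0 : ℝ)..1, φ t := by
  have hq' : (q : ℝ) ≠ 0 := by positivity
  have hi : ∀ j ∈ Finset.range q, IntervalIntegrable (fun t : ℝ => φ ((t + j) / q)) volume 0 1 :=
    fun j _ => (by fun_prop : Continuous fun t : ℝ => φ ((t + j) / q)).intervalIntegrable _ _
  rw [intervalIntegral.integral_const_mul, intervalIntegral.integral_finsetSum hi]
  have : ∀ j ∈ Finset.range q, ∫ t in (0 : ℝ)..1, φ ((t + j) / q) =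
      q * ∫ t in ((j : ℕ) : ℝ) / q..((j + 1 : ℕ) : ℝ) / q, φ t := by
    intro j _
    have h1 := intervalIntegral.integral_comp_add_div (a := 0) (b := 1) φ hq' ((j : ℝ) / q)
    rw [smul_eq_mul] at h1
    have e : ∀ t : ℝ, (t + j) / q = (j : ℝ) / q + t / q := fun t => by ring
    simp only [e]
    rw [h1]
    congr 2
    · ring
    · push_cast; ring
  rw [Finset.sum_congr rfl this, ← Finset.mul_sum,
    intervalIntegral.sum_integral_adjacent_intervals (a := fun j : ℕ => (j : ℝ) / q)
      (fun j _ => hφ.intervalIntegrable _ _)]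
  rw [← mul_assoc, one_div, inv_mul_cancel₀ hq', one_mul]
  simp [hq']

lemma sum_range_shift_periodic {φ : ℝ → ℝ} (hp : ∀ x, φ (x + 1) = φ x) {q : ℕ} (hq : 0 < q)
    (t : ℝ) : ∑ j ∈ Finset.range q, φ ((t + 1 + j) / q) = ∑ j ∈ Finset.range q, φ ((t + j) / q) := by
  have hq' : (q : ℝ) ≠ 0 := by positivity
  have h1 := Finset.sum_range_succ (fun j : ℕ => φ ((t + j) / q)) q
  have h2 := Finset.sum_range_succ' (fun j : ℕ => φ ((t + j) / q)) q
  have h3 : φ ((t + q) / q) = φ ((t + (0 : ℕ)) / q) := by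
    rw [add_div, div_self hq', hp]; simp
  rw [h1, h3] at h2
  have h4 := add_right_cancel h2
  rw [h4]
  refine Finset.sum_congr rfl fun j _ => ?_
  push_cast; ring_nf

/-- The mean of a periodic function, computed along the branches of a circle covering. -/
lemma integral_eq_integral_sum_branches {φ p J : ℝ → ℝ} (hφ : Continuous φ)
    (hφp : ∀ x, φ (x + 1) = φ x) (hp : ∀ y, HasDerivAt p (J y) y) (hJ : Continuous J) {q : ℕ}
    (hq : 0 < q) (a : ℝ) (hpp : p (a + 1) = p a + 1) :
    ∫ t in (0 : ℝ)..1, φ t =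
      ∫ y in a..(a + 1), ((1 / q : ℝ) * ∑ j ∈ Finset.range q, φ ((p y + j) / q)) * J y := by
  have := intervalIntegral.integral_comp_mul_deriv (a := a) (b := a + 1) (fun y _ => hp y)
    hJ.continuousOn
    (g := fun t => (1 / q : ℝ) * ∑ j ∈ Finset.range q, φ ((t + j) / q)) (by fun_prop)
  simp only [Function.comp_def] at this
  rw [this, hpp, integral_period (f := fun t => (1 / q : ℝ) * ∑ j ∈ Finset.range q, φ ((t + j) / q)),
    sum_integral_div hφ hq]
  intro y
  simp only [sum_range_shift_periodic hφp hq]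

/-! ### Inverting a family of circle diffeomorphisms -/

/-- The linear map `(x, y) ↦ (x, a x + b y)`. -/
noncomputable def shearEquiv (a b : ℝ) (hb : b ≠ 0) : (ℝ × ℝ) ≃L[ℝ] (ℝ × ℝ) :=
  ContinuousLinearEquiv.equivOfInverse
    ((ContinuousLinearMap.fst ℝ ℝ ℝ).prod
      (a • ContinuousLinearMap.fst ℝ ℝ ℝ + b • ContinuousLinearMap.snd ℝ ℝ ℝ))
    ((ContinuousLinearMap.fst ℝ ℝ ℝ).prod
      (b⁻¹ • (ContinuousLinearMap.snd ℝ ℝ ℝ - a • ContinuousLinearMap.fst ℝ ℝ ℝ)))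
    (fun x => by ext <;> simp; field_simp)
    (fun x => by ext <;> simp; field_simp; ring)

/-- Each fibre map is increasing and unbounded in both directions, hence bijective. Joint smoothness
of the inverse comes from the inverse function theorem for `(x, y) ↦ (x, G(x, y))`, whose
differential is a shear. -/
lemma exists_fibre_inverse {G J : ℝ × ℝ → ℝ} (hG : ContDiff ℝ ∞ G)
    (hd : ∀ x y, HasDerivAt (fun y => G (x, y)) (J (x, y)) y) (hJ : ∀ z, 0 < J z)
    (hp : ∀ x y, G (x, y + 1) = G (x, y) + 1) :
    ∃ K : ℝ × ℝ → ℝ, ContDiff ℝ ∞ K ∧ (∀ x t, G (x, K (x, t)) = t) ∧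
      ∀ x y, K (x, G (x, y)) = y := by
  have hmono : ∀ x, StrictMono fun y => G (x, y) := fun x =>
    strictMono_of_hasDerivAt_pos (hd x) fun y => hJ (x, y)
  have hper : ∀ x (n : ℕ), G (x, n) = G (x, 0) + n ∧ G (x, -n) = G (x, 0) - n := by
    intro x n
    induction n with
    | zero => simp
    | succ n ih =>
      constructor
      · push_cast; rw [hp, ih.1]; ring
      · have := hp x (-(n + 1 : ℕ))
        push_cast at this ⊢
        rw [show -((n : ℝ) + 1) + 1 = -n by ring, ih.2] at this
        linarith
  have hsurj : ∀ x, Function.Surjective fun y => G (x, y) := by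
    intro x
    have hc : Continuous fun y => G (x, y) := hG.continuous.comp (by fun_prop)
    refine hc.surjective ?_ ?_
    · refine tendsto_atTop_atTop_of_monotone (hmono x).monotone fun b => ?_
      obtain ⟨n, hn⟩ := exists_nat_ge (b - G (x, 0))
      exact ⟨n, by simp only [(hper x n).1]; linarith⟩
    · refine tendsto_atBot_atBot_of_monotone (hmono x).monotone fun b => ?_
      obtain ⟨n, hn⟩ := exists_nat_ge (G (x, 0) - b)
      exact ⟨-n, by simp only [(hper x n).2]; linarith⟩
  set A : ℝ × ℝ → ℝ × ℝ := fun z => (z.1, G z) with hA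
  have hAs : ContDiff ℝ ∞ A := contDiff_fst.prodMk hG
  have hbij : Function.Bijective A := by
    constructor
    · rintro ⟨x, y⟩ ⟨x', y'⟩ h
      simp only [hA, Prod.mk.injEq] at h
      obtain ⟨rfl, h⟩ := h
      rw [(hmono x).injective h]
    · rintro ⟨x, t⟩
      obtain ⟨y, hy⟩ := hsurj x t
      exact ⟨(x, y), Prod.ext rfl hy⟩
  have hGd : Differentiable ℝ G := hG.differentiable (by simp)
  have hfd : ∀ z, HasFDerivAt A
      (shearEquiv (fderiv ℝ G z (1, 0)) (J z) (hJ z).ne' : (ℝ × ℝ) →L[ℝ] (ℝ × ℝ)) z := by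
    intro z
    have h1 : fderiv ℝ G z (0, 1) = J z := by
      have h2 : HasDerivAt (fun y => (z.1, y)) ((0 : ℝ), (1 : ℝ)) z.2 :=
        (hasDerivAt_const z.2 z.1).prodMk (hasDerivAt_id z.2)
      have h3 := (hGd z).hasFDerivAt.comp_hasDerivAt_of_eq z.2 h2 rfl
      exact h3.unique (hd z.1 z.2)
    refine (hasFDerivAt_fst.prodMk (hGd z).hasFDerivAt).congr_fderiv ?_
    ext <;> simp [shearEquiv, h1]
  have hopen : IsOpenMap A := isOpenMap_of_hasStrictFDerivAt_equiv fun z =>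
    hAs.contDiffAt.hasStrictFDerivAt' (hfd z) (by simp)
  set e : (ℝ × ℝ) ≃ₜ (ℝ × ℝ) :=
    (Equiv.ofBijective A hbij).toHomeomorphOfContinuousOpen hAs.continuous hopen with he
  have hes : ContDiff ℝ ∞ e.symm := e.contDiff_symm hfd hAs
  have hfst : ∀ x t, (e.symm (x, t)).1 = x ∧ G (x, (e.symm (x, t)).2) = t := by
    intro x t
    have : A (e.symm (x, t)) = (x, t) := e.apply_symm_apply (x, t)
    simp only [hA, Prod.mk.injEq] at this
    refine ⟨this.1, ?_⟩
    convert this.2 using 2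
    exact Prod.ext this.1.symm rfl
  refine ⟨fun z => (e.symm z).2, contDiff_snd.comp hes, fun x t => (hfst x t).2, fun x y => ?_⟩
  exact (hmono x).injective (hfst x (G (x, y))).2

/-! ### Area preserving maps from a pair of functions -/

/-- Two functions of `(c, Y)` which induce an area preserving map
`(P / q, c) ↦ (Q / q, Y)`. -/
structure IsGeneratingPair (P Q J : ℝ × ℝ → ℝ) : Prop where
  smooth_left : ContDiff ℝ ∞ P
  smooth_right : ContDiff ℝ ∞ Q
  continuous_density : Continuous J
  left_add_one_fst : ∀ c Y, P (c + 1, Y) = P (c, Y) - 1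
  left_add_one_snd : ∀ c Y, P (c, Y + 1) = P (c, Y) + 1
  right_add_one_fst : ∀ c Y, Q (c + 1, Y) = Q (c, Y) - 1
  right_add_one_snd : ∀ c Y, Q (c, Y + 1) = Q (c, Y) + 1
  hasDerivAt_left : ∀ c Y, HasDerivAt (fun Y => P (c, Y)) (J (c, Y)) Y
  hasDerivAt_right : ∀ c Y, HasDerivAt (fun c => Q (c, Y)) (-J (c, Y)) c
  density_pos : ∀ z, 0 < J z

lemma isAreaPreservingDiffeo_of_integral {h : Equiv.Perm Torus} (h1 : IsSmooth h)
    (h2 : IsSmooth h.symm) (hi : ∀ f : C(Torus, ℝ), ∫ z, f (h z) = ∫ z, f z) :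
    IsAreaPreservingDiffeo h := by
  refine ⟨h1, h2, h1.continuous.measurable, ?_⟩
  have : IsFiniteMeasure (Measure.map h (volume : Measure Torus)) :=
    Measure.isFiniteMeasure_map _ _
  refine ext_of_forall_integral_eq_of_IsFiniteMeasure fun f => ?_
  rw [integral_map h1.continuous.measurable.aemeasurable f.continuous.aestronglyMeasurable]
  exact hi f.toContinuousMap

/-- For fixed `c` the first function is invertible in `Y`, and for fixed `Y` the second is
invertible in `c`; this produces the map and its inverse. Adding `j` to both functions amounts to
translating by `j / q` on both sides, whence the commutation. Area is preserved because both partial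
derivatives have absolute value `J`. -/
lemma IsGeneratingPair.exists_diffeo {P Q J : ℝ × ℝ → ℝ} (hG : IsGeneratingPair P Q J) {q : ℕ}
    (hq : 0 < q) : ∃ h : Equiv.Perm Torus, IsAreaPreservingDiffeo h ∧
      (∀ p : ℤ, Commute h (shift (p / q))) ∧
      ∀ c Y (j : ℤ), h (proj ((P (c, Y) + j) / q, c)) = proj ((Q (c, Y) + j) / q, Y) := by
  have hq' : (q : ℝ) ≠ 0 := by positivity
  obtain ⟨K, hK, hK1, hK2⟩ := exists_fibre_inverse hG.smooth_left hG.hasDerivAt_left hG.density_pos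
    hG.left_add_one_snd
  -- The second function decreases in `c`, so its negative is inverted, with the two variables
  -- exchanged.
  obtain ⟨M, hM, hM1, hM2⟩ := exists_fibre_inverse (G := fun z => -Q (z.2, z.1))
    (J := fun z => J (z.2, z.1)) (hG.smooth_right.comp (contDiff_snd.prodMk contDiff_fst)).neg
    (fun x y => (hG.hasDerivAt_right y x).neg.congr_deriv (neg_neg _)) (fun z => hG.density_pos _)
    (fun x y => by simp only [hG.right_add_one_fst]; ring)
  simp only at hM1 hM2
  set L : ℝ × ℝ → ℝ × ℝ := fun z => (Q (z.2, K (z.2, q * z.1)) / q, K (z.2, q * z.1)) with hL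
  set L' : ℝ × ℝ → ℝ × ℝ := fun z => (P (M (z.2, -(q * z.1)), z.2) / q, M (z.2, -(q * z.1))) with hL'
  have hLP : ∀ c Y, L (P (c, Y) / q, c) = (Q (c, Y) / q, Y) := by
    intro c Y; simp only [hL]; rw [mul_div_cancel₀ _ hq', hK2]
  have hLQ : ∀ c Y, L' (Q (c, Y) / q, Y) = (P (c, Y) / q, c) := by
    intro c Y; simp only [hL']; rw [mul_div_cancel₀ _ hq', hM2]
  have hPper : ∀ c Y (j : ℤ), P (c, Y + j) = P (c, Y) + j := by
    intro c Y j
    have : Function.Periodic (fun Y => P (c, Y) - Y) 1 := fun Y => by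
      simp only [hG.left_add_one_snd]; ring
    have := this.int_mul j Y
    simp only [mul_one] at this
    linarith
  have hQper : ∀ c Y (j : ℤ), Q (c, Y + j) = Q (c, Y) + j := by
    intro c Y j
    have : Function.Periodic (fun Y => Q (c, Y) - Y) 1 := fun Y => by
      simp only [hG.right_add_one_snd]; ring
    have := this.int_mul j Y
    simp only [mul_one] at this
    linarith
  have hsurj : ∀ z : ℝ × ℝ, ∃ c Y, z = (P (c, Y) / q, c) := fun z =>
    ⟨z.2, K (z.2, q * z.1), Prod.ext (by simp only [hK1]; field_simp) rfl⟩
  have hsurj' : ∀ z : ℝ × ℝ, ∃ c Y, z = (Q (c, Y) / q, Y) := fun z =>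
    ⟨M (z.2, -(q * z.1)), z.2, Prod.ext
      (by have := hM1 z.2 (-(q * z.1)); simp only; rw [neg_inj] at this; rw [this]; field_simp) rfl⟩
  have hLj : ∀ c Y (j : ℤ), proj (L ((P (c, Y) + j) / q, c)) = proj ((Q (c, Y) + j) / q, Y) := by
    intro c Y j
    rw [← hPper, ← hQper, hLP, proj_add_int_right]
  have hPper' : ∀ c Y (j : ℤ), P (c - j, Y) = P (c, Y) + j := by
    intro c Y j
    have : Function.Periodic (fun c => P (c, Y) + c) 1 := fun c => by
      simp only [hG.left_add_one_fst]; ring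
    have := this.sub_int_mul_eq (x := c) j
    simp only [mul_one] at this
    linarith
  have hQper' : ∀ c Y (j : ℤ), Q (c - j, Y) = Q (c, Y) + j := by
    intro c Y j
    have : Function.Periodic (fun c => Q (c, Y) + c) 1 := fun c => by
      simp only [hG.right_add_one_fst]; ring
    have := this.sub_int_mul_eq (x := c) j
    simp only [mul_one] at this
    linarith
  have hL'j : ∀ c Y (j : ℤ), proj (L' ((Q (c, Y) + j) / q, Y)) = proj ((P (c, Y) + j) / q, c) := by
    intro c Y j
    rw [← hPper', ← hQper', hLQ, ← proj_add_int_right _ _ j, sub_add_cancel]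
  have hdL : Descends L := by
    refine descends_of_periods (fun x y => ?_) (fun x y => ?_) <;>
      obtain ⟨c, Y, h⟩ := hsurj (x, y) <;> obtain ⟨rfl, rfl⟩ := Prod.mk.injEq _ _ _ _ ▸ h
    · have h1 := hLj y Y q
      have h2 := hLj y Y 0
      simp only [Int.cast_natCast, Int.cast_zero, add_zero, add_div, div_self hq'] at h1 h2
      rw [h1, h2, proj_add_one_left]
    · have h1 := hLj (y + 1) Y 1
      have h2 := hLj y Y 0
      simp only [hG.left_add_one_fst, hG.right_add_one_fst, Int.cast_one, Int.cast_zero, add_zero,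
        sub_add_cancel] at h1 h2
      rw [h1, h2]
  have hdL' : Descends L' := by
    refine descends_of_periods (fun x y => ?_) (fun x y => ?_) <;>
      obtain ⟨c, Y, h⟩ := hsurj' (x, y) <;> obtain ⟨rfl, rfl⟩ := Prod.mk.injEq _ _ _ _ ▸ h
    · have h1 := hL'j c y q
      have h2 := hL'j c y 0
      simp only [Int.cast_natCast, Int.cast_zero, add_zero, add_div, div_self hq'] at h1 h2
      rw [h1, h2, proj_add_one_left]
    · have h1 := hL'j c (y + 1) (-1)
      have h2 := hL'j c y 0
      simp only [hG.left_add_one_snd, hG.right_add_one_snd, Int.cast_neg, Int.cast_one,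
        Int.cast_zero, add_zero, add_neg_cancel_right] at h1 h2
      rw [h1, h2]
  have hLs : ContDiff ℝ ∞ L := by
    have h1 : ContDiff ℝ ∞ fun z : ℝ × ℝ => K (z.2, q * z.1) := hK.comp (by fun_prop)
    exact ((hG.smooth_right.comp (contDiff_snd.prodMk h1)).div_const _).prodMk h1
  have hLs' : ContDiff ℝ ∞ L' := by
    have h1 : ContDiff ℝ ∞ fun z : ℝ × ℝ => M (z.2, -(q * z.1)) := hM.comp (by fun_prop)
    exact ((hG.smooth_left.comp (h1.prodMk contDiff_snd)).div_const _).prodMk h1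
  set h : Equiv.Perm Torus := descendPerm L L' hdL hdL'
    (fun z => by obtain ⟨c, Y, rfl⟩ := hsurj z; rw [hLP, hLQ])
    (fun z => by obtain ⟨c, Y, rfl⟩ := hsurj' z; rw [hLQ, hLP]) with hh
  have key : ∀ c Y (j : ℤ), h (proj ((P (c, Y) + j) / q, c)) = proj ((Q (c, Y) + j) / q, Y) :=
    fun c Y j => (descend_proj hdL _).trans (hLj c Y j)
  have hsm : IsSmooth h := ⟨L, hLs, isLift_descend hdL⟩
  refine ⟨h, isAreaPreservingDiffeo_of_integral hsm ⟨L', hLs', isLift_descend hdL'⟩ ?_, ?_, key⟩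
  · intro f
    have hc : Continuous fun z => f (h z) := f.continuous.comp hsm.continuous
    rw [integral_torus hc, integral_torus f.continuous]
    have hJ := hG.continuous_density
    have hP := hG.smooth_left.continuous
    have hQ := hG.smooth_right.continuous
    -- In the coordinates `(c, Y)` both integrals become the double integral of `Φ`: one with `x =
    -- (P + j)/q` at fixed `c`, the other with `x = (Q + j)/q` at fixed `Y`.
    set Φ : ℝ × ℝ → ℝ := fun z =>
      ((1 / q : ℝ) * ∑ j ∈ Finset.range q, f (proj ((Q (z.1, z.2) + j) / q, z.2))) * J z with hΦ
    have hΦc : Continuous Φ := by fun_prop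
    have e1 : ∀ c, ∫ x in (0 : ℝ)..1, f (h (proj (x, c))) = ∫ Y in (0 : ℝ)..1, Φ (c, Y) := by
      intro c
      rw [integral_eq_integral_sum_branches (φ := fun x => f (h (proj (x, c))))
        (hc.comp (by fun_prop : Continuous fun x : ℝ => proj (x, c)))
        (fun x => by simp only [proj_add_one_left]) (hG.hasDerivAt_left c)
        (hJ.comp (by fun_prop)) hq 0 (by rw [hG.left_add_one_snd])]
      rw [zero_add]
      refine intervalIntegral.integral_congr fun Y _ => ?_
      simp only [hΦ]
      congr 2
      refine Finset.sum_congr rfl fun j _ => ?_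
      have := key c Y j
      rw [Int.cast_natCast] at this
      rw [this]
    have e2 : ∀ Y, ∫ x in (0 : ℝ)..1, f (proj (x, Y)) = ∫ c in (0 : ℝ)..1, Φ (c, Y) := by
      intro Y
      have hd : ∀ c, HasDerivAt (fun c => Q (-c, Y)) (J (-c, Y)) c := fun c =>
        (HasDerivAt.comp c (hG.hasDerivAt_right (-c) Y) (hasDerivAt_neg c)).congr_deriv (by ring)
      rw [integral_eq_integral_sum_branches (φ := fun x => f (proj (x, Y))) (by fun_prop)
        (fun x => by simp only [proj_add_one_left]) hd (hJ.comp (by fun_prop)) hq (-1)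
        (by have := hG.right_add_one_fst 0 Y
            simp only [zero_add] at this
            rw [neg_neg, this]; simp)]
      have := intervalIntegral.integral_comp_neg (a := -1) (b := 0) fun c => Φ (c, Y)
      rw [neg_neg, neg_zero] at this
      rw [← this, neg_add_cancel]
    simp only [e1, e2]
    exact (integral_swap hΦc).symm
  · intro p
    refine Equiv.ext fun z => ?_
    obtain ⟨x, rfl⟩ := proj_surjective z
    obtain ⟨c, Y, rfl⟩ := hsurj x
    have h0 := key c Y 0
    simp only [Int.cast_zero, add_zero] at h0
    simp only [Equiv.Perm.mul_apply]
    rw [h0, shift_proj, shift_proj, ← add_div, ← add_div, key]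

end AbC

namespace AbC

/-! ### The generating pair of a conjugacy -/

lemma contDiff_of_hasDerivAt {f f' : ℝ → ℝ} (hf : ContDiff ℝ ∞ f)
    (h : ∀ y, HasDerivAt f (f' y) y) : ContDiff ℝ ∞ f' := by
  rw [show f' = deriv f from funext fun y => (h y).deriv.symm]
  exact (contDiff_infty_iff_deriv.1 hf).2

lemma exists_abs_le_of_periodic {f : ℝ → ℝ} (hf : Continuous f) (hp : ∀ y, f (y + 1) = f y) :
    ∃ M, 0 ≤ M ∧ ∀ y, |f y| ≤ M := by
  obtain ⟨M, hM⟩ := (isCompact_Icc (a := (0 : ℝ)) (b := 1)).exists_bound_of_continuousOn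
    hf.continuousOn
  have h : ∀ y, |f y| ≤ M := fun y => by
    rw [← apply_fract_of_periodic hp y]
    exact hM _ ⟨Int.fract_nonneg y, (Int.fract_lt_one y).le⟩
  exact ⟨M, (abs_nonneg _).trans (h 0), h⟩

lemma derivative_add_one {f f' : ℝ → ℝ} (h : ∀ y, HasDerivAt f (f' y) y) {b : ℝ}
    (hp : ∀ y, f (y + 1) = f y + b) (y : ℝ) : f' (y + 1) = f' y := by
  have h1 : HasDerivAt (fun y => f (y + 1)) (f' (y + 1)) y := (h (y + 1)).comp_add_const y 1
  simp only [hp] at h1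
  exact h1.unique ((h y).add_const b)

/-- Interpolation between the two circle coverings `F` on the Cantor set and `R (· - c)` off a
neighbourhood of it. -/
lemma exists_generatingPair {F F' R R' : ℝ → ℝ} {a δ ρ σ : ℝ} (hF : ContDiff ℝ ∞ F)
    (hFd : ∀ y, HasDerivAt F (F' y) y) (hF1 : ∀ y, F (y + 1) = F y + 1) (ha : 0 < a)
    (hFa : ∀ y, a ≤ F' y) (hFC : ∀ y ∈ cantorLift, F' y = 1)
    (hR : ContDiff ℝ ∞ R) (hRd : ∀ y, HasDerivAt R (R' y) y) (hR1 : ∀ y, R (y + 1) = R y + 1)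
    (hδ : 0 < δ) (hRδ : ∀ y, δ ≤ R' y) (hR0 : R 0 = 0) (hR0' : R' 0 = 1) (hρ : 0 < ρ)
    (hσ : 0 < σ) :
    ∃ P Q J : ℝ × ℝ → ℝ, IsGeneratingPair P Q J ∧
      (∀ c ∈ cantorLift, P (c, c) = 0 ∧ Q (c, c) = 0) ∧
      (∀ c ∈ cantorLift, ∀ Y, |J (c, Y) - F' Y| ≤ σ) ∧
      (∀ c, ¬ NearCantor ρ c → ∀ Y, |J (c, Y) - R' (Y - c)| ≤ σ) ∧
      ∀ c Y, |Q (c, Y) - R (Y - c)| ≤ σ := by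
  have hF's := contDiff_of_hasDerivAt hF hFd
  have hR's := contDiff_of_hasDerivAt hR hRd
  set R'' : ℝ → ℝ := deriv R' with hR''
  have hR'd : ∀ y, HasDerivAt R' (R'' y) y := fun y =>
    (hR's.differentiable (by simp) y).hasDerivAt
  have hR''s := contDiff_of_hasDerivAt hR's hR'd
  have hF'p := derivative_add_one hFd hF1
  have hR'p := derivative_add_one hRd hR1
  have hR''p := derivative_add_one hR'd (b := 0) (by simpa using hR'p)
  obtain ⟨M₁, hM₁, hM₁'⟩ := exists_abs_le_of_periodic hF's.continuous hF'p
  obtain ⟨M₂, hM₂, hM₂'⟩ := exists_abs_le_of_periodic hR's.continuous hR'p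
  obtain ⟨M₃, hM₃, hM₃'⟩ := exists_abs_le_of_periodic hR''s.continuous hR''p
  -- The bound by half of `min δ a` keeps `J` positive: `J` is nearly a convex combination of `R' ≥
  -- δ` and `F' ≥ a`, with errors controlled by `τ`.
  set τ := min σ (min δ a / 2) with hτ
  have hτ0 : 0 < τ := lt_min hσ (half_pos (lt_min hδ ha))
  set m := τ / (M₁ + M₂ + M₃ + 1) with hm
  have hm0 : 0 < m := by positivity
  have hmτ : m * (M₁ + M₂ + M₃) ≤ τ := by
    rw [hm, div_mul_eq_mul_div, div_le_iff₀ (by positivity)]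
    nlinarith
  have hmσ : m * (M₁ + M₂ + M₃) ≤ σ := hmτ.trans (min_le_left _ _)
  obtain ⟨χ, χ', hχ, hχ's, hχd, hχp, hχ'p, hχm, hχ'1, hχ'C, hχ'n⟩ := exists_small_primitive hρ hm0
  -- With `W(c,Y) = S(Y - c) - χ(c)(F(Y) - F(c) - R(Y - c))` and `S' = R`, these are `P = -∂W/∂c`,
  -- `Q = ∂W/∂Y` and `J = -∂²W/∂c∂Y`. Only `χ'`, never `χ`, is of order one; hence `Q` stays close
  -- to `R(Y - c)` for every `c`, while the density switches from `R'(Y - c)` to `F'(Y)`.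
  set P : ℝ × ℝ → ℝ := fun z => R (z.2 - z.1) + χ' z.1 * (F z.2 - F z.1 - R (z.2 - z.1)) +
    χ z.1 * (R' (z.2 - z.1) - F' z.1) with hP
  set Q : ℝ × ℝ → ℝ := fun z => R (z.2 - z.1) - χ z.1 * (F' z.2 - R' (z.2 - z.1)) with hQ
  set J : ℝ × ℝ → ℝ := fun z => R' (z.2 - z.1) + χ' z.1 * (F' z.2 - R' (z.2 - z.1)) +
    χ z.1 * R'' (z.2 - z.1) with hJ
  have hχR : ∀ c Y, |χ c * R'' (Y - c)| ≤ m * M₃ := fun c Y => by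
    rw [abs_mul]; exact mul_le_mul (hχm c) (hM₃' _) (abs_nonneg _) hm0.le
  have hFR : ∀ c Y, |F' Y - R' (Y - c)| ≤ M₁ + M₂ := fun c Y =>
    (abs_sub _ _).trans (add_le_add (hM₁' _) (hM₂' _))
  have sub1 : ∀ c Y : ℝ, Y - (c + 1) + 1 = Y - c := fun c Y => by ring
  have hRs : ∀ c Y, R (Y - (c + 1)) = R (Y - c) - 1 := fun c Y => by
    have := hR1 (Y - (c + 1)); rw [sub1] at this; linarith
  have hR's1 : ∀ c Y, R' (Y - (c + 1)) = R' (Y - c) := fun c Y => by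
    have := hR'p (Y - (c + 1)); rw [sub1] at this; linarith
  have add1 : ∀ c Y : ℝ, Y + 1 - c = Y - c + 1 := fun c Y => by ring
  refine ⟨P, Q, J, ⟨by fun_prop, by fun_prop, ?_, ?_, ?_, ?_, ?_, ?_, ?_, ?_⟩, ?_, ?_, ?_, ?_⟩
  · have := hR's.continuous
    have := hR''s.continuous
    have := hF's.continuous
    have := hχ.continuous
    have := hχ's.continuous
    fun_prop
  · intro c Y
    simp only [hP, hRs, hR's1, hχp, hχ'p, hF1, hF'p]; ring
  · intro c Y
    simp only [hP, add1, hR1, hR'p, hF1]; ring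
  · intro c Y
    simp only [hQ, hRs, hR's1, hχp]; ring
  · intro c Y
    simp only [hQ, add1, hR1, hR'p, hF'p]
  · intro c Y
    have h1 := (hRd (Y - c)).comp_sub_const Y c
    have h2 := (hR'd (Y - c)).comp_sub_const Y c
    exact (h1.add (((hFd Y).sub_const (F c)).sub h1 |>.const_mul (χ' c))).add
      ((h2.sub_const (F' c)).const_mul (χ c))
  · intro c Y
    have h1 := (hRd (Y - c)).comp_const_sub Y c
    have h2 := (hR'd (Y - c)).comp_const_sub Y c
    refine (h1.sub ((hχd c).mul (h2.const_sub (F' Y)))).congr_deriv ?_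
    simp only [hJ]; ring
  · rintro ⟨c, Y⟩
    have h1 := (abs_le.1 (hχR c Y)).1
    have hJe : J (c, Y) = (1 - χ' c) * R' (Y - c) + χ' c * F' Y + χ c * R'' (Y - c) := by
      simp only [hJ]; ring
    rw [hJe]
    have hδ' : min δ a ≤ R' (Y - c) := (min_le_left _ _).trans (hRδ _)
    have ha' : min δ a ≤ F' Y := (min_le_right _ _).trans (hFa _)
    have hmin : 0 < min δ a := lt_min hδ ha
    have hτ2 : τ ≤ min δ a / 2 := min_le_right _ _
    have hF'M := (abs_le.1 (hM₁' Y)).2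
    obtain ⟨h3, h4⟩ := hχ'1 c
    have h5 : 0 ≤ m * M₂ := by positivity
    rcases le_or_gt 0 (χ' c) with h | h
    · have h6 : 0 ≤ m * M₁ := by positivity
      nlinarith [mul_le_mul_of_nonneg_left hδ' (sub_nonneg.2 h4), mul_le_mul_of_nonneg_left ha' h]
    · have h7 : -(m * M₁) ≤ χ' c * F' Y := by
        have : 0 < F' Y := hmin.trans_le ha'
        nlinarith
      have h8 : R' (Y - c) ≤ (1 - χ' c) * R' (Y - c) := by
        have : 0 < R' (Y - c) := hmin.trans_le hδ'
        nlinarith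
      nlinarith
  · intro c hc
    simp only [hP, hQ, sub_self, hR0, hR0', hFC c hc]
    constructor <;> ring
  · intro c hc Y
    have : J (c, Y) - F' Y = (χ' c - 1) * (F' Y - R' (Y - c)) + χ c * R'' (Y - c) := by
      simp only [hJ]; ring
    rw [this]
    have h2 : |(χ' c - 1) * (F' Y - R' (Y - c))| ≤ m * (M₁ + M₂) := by
      rw [abs_mul]; exact mul_le_mul (hχ'C c hc) (hFR c Y) (abs_nonneg _) hm0.le
    linarith [abs_add_le ((χ' c - 1) * (F' Y - R' (Y - c))) (χ c * R'' (Y - c)), hχR c Y]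
  · intro c hc Y
    have : J (c, Y) - R' (Y - c) = χ' c * (F' Y - R' (Y - c)) + χ c * R'' (Y - c) := by
      simp only [hJ]; ring
    rw [this]
    have h2 : |χ' c * (F' Y - R' (Y - c))| ≤ m * (M₁ + M₂) := by
      rw [abs_mul]; exact mul_le_mul (hχ'n c hc) (hFR c Y) (abs_nonneg _) hm0.le
    linarith [abs_add_le (χ' c * (F' Y - R' (Y - c))) (χ c * R'' (Y - c)), hχR c Y]
  · intro c Y
    have : Q (c, Y) - R (Y - c) = -(χ c * (F' Y - R' (Y - c))) := by
      simp only [hQ]; ring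
    rw [this, abs_neg]
    have h2 : |χ c * (F' Y - R' (Y - c))| ≤ m * (M₁ + M₂) := by
      rw [abs_mul]; exact mul_le_mul (hχm c) (hFR c Y) (abs_nonneg _) hm0.le
    have : 0 ≤ m * M₃ := by positivity
    linarith

end AbC

namespace AbC

/-! ### Continuous dependence of conjugated translations on the translation -/

/-- A derivative in the plane variable alone is the full derivative restricted to vectors of the
form `(0, v)`. -/
lemma continuous_iteratedFDeriv_slice {Ψ : ℝ × (ℝ × ℝ) → ℝ × ℝ} (hΨ : ContDiff ℝ ∞ Ψ) (k : ℕ) :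
    Continuous fun x : ℝ × (ℝ × ℝ) => iteratedFDeriv ℝ k (fun z => Ψ (x.1, z)) x.2 := by
  have key : ∀ x : ℝ × (ℝ × ℝ), iteratedFDeriv ℝ k (fun z => Ψ (x.1, z)) x.2 =
      (iteratedFDeriv ℝ k Ψ x).compContinuousLinearMap
        fun _ => ContinuousLinearMap.inr ℝ ℝ (ℝ × ℝ) := by
    rintro ⟨t, z⟩
    have h1 : ContDiff ℝ k fun w : ℝ × (ℝ × ℝ) => Ψ (w + (t, 0)) :=
      (hΨ.of_le (by exact_mod_cast le_top)).comp (by fun_prop)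
    have h2 := (ContinuousLinearMap.inr ℝ ℝ (ℝ × ℝ)).iteratedFDeriv_comp_right h1 z le_rfl
    rw [iteratedFDeriv_comp_add_right] at h2
    have e1 : (fun w : ℝ × (ℝ × ℝ) => Ψ (w + (t, 0))) ∘ ContinuousLinearMap.inr ℝ ℝ (ℝ × ℝ) =
        fun z => Ψ (t, z) := by
      funext w; simp
    have e2 : ContinuousLinearMap.inr ℝ ℝ (ℝ × ℝ) z + (t, 0) = (t, z) := by simp
    rwa [e1, e2] at h2
  simp only [key]
  have h3 : Continuous (iteratedFDeriv ℝ k Ψ) := hΨ.continuous_iteratedFDeriv (by exact_mod_cast le_top)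
  exact (ContinuousMultilinearMap.compContinuousLinearMapL
    (fun _ : Fin k => ContinuousLinearMap.inr ℝ ℝ (ℝ × ℝ))).continuous.comp h3

/-- A continuous function of a real variable with values in the integer lattice is constant. -/
lemma eq_of_proj_const {D : ℝ → ℝ × ℝ} (hD : Continuous D) (h : ∀ t, proj (D t) = proj (0, 0))
    (s t : ℝ) : D s = D t := by
  have key : ∀ d : ℝ → ℝ, Continuous d → (∀ t, ∃ k : ℤ, d t = k) → d s = d t := by
    intro d hd hk
    choose k hk using hk
    have hc : Continuous k := by
      refine (Int.isClosedEmbedding_coe_real.isInducing.continuous_iff).2 ?_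
      rwa [show (Int.cast : ℤ → ℝ) ∘ k = d from funext fun t => (hk t).symm]
    rw [hk, hk, PreconnectedSpace.constant inferInstance hc]
  have hk : ∀ t, ∃ k l : ℤ, (D t).1 = k ∧ (D t).2 = l := fun t => by
    obtain ⟨k, l, h1, h2⟩ := proj_eq_iff.1 (h t)
    exact ⟨k, l, by simpa using h1, by simpa using h2⟩
  exact Prod.ext
    (key _ (continuous_fst.comp hD) fun t => let ⟨k, _, h, _⟩ := hk t; ⟨k, h⟩)
    (key _ (continuous_snd.comp hD) fun t => let ⟨_, l, _, h⟩ := hk t; ⟨l, h⟩)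

lemma proj_sub_eq_zero {x y : ℝ × ℝ} (h : proj x = proj y) : proj (x - y) = proj (0, 0) := by
  obtain ⟨k, l, h1, h2⟩ := proj_eq_iff.1 h
  exact proj_eq_iff.2 ⟨k, l, by simp [h1], by simp [h2]⟩

lemma proj_add_sub {x y z : ℝ × ℝ} (h : proj x = proj z) : proj (x + y - z) = proj y := by
  obtain ⟨k, l, h1, h2⟩ := proj_eq_iff.1 h
  exact proj_eq_iff.2 ⟨k, l, by simp [h1]; ring, by simp [h2]; ring⟩

/-- The conjugates of nearby translations have lifts that are close in `C^n`. -/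
lemma eventually_close_lift {H : Equiv.Perm Torus} (hH : IsSmooth H) (hH' : IsSmooth H.symm)
    (α : ℝ) (n : ℕ) {ε : ℝ} (hε : 0 < ε) :
    ∀ᶠ α' in 𝓝 α, ∀ G₀ : ℝ × ℝ → ℝ × ℝ, ContDiff ℝ ∞ G₀ → IsLift G₀ (H * shift α * H⁻¹) →
      ∃ G, ContDiff ℝ ∞ G ∧ IsLift G (H * shift α' * H⁻¹) ∧
        ∀ k ≤ n, ∀ z, ‖iteratedFDeriv ℝ k G z - iteratedFDeriv ℝ k G₀ z‖ ≤ ε := by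
  obtain ⟨A, hA, hAl⟩ := hH
  obtain ⟨B, hB, hBl⟩ := hH'
  set Ψ : ℝ × (ℝ × ℝ) → ℝ × ℝ := fun x => A (B x.2 + (x.1, 0)) with hΨ
  have hΨs : ContDiff ℝ ∞ Ψ := hA.comp (by fun_prop)
  have hΨt : ∀ t, ContDiff ℝ ∞ fun z => Ψ (t, z) := fun t => hΨs.comp (by fun_prop)
  have hlift : ∀ t, IsLift (fun z => Ψ (t, z)) (H * shift t * H⁻¹) := by
    intro t z
    simp only [hΨ, Equiv.Perm.mul_apply]
    rw [show H⁻¹ (proj z) = proj (B z) from (hBl z).symm,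
      show B z = ((B z).1, (B z).2) from rfl, shift_proj, hAl]
    congr 2
    ext <;> simp
  -- The increment of `Ψ(t, ·)` over a period is an integer vector depending continuously on `t`,
  -- hence independent of `t`. So the difference of two of these lifts is doubly periodic and its
  -- size can be estimated on the unit square.
  have hper : ∀ t (v : ℝ × ℝ), proj v = proj (0, 0) → ∀ z,
      Ψ (t, z + v) - Ψ (α, z + v) = Ψ (t, z) - Ψ (α, z) := by
    intro t v hv z
    have h1 : proj (z + v) = proj z := by
      obtain ⟨k, l, h1, h2⟩ := proj_eq_iff.1 hv
      exact proj_eq_iff.2 ⟨k, l, by simp at h1; simp [h1], by simp at h2; simp [h2]⟩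
    have hc : Continuous fun t => Ψ (t, z + v) - Ψ (t, z) := by
      have := hΨs.continuous
      fun_prop
    have h2 := eq_of_proj_const hc (fun t => proj_sub_eq_zero (by
      have := (hlift t).descends _ _ h1
      exact this)) t α
    rw [sub_eq_sub_iff_add_eq_add] at h2 ⊢
    rw [h2, add_comm]
  have hev : ∀ᶠ t in 𝓝 α, ∀ z ∈ Set.Icc (0 : ℝ) 1 ×ˢ Set.Icc (0 : ℝ) 1, ∀ k ∈ Finset.range (n + 1),
      ‖iteratedFDeriv ℝ k (fun z => Ψ (t, z)) z - iteratedFDeriv ℝ k (fun z => Ψ (α, z)) z‖ < ε := by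
    refine (isCompact_Icc.prod isCompact_Icc).eventually_forall_of_forall_eventually fun z _ => ?_
    rw [Filter.eventually_all_finset]
    intro k _
    have hc := continuous_iteratedFDeriv_slice hΨs k
    have hc' : Continuous fun x : ℝ × (ℝ × ℝ) => ‖iteratedFDeriv ℝ k (fun z => Ψ (x.1, z)) x.2 -
        iteratedFDeriv ℝ k (fun z => Ψ (α, z)) x.2‖ :=
      (hc.sub (hc.comp (continuous_const.prodMk continuous_snd))).norm
    exact hc'.continuousAt.eventually (gt_mem_nhds (by simpa using hε))
  filter_upwards [hev] with t ht G₀ hG₀ hl₀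
  -- The given lift is corrected by the small periodic difference; `G₀` and `Ψ(α, ·)` lift the same
  -- map, so the result lifts the new one.
  refine ⟨fun z => G₀ z + Ψ (t, z) - Ψ (α, z), (hG₀.add (hΨt t)).sub (hΨt α), fun z => ?_, ?_⟩
  · rw [proj_add_sub ((hl₀ z).trans (hlift α z).symm)]
    exact hlift t z
  · intro k hk z
    have hle : ((k : ℕ) : WithTop ℕ∞) ≤ ∞ := by exact_mod_cast le_top
    set Δ : ℝ × ℝ → ℝ × ℝ := fun z => Ψ (t, z) - Ψ (α, z) with hΔ
    have hΔs : ContDiff ℝ ∞ Δ := (hΨt t).sub (hΨt α)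
    have e1 : (fun z => G₀ z + Ψ (t, z) - Ψ (α, z)) = G₀ + Δ := by
      funext z; simp only [hΔ, Pi.add_apply]; abel
    rw [e1, iteratedFDeriv_add_apply (hG₀.of_le hle).contDiffAt (hΔs.of_le hle).contDiffAt,
      add_sub_cancel_left]
    obtain ⟨w, hw, hwz⟩ := exists_proj_eq (proj z)
    have hv := proj_sub_eq_zero hwz.symm
    have e2 : iteratedFDeriv ℝ k Δ z = iteratedFDeriv ℝ k Δ w := by
      have e3 : Δ = fun y => Δ (y + (z - w)) := funext fun y => (hper t _ hv y).symm
      conv_rhs => rw [e3, iteratedFDeriv_comp_add_right]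
      simp
    have e4 := ht w ⟨⟨hw.1, hw.2.1.le⟩, ⟨hw.2.2.1, hw.2.2.2.le⟩⟩ k (Finset.mem_range.2 (by omega))
    have e5 : Δ = (fun z => Ψ (t, z)) - fun z => Ψ (α, z) := rfl
    rw [e2, e5, iteratedFDeriv_sub_apply ((hΨt t).of_le hle).contDiffAt
      ((hΨt α).of_le hle).contDiffAt]
    exact e4.le

lemma shift_inv (t : ℝ) : (shift t)⁻¹ = shift (-t) := by
  refine inv_eq_of_mul_eq_one_right (Equiv.ext fun z => ?_)
  obtain ⟨⟨x, y⟩, rfl⟩ := proj_surjective z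
  rw [Equiv.Perm.mul_apply, shift_proj, shift_proj]
  simp

lemma shift_add (s t : ℝ) : shift (s + t) = shift s * shift t := by
  refine Equiv.ext fun z => ?_
  obtain ⟨⟨x, y⟩, rfl⟩ := proj_surjective z
  rw [Equiv.Perm.mul_apply, shift_proj, shift_proj, shift_proj]
  congr 2; ring

lemma shift_pow (t : ℝ) (i : ℕ) : shift t ^ i = shift (i * t) := by
  induction i with
  | zero =>
    refine Equiv.ext fun z => ?_
    obtain ⟨⟨x, y⟩, rfl⟩ := proj_surjective z
    rw [shift_proj]; simp
  | succ i ih => rw [pow_succ, ih, ← shift_add]; congr 1; push_cast; ring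

lemma conj_pow (H S : Equiv.Perm Torus) (i : ℕ) : (H * S * H⁻¹) ^ i = H * S ^ i * H⁻¹ :=
  _root_.conj_pow

lemma dist_coe_le (x y : ℝ) : dist (x : UnitAddCircle) y ≤ |x - y| := by
  rw [dist_eq_norm, ← AddCircle.coe_sub]
  exact QuotientAddGroup.norm_mk_le_norm

lemma dist_proj_le (x y : ℝ × ℝ) : dist (proj x) (proj y) ≤ dist x y := by
  rw [Prod.dist_eq, Prod.dist_eq]
  exact max_le_max (dist_coe_le _ _) (dist_coe_le _ _)

lemma dist_shift_le (s t : ℝ) (z : Torus) : dist (shift s z) (shift t z) ≤ |s - t| := by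
  obtain ⟨⟨x, y⟩, rfl⟩ := proj_surjective z
  rw [shift_proj, shift_proj, proj, proj, Prod.dist_eq]
  simp only [dist_self]
  refine max_le ?_ (abs_nonneg _)
  refine (dist_coe_le _ _).trans ?_
  rw [show x + s - (x + t) = s - t by ring]

lemma eventually_dist_iterate_le {H : Equiv.Perm Torus} (hH : Continuous H) (α : ℝ) (m : ℕ) {ε : ℝ}
    (hε : 0 < ε) : ∀ᶠ α' in 𝓝 α, ∀ i ≤ m, ∀ x,
      dist (((H * shift α' * H⁻¹) ^ i) x) (((H * shift α * H⁻¹) ^ i) x) ≤ ε := by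
  obtain ⟨η, hη, hu⟩ := Metric.uniformContinuous_iff.1
    (CompactSpace.uniformContinuous_of_continuous hH) ε hε
  have : Tendsto (fun α' : ℝ => m * |α' - α|) (𝓝 α) (𝓝 (m * |α - α|)) :=
    (Continuous.tendsto (by fun_prop) α)
  rw [sub_self, abs_zero, mul_zero] at this
  filter_upwards [(tendsto_order.1 this).2 η hη] with α' h i hi x
  rw [conj_pow, conj_pow, shift_pow, shift_pow]
  refine (hu ?_).le
  refine (dist_shift_le _ _ _).trans_lt (lt_of_le_of_lt ?_ h)
  rw [← mul_sub, abs_mul, Nat.abs_cast]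
  gcongr

/-! ### Limits in the smooth topology -/

/-- The sequence is summed as a telescoping series. Derivatives of order `k` are controlled only
from index `k` on, so the limit is written as `G n` plus a tail starting at `n`, for each `n`, and
the tail is of class `C^n`. -/
lemma exists_smooth_limit {G : ℕ → ℝ × ℝ → ℝ × ℝ} (hG : ∀ n, ContDiff ℝ ∞ (G n))
    (hc : ∀ n, ∀ k ≤ n, ∀ z, ‖iteratedFDeriv ℝ k (G (n + 1)) z - iteratedFDeriv ℝ k (G n) z‖ ≤
      (1 / 2) ^ n) :
    ∃ G' : ℝ × ℝ → ℝ × ℝ, ContDiff ℝ ∞ G' ∧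
      ∀ k : ℕ, TendstoUniformly (fun n => iteratedFDeriv ℝ k (G n)) (iteratedFDeriv ℝ k G') atTop := by
  have hle : ∀ k : ℕ, ((k : ℕ) : WithTop ℕ∞) ≤ ∞ := fun k => by exact_mod_cast le_top
  set f : ℕ → ℕ → ℝ × ℝ → ℝ × ℝ := fun n i => G (n + i + 1) - G (n + i) with hf
  have hfs : ∀ n i, ContDiff ℝ ∞ (f n i) := fun n i => (hG _).sub (hG _)
  have hfb : ∀ n k i z, k ≤ n → ‖iteratedFDeriv ℝ k (f n i) z‖ ≤ (1 / 2) ^ n * (1 / 2) ^ i := by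
    intro n k i z hk
    simp only [hf]
    rw [iteratedFDeriv_sub_apply ((hG _).of_le (hle k)).contDiffAt
      ((hG _).of_le (hle k)).contDiffAt, ← pow_add]
    exact hc (n + i) k (by omega) z
  have hsum : HasSum (fun i : ℕ => (1 / 2 : ℝ) ^ i) 2 := hasSum_geometric_two
  have hfb0 : ∀ n i z, ‖f n i z‖ ≤ (1 / 2) ^ n * (1 / 2) ^ i := by
    intro n i z
    have := hfb n 0 i z (Nat.zero_le _)
    rwa [norm_iteratedFDeriv_zero] at this
  set S : ℕ → ℝ × ℝ → ℝ × ℝ := fun n z => ∑' i, f n i z with hS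
  have hsm : ∀ n z, Summable fun i => f n i z := fun n z =>
    Summable.of_norm_bounded (hsum.summable.mul_left _) fun i => hfb0 n i z
  have hrec : ∀ n z, G n z + S n z = G 0 z + S 0 z := by
    intro n z
    induction n with
    | zero => rfl
    | succ n ih =>
      rw [← ih]
      simp only [hS]
      rw [(hsm n z).tsum_eq_zero_add]
      have : ∀ i, f n (i + 1) z = f (n + 1) i z := fun i => by
        simp only [hf]; rw [show n + (i + 1) = n + 1 + i by omega]
      simp only [this]
      simp only [hf, add_zero, Pi.sub_apply]
      abel
  have hb' : ∀ (n k i : ℕ) z, (k : ℕ∞) ≤ (n : ℕ∞) →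
      ‖iteratedFDeriv ℝ k (f n i) z‖ ≤ (1 / 2) ^ n * (1 / 2) ^ i :=
    fun n k i z hk => hfb n k i z (by exact_mod_cast hk)
  have hSs : ∀ n : ℕ, ContDiff ℝ n (S n) := fun n =>
    contDiff_tsum (N := (n : ℕ∞)) (v := fun _ i => (1 / 2 : ℝ) ^ n * (1 / 2) ^ i)
      (fun i => (hfs n i).of_le (hle n)) (fun _ _ => hsum.summable.mul_left _) (hb' n)
  have hSb : ∀ n k z, k ≤ n → ‖iteratedFDeriv ℝ k (S n) z‖ ≤ (1 / 2) ^ n * 2 := by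
    intro n k z hk
    have := iteratedFDeriv_tsum_apply (N := (n : ℕ∞)) (𝕜 := ℝ)
      (v := fun _ i => (1 / 2 : ℝ) ^ n * (1 / 2) ^ i)
      (fun i => (hfs n i).of_le (hle n)) (fun _ _ => hsum.summable.mul_left _) (hb' n) (k := k)
      (by exact_mod_cast hk) z
    simp only [hS]
    rw [this]
    exact tsum_of_norm_bounded (hsum.mul_left _) fun i => hfb n k i z hk
  set G' : ℝ × ℝ → ℝ × ℝ := fun z => G 0 z + S 0 z with hG'
  have hG'e : ∀ n, G' = G n + S n := fun n => funext fun z => (hrec n z).symm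
  refine ⟨G', ?_, fun k => ?_⟩
  · refine contDiff_infty.2 fun n => ?_
    rw [hG'e n]
    exact ((hG n).of_le (hle n)).add (hSs n)
  · rw [Metric.tendstoUniformly_iff]
    intro ε hε
    have h0 : Tendsto (fun n : ℕ => (1 / 2 : ℝ) ^ n * 2) atTop (𝓝 (0 * 2)) :=
      (tendsto_pow_atTop_nhds_zero_of_lt_one (by norm_num) (by norm_num)).mul_const 2
    rw [zero_mul] at h0
    filter_upwards [(tendsto_order.1 h0).2 ε hε, eventually_ge_atTop k] with n hn hkn z
    rw [dist_eq_norm, hG'e n, iteratedFDeriv_add_apply ((hG n).of_le (hle k)).contDiffAt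
      ((hSs n).of_le (by exact_mod_cast hkn)).contDiffAt, add_sub_cancel_left]
    exact (hSb n k z hkn).trans_lt hn

/-- Successive maps have close smooth lifts. -/
def CloseLifts (T : ℕ → Torus → Torus) : Prop :=
  ∀ n, ∀ G₀ : ℝ × ℝ → ℝ × ℝ, ContDiff ℝ ∞ G₀ → IsLift G₀ (T n) →
    ∃ G, ContDiff ℝ ∞ G ∧ IsLift G (T (n + 1)) ∧
      ∀ k ≤ n, ∀ z, ‖iteratedFDeriv ℝ k G z - iteratedFDeriv ℝ k G₀ z‖ ≤ (1 / 2) ^ n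

/-- Since every lift of one map has a close lift of the next, a coherent sequence of lifts can be
chosen recursively. -/
lemma CloseLifts.exists_limit {T : ℕ → Torus → Torus} (hT : CloseLifts T) (h0 : IsSmooth (T 0)) :
    ∃ (F : ℕ → ℝ × ℝ → ℝ × ℝ) (G : ℝ × ℝ → ℝ × ℝ),
    (∀ n, ContDiff ℝ ∞ (F n) ∧ IsLift (F n) (T n)) ∧ ContDiff ℝ ∞ G ∧
    (∀ k : ℕ, TendstoUniformly (fun n => iteratedFDeriv ℝ k (F n)) (iteratedFDeriv ℝ k G) atTop) ∧
    TendstoUniformly F G atTop ∧ Descends G := by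
  choose Φ hΦ1 hΦ2 hΦ3 using hT
  obtain ⟨G₀, hG₀, hl₀⟩ := h0
  let X := fun n => {G : ℝ × ℝ → ℝ × ℝ // ContDiff ℝ ∞ G ∧ IsLift G (T n)}
  let F : ∀ n, X n := fun n => Nat.rec (motive := X) ⟨G₀, hG₀, hl₀⟩
    (fun n G => ⟨Φ n G.1 G.2.1 G.2.2, hΦ1 n G.1 G.2.1 G.2.2, hΦ2 n G.1 G.2.1 G.2.2⟩) n
  have hF : ∀ n, (F (n + 1)).1 = Φ n (F n).1 (F n).2.1 (F n).2.2 := fun n => rfl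
  obtain ⟨G, hG, hlim⟩ := exists_smooth_limit (G := fun n => (F n).1) (fun n => (F n).2.1)
    (fun n k hk z => by rw [hF]; exact hΦ3 n _ _ _ k hk z)
  have hu : TendstoUniformly (fun n => (F n).1) G atTop := by
    rw [Metric.tendstoUniformly_iff]
    intro ε hε
    filter_upwards [Metric.tendstoUniformly_iff.1 (hlim 0) ε hε] with n hn z
    have h1 := hn z
    have h2 := congrArg (fun f => f 0) (iteratedFDeriv_zero_eq_comp (𝕜 := ℝ) (f := G))
    rw [dist_eq_norm] at h1 ⊢
    rw [iteratedFDeriv_zero_eq_comp, iteratedFDeriv_zero_eq_comp] at h1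
    simp only [Function.comp_apply] at h1
    rwa [← map_sub, LinearIsometryEquiv.norm_map] at h1
  refine ⟨fun n => (F n).1, G, fun n => (F n).2, hG, hlim, hu, fun x y hxy => ?_⟩
  have h1 := (continuous_proj.tendsto _).comp (hu.tendsto_at x)
  have h2 := (continuous_proj.tendsto _).comp (hu.tendsto_at y)
  refine tendsto_nhds_unique h1 (h2.congr fun n => ?_)
  exact ((F n).2.2.descends _ _ hxy).symm

/-- A sequence of area preserving diffeomorphisms with fast enough convergence has a limit. -/
lemma exists_limit_diffeo {T : ℕ → Equiv.Perm Torus} (hT : ∀ n, IsAreaPreservingDiffeo (T n))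
    (h : CloseLifts fun n => T n) (h' : CloseLifts fun n => (T n).symm) :
    ∃ T' : Equiv.Perm Torus, IsAreaPreservingDiffeo T' ∧ TendstoSmooth (fun n => T n) T' ∧
      TendstoSmooth (fun n => (T n).symm) T'.symm ∧
      ∀ i z, Tendsto (fun n => ((T n) ^ i) z) atTop (𝓝 ((T' ^ i) z)) := by
  obtain ⟨F, G, hF, hG, hlim, hu, hd⟩ := h.exists_limit (hT 0).smooth
  obtain ⟨F', G', hF', hG', hlim', hu', hd'⟩ := h'.exists_limit (hT 0).smooth_symm
  -- The limits of the maps and of their inverses are mutually inverse after projection: uniform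
  -- convergence allows passing to the limit in the composition.
  have key : ∀ {F G F' G' : _} {T T' : ℕ → Torus → Torus}, (∀ n, IsLift (F n) (T n)) →
      (∀ n, IsLift (F' n) (T' n)) → (∀ n z, T' n (T n z) = z) → TendstoUniformly F G atTop →
      TendstoUniformly F' G' atTop → Continuous G' → ∀ x, proj (G' (G x)) = proj x := by
    intro F G F' G' T T' hF hF' hinv hu hu' hc x
    have h1 : Tendsto (fun n => F' n (F n x)) atTop (𝓝 (G' (G x))) :=
      hu'.tendsto_comp hc.continuousAt (hu.tendsto_at x)
    refine tendsto_nhds_unique ((continuous_proj.tendsto _).comp h1)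
      (tendsto_const_nhds.congr fun n => ?_)
    simp only [Function.comp_apply]
    rw [hF', hF, hinv]
  set T' : Equiv.Perm Torus := descendPerm G G' hd hd'
    (key (fun n => (hF n).2) (fun n => (hF' n).2) (fun n z => (T n).symm_apply_apply z) hu hu'
      hG'.continuous)
    (key (fun n => (hF' n).2) (fun n => (hF n).2) (fun n z => (T n).apply_symm_apply z) hu' hu
      hG.continuous) with hT'
  have hl : IsLift G T' := isLift_descend hd
  have hl' : IsLift G' T'.symm := isLift_descend hd'
  have hpt : ∀ z, Tendsto (fun n => T n z) atTop (𝓝 (T' z)) := by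
    intro z
    obtain ⟨x, rfl⟩ := proj_surjective z
    rw [← hl]
    exact ((continuous_proj.tendsto _).comp (hu.tendsto_at x)).congr fun n => (hF n).2 x
  have hsm : IsSmooth T' := ⟨G, hG, hl⟩
  have huT : TendstoUniformly (fun n z => T n z) T' atTop := by
    have hpu : UniformContinuous proj :=
      (LipschitzWith.mk_one dist_proj_le).uniformContinuous
    have h2 := hpu.comp_tendstoUniformly hu
    rw [Metric.tendstoUniformly_iff] at h2 ⊢
    intro ε hε
    filter_upwards [h2 ε hε] with n hn z
    obtain ⟨x, rfl⟩ := proj_surjective z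
    have := hn x
    simp only [Function.comp_apply] at this
    rwa [hl, (hF n).2] at this
  refine ⟨T', isAreaPreservingDiffeo_of_integral hsm ⟨G', hG', hl'⟩ fun f => ?_,
    ⟨F, G, hF, hG, hl, hlim⟩, ⟨F', G', hF', hG', hl', hlim'⟩, fun i => ?_⟩
  -- Invariance of the integrals of continuous functions survives dominated convergence, and it
  -- suffices for measure preservation.
  · have h1 : ∀ n, ∫ z, f (T n z) = ∫ z, f z := fun n => by
      have := integral_map (μ := volume) (hT n).measurePreserving.measurable.aemeasurable
        f.continuous.aestronglyMeasurable
      rw [(hT n).measurePreserving.map_eq] at this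
      exact this.symm
    have h2 : Tendsto (fun n => ∫ z, f (T n z)) atTop (𝓝 (∫ z, f (T' z))) := by
      refine tendsto_integral_of_dominated_convergence (fun _ => ‖f‖)
        (fun n => (f.continuous.comp (hT n).smooth.continuous).aestronglyMeasurable)
        (integrable_const _) (fun n => ae_of_all _ fun z => f.norm_coe_le_norm _)
        (ae_of_all _ fun z => (f.continuous.tendsto _).comp (hpt z))
    exact tendsto_nhds_unique h2 (tendsto_const_nhds.congr fun n => (h1 n).symm)
  · induction i with
    | zero => intro z; simp
    | succ i ih =>
      intro z
      simp only [pow_succ', Equiv.Perm.mul_apply]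
      exact huT.tendsto_comp hsm.continuous.continuousAt (ih z)

end AbC

namespace AbC

/-! ### Averages along horizontal circles -/

lemma abs_integral_le_integral {f g : ℝ → ℝ} {a b : ℝ} (hab : a ≤ b) (hg : Continuous g)
    (h : ∀ y, |f y| ≤ g y) : |∫ y in a..b, f y| ≤ ∫ y in a..b, g y :=
  intervalIntegral.norm_integral_le_of_norm_le (f := f) (g := g) (μ := volume) hab
    (ae_of_all _ fun y _ => h y) (hg.intervalIntegrable _ _)

/-- The average of `f ∘ H` along the horizontal circle at height `y`. -/
noncomputable def avg (H : Torus → Torus) (f : C(Torus, ℝ)) (y : ℝ) : ℝ :=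
  ∫ x in (0 : ℝ)..1, f (H (proj (x, y)))

/-- The average of `f ∘ H` over `q` equidistant points of the horizontal circle at height `y`. -/
noncomputable def branch (H : Torus → Torus) (f : C(Torus, ℝ)) (q : ℕ) (x y : ℝ) : ℝ :=
  (1 / q : ℝ) * ∑ j ∈ Finset.range q, f (H (proj (x + j / q, y)))

lemma continuous_comp_proj {H : Torus → Torus} (hH : Continuous H) (f : C(Torus, ℝ)) :
    Continuous fun z => f (H (proj z)) :=
  f.continuous.comp (hH.comp continuous_proj)

lemma continuous_avg {H : Torus → Torus} (hH : Continuous H) (f : C(Torus, ℝ)) :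
    Continuous (avg H f) :=
  continuous_intervalIntegral (continuous_comp_proj hH f) 0 1

lemma continuous_branch {H : Torus → Torus} (hH : Continuous H) (f : C(Torus, ℝ)) (q : ℕ) :
    Continuous fun z : ℝ × ℝ => branch H f q z.1 z.2 := by
  have := continuous_comp_proj hH f
  unfold branch
  refine continuous_const.mul (continuous_finsetSum _ fun j _ => ?_)
  exact this.comp (by fun_prop : Continuous fun z : ℝ × ℝ => (z.1 + j / q, z.2))

lemma integral_avg {H : Equiv.Perm Torus} (hH : IsAreaPreservingDiffeo H) (f : C(Torus, ℝ)) :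
    ∫ y in (0 : ℝ)..1, avg H f y = ∫ z, f z := by
  have h1 := integral_map (μ := volume) hH.measurePreserving.measurable.aemeasurable
    f.continuous.aestronglyMeasurable
  rw [hH.measurePreserving.map_eq] at h1
  have h2 : Continuous fun z => f (H z) := f.continuous.comp hH.smooth.continuous
  rw [h1, integral_torus h2]
  rfl

lemma volume_real_univ : (volume : Measure Torus).real Set.univ = 1 := by
  rw [Measure.real, Measure.volume_eq_prod, ← Set.univ_prod_univ, Measure.prod_prod]
  simp

lemma abs_avg_sub_integral_le (H : Torus → Torus) (f : C(Torus, ℝ)) (y : ℝ) :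
    |avg H f y - ∫ z, f z| ≤ 2 * ‖f‖ := by
  have h1 : |avg H f y| ≤ ‖f‖ := by
    have := intervalIntegral.norm_integral_le_of_norm_le_const (a := 0) (b := 1) (C := ‖f‖)
      (f := fun x => f (H (proj (x, y)))) fun x _ => f.norm_coe_le_norm _
    simpa [avg] using this
  have h2 : |∫ z, f z| ≤ ‖f‖ := by
    have := norm_integral_le_of_norm_le_const (μ := (volume : Measure Torus)) (C := ‖f‖)
      (ae_of_all _ fun z => f.norm_coe_le_norm z)
    rwa [volume_real_univ, mul_one] at this
  linarith [abs_sub (avg H f y) (∫ z, f z)]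

/-- The full average is the mean over `t ∈ [0,1]` of the averages at the points `x + (t + j)/q`,
each within `1/q` of `x + j/q`. -/
lemma abs_branch_sub_le_of_modulus {H : Torus → Torus} (hH : Continuous H) {f : C(Torus, ℝ)} {q : ℕ}
    (hq : 0 < q) {ε : ℝ} (h : ∀ s t y : ℝ, |s - t| ≤ 1 / q →
      |f (H (proj (s, y))) - f (H (proj (t, y)))| ≤ ε) (x y : ℝ) :
    |branch H f q x y - avg H f y| ≤ ε := by
  have hc : Continuous fun t => f (H (proj (t, y))) :=
    (continuous_comp_proj hH f).comp (by fun_prop)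
  have hq' : (0 : ℝ) < q := by exact_mod_cast hq
  have e1 : avg H f y = ∫ t in (0 : ℝ)..1,
      (1 / q : ℝ) * ∑ j ∈ Finset.range q, f (H (proj (x + (t + j) / q, y))) := by
    rw [sum_integral_div (φ := fun t => f (H (proj (x + t, y)))) (by fun_prop) hq]
    have h1 := intervalIntegral.integral_comp_add_left (a := 0) (b := 1)
      (fun t => f (H (proj (t, y)))) x
    rw [h1, add_zero, integral_period (f := fun t => f (H (proj (t, y))))
      (fun t => by simp only [proj_add_one_left])]
    rfl
  have e2 : branch H f q x y = ∫ t in (0 : ℝ)..1, branch H f q x y := by simp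
  have hc2 : Continuous fun t : ℝ =>
      (1 / q : ℝ) * ∑ j ∈ Finset.range q, f (H (proj (x + (t + j) / q, y))) :=
    continuous_const.mul (continuous_finsetSum _ fun j _ =>
      hc.comp (by fun_prop : Continuous fun t : ℝ => x + (t + j) / q))
  rw [e1, e2, ← intervalIntegral.integral_sub (by simp) (hc2.intervalIntegrable _ _)]
  have := intervalIntegral.norm_integral_le_of_norm_le_const (a := 0) (b := 1) (C := ε)
    (f := fun t : ℝ => branch H f q x y -
      (1 / q : ℝ) * ∑ j ∈ Finset.range q, f (H (proj (x + (t + j) / q, y)))) fun t ht => ?_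
  · simpa using this
  · rw [Set.uIoc_of_le zero_le_one] at ht
    rw [Real.norm_eq_abs, branch, ← mul_sub, ← Finset.sum_sub_distrib, abs_mul,
      abs_of_pos (by positivity)]
    have hs : |∑ j ∈ Finset.range q, (f (H (proj (x + j / q, y))) -
        f (H (proj (x + (t + j) / q, y))))| ≤ ∑ j ∈ Finset.range q, ε := by
      refine (Finset.abs_sum_le_sum_abs _ _).trans (Finset.sum_le_sum fun j _ => h _ _ _ ?_)
      rw [show x + j / q - (x + (t + j) / q) = -(t / q) by ring, abs_neg,
        abs_of_nonneg (div_nonneg ht.1.le hq'.le)]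
      exact div_le_div_of_nonneg_right ht.2 hq'.le
    rw [Finset.sum_const, Finset.card_range, nsmul_eq_mul] at hs
    rw [one_div, inv_mul_le_iff₀ hq']
    exact hs

lemma exists_modulus {H : Torus → Torus} (hH : Continuous H) (f : C(Torus, ℝ)) {ε : ℝ}
    (hε : 0 < ε) : ∃ η > 0, ∀ x y : ℝ × ℝ, dist x y < η →
      |f (H (proj x)) - f (H (proj y))| ≤ ε := by
  obtain ⟨η, hη, hu⟩ := Metric.uniformContinuous_iff.1
    (CompactSpace.uniformContinuous_of_continuous (f.continuous.comp hH)) ε hε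
  exact ⟨η, hη, fun x y h => (hu ((dist_proj_le x y).trans_lt h)).le⟩

lemma abs_avg_sub_avg_le {H : Torus → Torus} (hH : Continuous H) {f : C(Torus, ℝ)} {ε η : ℝ}
    (h : ∀ x y : ℝ × ℝ, dist x y < η → |f (H (proj x)) - f (H (proj y))| ≤ ε) {y y' : ℝ}
    (hy : |y - y'| < η) : |avg H f y - avg H f y'| ≤ ε := by
  have hc := fun y : ℝ => (continuous_comp_proj hH f).comp
    (by fun_prop : Continuous fun t : ℝ => (t, y))
  have e : avg H f y - avg H f y' =
      ∫ x in (0 : ℝ)..1, (f (H (proj (x, y))) - f (H (proj (x, y')))) :=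
    (intervalIntegral.integral_sub ((hc y).intervalIntegrable _ _)
      ((hc y').intervalIntegrable _ _)).symm
  rw [e]
  have := intervalIntegral.norm_integral_le_of_norm_le_const (a := 0) (b := 1) (C := ε)
    (f := fun x : ℝ => f (H (proj (x, y))) - f (H (proj (x, y')))) fun t _ => h _ _ ?_
  · simpa using this
  · rw [Prod.dist_eq, dist_self, Real.dist_eq]
    exact max_lt ((abs_nonneg _).trans_lt hy) hy

/-! ### Averages after one more conjugation -/

/-- `h` maps `(P / q, c)` to `(Q / q, Y)`, along all branches. -/
def IsGenerated (h : Torus → Torus) (q : ℕ) (P Q : ℝ × ℝ → ℝ) : Prop :=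
  ∀ c Y (j : ℤ), h (proj ((P (c, Y) + j) / q, c)) = proj ((Q (c, Y) + j) / q, Y)

variable {P Q J : ℝ × ℝ → ℝ} {H h : Torus → Torus} {q : ℕ}

lemma branch_comp (hh : IsGenerated h q P Q) (f : C(Torus, ℝ)) (c Y : ℝ) :
    branch (H ∘ h) f q (P (c, Y) / q) c = branch H f q (Q (c, Y) / q) Y := by
  unfold branch
  congr 1
  refine Finset.sum_congr rfl fun j _ => ?_
  have := hh c Y j
  rw [Int.cast_natCast, add_div, add_div] at this
  rw [Function.comp_apply, this]

lemma IsGeneratingPair.integral_density (hG : IsGeneratingPair P Q J) (c a b : ℝ) :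
    ∫ Y in a..b, J (c, Y) = P (c, b) - P (c, a) :=
  intervalIntegral.integral_eq_sub_of_hasDerivAt (fun Y _ => hG.hasDerivAt_left c Y)
    ((hG.continuous_density.comp (by fun_prop)).intervalIntegrable _ _)

lemma IsGeneratingPair.integral_density_one (hG : IsGeneratingPair P Q J) (c : ℝ) :
    ∫ Y in (0 : ℝ)..1, J (c, Y) = 1 := by
  have := hG.left_add_one_snd c 0
  rw [zero_add] at this
  rw [hG.integral_density, this]; ring

lemma IsGeneratingPair.continuous_slice (hG : IsGeneratingPair P Q J) (c : ℝ) :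
    Continuous fun Y => J (c, Y) :=
  hG.continuous_density.comp (by fun_prop)

/-- Substituting `x = P(c,Y)/q` turns the new circle average into the integral of old branch
averages against `J(c,·)`, a probability density over one period. -/
lemma abs_avg_comp_sub_le (hG : IsGeneratingPair P Q J) (hh : IsGenerated h q P Q) (hq : 0 < q)
    (hH : Continuous H) (hhc : Continuous h) {f : C(Torus, ℝ)} {ε : ℝ}
    (hR : ∀ x y, |branch H f q x y - avg H f y| ≤ ε) (c : ℝ) :
    |avg (H ∘ h) f c - ∫ Y in (0 : ℝ)..1, avg H f Y * J (c, Y)| ≤ ε := by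
  have hc : Continuous fun x => f ((H ∘ h) (proj (x, c))) :=
    (continuous_comp_proj (hH.comp hhc) f).comp (by fun_prop : Continuous fun t : ℝ => (t, c))
  have hJ := hG.continuous_slice c
  have hQ := hG.smooth_right.continuous
  have e1 : avg (H ∘ h) f c =
      ∫ Y in (0 : ℝ)..1, branch H f q (Q (c, Y) / q) Y * J (c, Y) := by
    unfold avg
    rw [integral_eq_integral_sum_branches hc (fun x => by simp only [proj_add_one_left])
      (hG.hasDerivAt_left c) hJ hq 0 (by rw [hG.left_add_one_snd]), zero_add]
    refine intervalIntegral.integral_congr fun Y _ => ?_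
    have := branch_comp (H := H) hh f c Y
    simp only [branch, ← add_div] at this ⊢
    rw [this]
  have hb : Continuous fun Y => branch H f q (Q (c, Y) / q) Y :=
    (continuous_branch hH f q).comp (by fun_prop : Continuous fun Y : ℝ => (Q (c, Y) / q, Y))
  have hb1 : Continuous fun Y => branch H f q (Q (c, Y) / q) Y * J (c, Y) := hb.mul hJ
  have hb2 : Continuous fun Y => avg H f Y * J (c, Y) := (continuous_avg hH f).mul hJ
  rw [e1, ← intervalIntegral.integral_sub (hb1.intervalIntegrable _ _)
    (hb2.intervalIntegrable _ _)]
  have h2 := abs_integral_le_integral (a := 0) (b := 1) zero_le_one (continuous_const.mul hJ)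
    (f := fun Y => branch H f q (Q (c, Y) / q) Y * J (c, Y) - avg H f Y * J (c, Y))
    (g := fun Y => ε * J (c, Y)) fun Y => by
      rw [← sub_mul, abs_mul, abs_of_pos (hG.density_pos _)]
      exact mul_le_mul_of_nonneg_right (hR _ _) (hG.density_pos _).le
  rwa [intervalIntegral.integral_const_mul, hG.integral_density_one, mul_one] at h2

/-- On the Cantor set, the average of a mean zero function contracts. -/
lemma abs_integral_mul_density_le {u E' F' j : ℝ → ℝ} {I a σ B D : ℝ} (hu : Continuous u)
    (hui : ∫ y in (0 : ℝ)..1, u y = I) (hE : Continuous E') (hj : Continuous j)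
    (hE0 : ∀ y, 0 ≤ E' y) (hE1 : ∫ y in (0 : ℝ)..1, E' y = 1)
    (hF : ∀ y, F' y = a + (1 - a) * E' y) (ha : a ≤ 1)
    (hj1 : ∫ y in (0 : ℝ)..1, j y = 1) (hjF : ∀ y, |j y - F' y| ≤ σ)
    (hB : ∀ y, |u y - I| ≤ B) (hD : ∀ y, E' y ≠ 0 → |u y - I| ≤ D) :
    |(∫ y in (0 : ℝ)..1, u y * j y) - I| ≤ (1 - a) * D + B * σ := by
  have hii : ∀ {g : ℝ → ℝ}, Continuous g → IntervalIntegrable g volume 0 1 := fun hg =>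
    hg.intervalIntegrable _ _
  -- The uniform part of the density sees the mean-zero function `u - I` and integrates to zero, so
  -- it may be subtracted; what remains carries the weight `1 - a`.
  have e : (∫ y in (0 : ℝ)..1, u y * j y) - I =
      ∫ y in (0 : ℝ)..1, ((u y - I) * j y - a * (u y - I)) := by
    have h1 : Continuous fun y => u y - I := hu.sub continuous_const
    have e1 : ∀ y, (u y - I) * j y - a * (u y - I) = u y * j y - (I * j y + a * (u y - I)) :=
      fun y => by ring
    simp only [e1]
    rw [intervalIntegral.integral_sub (hii (by fun_prop)) (hii (by fun_prop)),
      intervalIntegral.integral_add (hii (by fun_prop)) (hii (by fun_prop)),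
      intervalIntegral.integral_const_mul, intervalIntegral.integral_const_mul, hj1,
      intervalIntegral.integral_sub (hii (by fun_prop)) (by simp), hui]
    simp
  rw [e]
  have := abs_integral_le_integral (a := 0) (b := 1) zero_le_one
    (f := fun y => (u y - I) * j y - a * (u y - I)) (g := fun y => B * σ + (1 - a) * D * E' y)
    (continuous_const.add (continuous_const.mul hE)) fun y => by
      have e2 : (u y - I) * j y - a * (u y - I) =
          (u y - I) * (j y - F' y) + (1 - a) * ((u y - I) * E' y) := by rw [hF]; ring
      rw [e2]
      refine (abs_add_le _ _).trans (add_le_add ?_ ?_)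
      · rw [abs_mul]
        exact mul_le_mul (hB y) (hjF y) (abs_nonneg _) ((abs_nonneg _).trans (hB y))
      · rw [abs_mul, abs_of_nonneg (by linarith : 0 ≤ 1 - a), mul_assoc, abs_mul,
          abs_of_nonneg (hE0 y)]
        refine mul_le_mul_of_nonneg_left ?_ (by linarith)
        by_cases h : E' y = 0
        · simp [h]
        · exact mul_le_mul_of_nonneg_right (hD y h) (hE0 y)
  refine this.trans (le_of_eq ?_)
  rw [intervalIntegral.integral_add (by simp) (hii (by fun_prop)),
    intervalIntegral.integral_const_mul ((1 - a) * D), hE1]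
  simp; ring

/-- The same comparison over an interval that starts on the Cantor set. -/
lemma abs_integral_mul_density_le_of_mem {u E E' F' j : ℝ → ℝ} {I a σ B D y₀ y₁ : ℝ}
    (hEd : ∀ y, HasDerivAt E (E' y) y) (hE : Continuous E') (hj : Continuous j)
    (hE0 : ∀ y, 0 ≤ E' y) (hEy : y₁ ≤ E y₁) (hEy₀ : E y₀ = y₀) (hy : y₀ ≤ y₁)
    (hF : ∀ y, F' y = a + (1 - a) * E' y) (ha0 : 0 ≤ a) (ha : a ≤ 1)
    (hjF : ∀ y, |j y - F' y| ≤ σ) (hσ : σ ≤ 1 / 2) (hD0 : 0 ≤ D)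
    (hB : ∀ y, |u y - I| ≤ B) (hD : ∀ y, E' y ≠ 0 → |u y - I| ≤ D) :
    |∫ y in y₀..y₁, (u y - I) * j y| ≤
      (D + 2 * (D * σ + B * (a + σ))) * ∫ y in y₀..y₁, j y := by
  have hii : ∀ {g : ℝ → ℝ}, Continuous g → IntervalIntegrable g volume y₀ y₁ := fun hg =>
    hg.intervalIntegrable _ _
  have hB0 : 0 ≤ B := (abs_nonneg _).trans (hB 0)
  have hσ0 : 0 ≤ σ := (abs_nonneg _).trans (hjF 0)
  have h1 := abs_integral_le_integral hy
    (f := fun y => (u y - I) * j y) (g := fun y => D * j y + (D * σ + B * (a + σ)))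
    ((continuous_const.mul hj).add continuous_const) fun y => by
      have e2 : (u y - I) * j y = (u y - I) * (j y - F' y) + a * (u y - I) +
          (1 - a) * ((u y - I) * E' y) := by rw [hF]; ring
      have h3 : |(u y - I) * (j y - F' y)| ≤ B * σ := by
        rw [abs_mul]
        exact mul_le_mul (hB y) (hjF y) (abs_nonneg _) hB0
      have h4 : |a * (u y - I)| ≤ a * B := by
        rw [abs_mul, abs_of_nonneg ha0]; exact mul_le_mul_of_nonneg_left (hB y) ha0
      have h5 : |(1 - a) * ((u y - I) * E' y)| ≤ (1 - a) * (D * E' y) := by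
        rw [abs_mul, abs_of_nonneg (by linarith : 0 ≤ 1 - a), abs_mul, abs_of_nonneg (hE0 y)]
        refine mul_le_mul_of_nonneg_left ?_ (by linarith)
        by_cases h : E' y = 0
        · simp [h]
        · exact mul_le_mul_of_nonneg_right (hD y h) (hE0 y)
      have h6 : (1 - a) * (D * E' y) ≤ D * (j y + σ) := by
        have : (1 - a) * E' y ≤ j y + σ := by
          have := (abs_le.1 (hjF y)).1
          rw [hF] at this; linarith
        nlinarith
      rw [e2]
      linarith [abs_add_le ((u y - I) * (j y - F' y) + a * (u y - I)) ((1 - a) * ((u y - I) * E' y)),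
        abs_add_le ((u y - I) * (j y - F' y)) (a * (u y - I))]
  rw [intervalIntegral.integral_add (hii (by fun_prop)) (by simp),
    intervalIntegral.integral_const_mul, intervalIntegral.integral_const, smul_eq_mul] at h1
  -- Here `E y₀ = y₀` and `y₁ ≤ E y₁` enter: they give `∫ E' ≥ y₁ - y₀`. Thus the elapsed mass
  -- dominates the elapsed height on every initial interval, and the uniform part, of mass `a (y₁ -
  -- y₀)`, is never more than about a share `a` of it.
  have h7 : (1 - σ) * (y₁ - y₀) ≤ ∫ y in y₀..y₁, j y := by
    have hle : ∫ y in y₀..y₁, (a + (1 - a) * E' y - σ) ≤ ∫ y in y₀..y₁, j y :=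
      intervalIntegral.integral_mono hy (hii (by fun_prop)) (hii hj) fun y => by
        have := (abs_le.1 (hjF y)).1
        rw [hF] at this; simp only; linarith
    have hint : ∫ y in y₀..y₁, E' y = E y₁ - E y₀ :=
      intervalIntegral.integral_eq_sub_of_hasDerivAt (fun y _ => hEd y) (hii hE)
    rw [intervalIntegral.integral_sub (hii (by fun_prop)) (by simp),
      intervalIntegral.integral_add (by simp) (hii (by fun_prop)),
      intervalIntegral.integral_const_mul, hint] at hle
    simp only [intervalIntegral.integral_const, smul_eq_mul, hEy₀] at hle
    nlinarith
  have h8 : y₁ - y₀ ≤ 2 * ∫ y in y₀..y₁, j y := by nlinarith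
  have h9 : 0 ≤ D * σ + B * (a + σ) := by positivity
  nlinarith

/-- Off a neighbourhood of the Cantor set the averages hardly change. -/
lemma abs_integral_mul_density_sub_le {u φ R' j : ℝ → ℝ} {c ρ e δ r σ M v : ℝ} (hu : Continuous u)
    (hφ : Continuous φ) (hφp : ∀ y, φ (y + 1) = φ y) (hφ1 : ∀ y, |φ y| ≤ 1)
    (hφl : ∀ x y, |φ x - φ y| ≤ 2 * Real.pi * |x - y|) (hu1 : ∀ y, |u y| ≤ 1) (hj : Continuous j)
    (hj0 : ∀ y, 0 ≤ j y) (hj1 : ∫ y in (0 : ℝ)..1, j y = 1) (hR : Continuous R')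
    (hR1 : ∫ y in (0 : ℝ)..1, R' (y - c) = 1) (hδ : 0 ≤ δ) (hR0 : ∀ y, 0 ≤ R' y) (hr : 0 ≤ r)
    (hRr : ∀ y : ℝ, (∀ k : ℤ, r ≤ |y - k|) → R' y = δ) (hM : ∀ y, R' y ≤ M)
    (hjR : ∀ y, |j y - R' (y - c)| ≤ σ) (he : 0 ≤ e) (hbulk : ∀ y, ¬ NearCantor ρ y → |u y - φ y| ≤ e)
    (hv : 0 ≤ v) (hvol : volume ({y | NearCantor ρ y} ∩ Set.Icc 0 1) ≤ ENNReal.ofReal v) :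
    |(∫ y in (0 : ℝ)..1, u y * j y) - φ c| ≤
      e + 2 * (M + σ) * v + σ + 2 * Real.pi * r + 2 * δ := by
  have hii : ∀ {g : ℝ → ℝ}, Continuous g → IntervalIntegrable g volume 0 1 := fun hg =>
    hg.intervalIntegrable _ _
  have hσ0 : 0 ≤ σ := (abs_nonneg _).trans (hjR 0)
  have hM0 : 0 ≤ M := (hR0 0).trans (hM 0)
  have hjM : ∀ y, j y ≤ M + σ := fun y => by
    linarith [(abs_le.1 (hjR y)).2, hM (y - c)]
  have hRc : Continuous fun y => R' (y - c) := by fun_prop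
  have h1 : |∫ y in (0 : ℝ)..1, (u y - φ y) * j y| ≤ e + 2 * (M + σ) * v := by
    have h2 := abs_integral_le_integral (a := 0) (b := 1) zero_le_one
      (f := fun y => (u y - φ y) * j y) (g := fun y => |u y - φ y| * j y)
      (by fun_prop) fun y => by rw [abs_mul, abs_of_nonneg (hj0 y)]
    have h3 := integral_le_of_support_near (ρ := ρ) (g := fun y => |u y - φ y| * j y - e * j y)
      (ε := 0) (M := 2 * (M + σ)) (by fun_prop) (by positivity) (fun y _ => by
        have : |u y - φ y| ≤ 2 := (abs_sub _ _).trans (by linarith [hu1 y, hφ1 y])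
        nlinarith [hj0 y, hjM y, mul_nonneg he (hj0 y)])
      (fun y hy => by nlinarith [hbulk y hy, hj0 y]) le_rfl hv hvol
    rw [intervalIntegral.integral_sub (hii (by fun_prop)) (hii (by fun_prop)),
      intervalIntegral.integral_const_mul, hj1] at h3
    linarith
  have h4 : |∫ y in (0 : ℝ)..1, φ y * (j y - R' (y - c))| ≤ σ := by
    have := abs_integral_le_integral (a := 0) (b := 1) zero_le_one
      (f := fun y => φ y * (j y - R' (y - c))) (g := fun _ => σ) continuous_const fun y => by
        rw [abs_mul]
        exact (mul_le_mul (hφ1 y) (hjR y) (abs_nonneg _) zero_le_one).trans (one_mul _).le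
    simpa using this
  have hφk : ∀ (k : ℤ) y, φ (y + k) = φ y := fun k y => by
    have := (show Function.Periodic φ 1 from hφp).int_mul k y
    simpa using this
  have h5 : |∫ y in (0 : ℝ)..1, (φ y - φ c) * R' (y - c)| ≤ 2 * Real.pi * r + 2 * δ := by
    have := abs_integral_le_integral (a := 0) (b := 1) zero_le_one
      (f := fun y => (φ y - φ c) * R' (y - c)) (g := fun y => 2 * Real.pi * r * R' (y - c) + 2 * δ)
      (by fun_prop) fun y => by
        rw [abs_mul, abs_of_nonneg (hR0 _)]
        by_cases h : ∀ k : ℤ, r ≤ |y - c - k|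
        · rw [hRr _ h]
          have : |φ y - φ c| ≤ 2 := (abs_sub _ _).trans (by linarith [hφ1 y, hφ1 c])
          have : 0 ≤ 2 * Real.pi * r * δ := by positivity
          nlinarith
        · push Not at h
          obtain ⟨k, hk⟩ := h
          have h6 : |φ y - φ c| ≤ 2 * Real.pi * r := by
            rw [← hφk k c]
            refine (hφl _ _).trans ?_
            rw [show y - (c + k) = y - c - k by ring]
            exact mul_le_mul_of_nonneg_left hk.le (by positivity)
          nlinarith [hR0 (y - c)]
    rw [intervalIntegral.integral_add (hii (by fun_prop)) (by simp),
      intervalIntegral.integral_const_mul, hR1] at this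
    simpa using this
  -- The three errors are: `u` against `φ`, the density against its model `R'(· - c)`, and the
  -- variation of `φ` seen by that model, which sits near `c` up to a background `δ`.
  have e1 : (∫ y in (0 : ℝ)..1, u y * j y) - φ c = (∫ y in (0 : ℝ)..1, (u y - φ y) * j y) +
      (∫ y in (0 : ℝ)..1, φ y * (j y - R' (y - c))) + ∫ y in (0 : ℝ)..1, (φ y - φ c) * R' (y - c) := by
    rw [← intervalIntegral.integral_add (hii (by fun_prop)) (hii (by fun_prop)),
      ← intervalIntegral.integral_add (hii (by fun_prop)) (hii (by fun_prop))]
    have e2 : ∀ y, (u y - φ y) * j y + φ y * (j y - R' (y - c)) + (φ y - φ c) * R' (y - c) =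
        u y * j y - φ c * R' (y - c) := fun y => by ring
    simp only [e2]
    rw [intervalIntegral.integral_sub (hii (by fun_prop)) (hii (by fun_prop)),
      intervalIntegral.integral_const_mul, hR1, mul_one]
  rw [e1]
  linarith [abs_add_three (∫ y in (0 : ℝ)..1, (u y - φ y) * j y)
    (∫ y in (0 : ℝ)..1, φ y * (j y - R' (y - c))) (∫ y in (0 : ℝ)..1, (φ y - φ c) * R' (y - c))]

end AbC

namespace AbC

/-! ### Time averages of translations -/

lemma sum_range_mul_eq {M : Type*} [AddCommMonoid M] (g : ℕ → M) (B q : ℕ) :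
    ∑ i ∈ Finset.range (B * q), g i =
      ∑ b ∈ Finset.range B, ∑ i ∈ Finset.range q, g (b * q + i) := by
  induction B with
  | zero => simp
  | succ B ih => rw [Nat.succ_mul, Finset.sum_range_add, ih, Finset.sum_range_succ]

/-- Multiplication by `p` permutes the residues modulo `q`. -/
lemma sum_coprime_eq {φ : ℝ → ℝ} (hφ : ∀ x, φ (x + 1) = φ x) {p : ℤ} {q : ℕ} (hq : 0 < q)
    (hpq : IsCoprime p q) (t : ℝ) :
    ∑ i ∈ Finset.range q, φ (t + i * (p / q)) = ∑ j ∈ Finset.range q, φ (t + j / q) := by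
  have hq' : (q : ℝ) ≠ 0 := by positivity
  have hqz : (q : ℤ) ≠ 0 := by exact_mod_cast hq.ne'
  set e : ℕ → ℕ := fun i => ((i * p) % q : ℤ).toNat with he
  have hez : ∀ i, (e i : ℤ) = (i * p) % q := fun i => Int.toNat_of_nonneg (Int.emod_nonneg _ hqz)
  have hmaps : ∀ i ∈ Finset.range q, e i ∈ Finset.range q := fun i _ => by
    rw [Finset.mem_range]
    have := Int.emod_lt_of_pos ((i : ℤ) * p) (by exact_mod_cast hq : (0 : ℤ) < q)
    rw [← hez] at this
    exact_mod_cast this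
  have hinj : Set.InjOn e (Finset.range q) := by
    intro i hi j hj hij
    have h1 : ((i : ℤ) * p) % q = (j * p) % q := by rw [← hez, ← hez, hij]
    have h2 : (q : ℤ) ∣ ((j : ℤ) - i) * p := by
      rw [sub_mul]; exact Int.ModEq.dvd h1
    have h3 := (hpq.symm.dvd_of_dvd_mul_right h2)
    have h4 := Int.eq_zero_of_abs_lt_dvd h3 (by
      have hi' := Finset.mem_range.1 hi
      have hj' := Finset.mem_range.1 hj
      rw [abs_lt]; constructor <;> omega)
    omega
  refine Finset.sum_nbij e hmaps hinj
    (Finset.surjOn_of_injOn_of_card_le e hmaps hinj le_rfl) fun i _ => ?_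
  have h5 : (i * p : ℝ) = q * ((i * p / q : ℤ) : ℝ) + e i := by
    have := Int.mul_ediv_add_emod ((i : ℤ) * p) q
    rw [← hez] at this
    exact_mod_cast this.symm
  have h6 : t + i * (p / q) = t + e i / q + ((i * p / q : ℤ) : ℝ) := by
    rw [← mul_div_assoc, h5]; field_simp; ring
  rw [h6]
  have := (show Function.Periodic φ 1 from hφ).int_mul (i * p / q : ℤ) (t + e i / q)
  rwa [mul_one] at this

/-- Birkhoff averages of a translation close to a rational one are close to integrals of the
average over the rational orbits. -/
lemma abs_sum_sub_integral_le {φ : ℝ → ℝ} (hφc : Continuous φ) (hφ : ∀ x, φ (x + 1) = φ x) {p : ℤ}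
    {q L : ℕ} (hq : 0 < q) (hL : 0 < L) (hpq : IsCoprime p q) {ε : ℝ}
    (hε : ∀ s t : ℝ, |s - t| ≤ 1 / (L * q) → |φ s - φ t| ≤ ε) (B : ℕ) (θ : ℝ) :
    |∑ i ∈ Finset.range (B * q), φ (θ + i * (p / q + 1 / (L * q ^ 2))) -
      q * (L * q) * ∫ t in θ..(θ + B / (L * q)), (1 / q : ℝ) * ∑ j ∈ Finset.range q, φ (t + j / q)| ≤
      B * q * (2 * ε) := by
  have hq' : (0 : ℝ) < q := by exact_mod_cast hq
  have hL' : (0 : ℝ) < L := by exact_mod_cast hL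
  set A : ℝ → ℝ := fun t => (1 / q : ℝ) * ∑ j ∈ Finset.range q, φ (t + j / q) with hA
  have hAc : Continuous A := by fun_prop
  have hAε : ∀ s t : ℝ, |s - t| ≤ 1 / (L * q) → |A s - A t| ≤ ε := by
    intro s t h
    simp only [hA]
    rw [← mul_sub, ← Finset.sum_sub_distrib, abs_mul, abs_of_pos (by positivity), one_div,
      inv_mul_le_iff₀ hq']
    calc |∑ j ∈ Finset.range q, (φ (s + j / q) - φ (t + j / q))|
        ≤ ∑ j ∈ Finset.range q, ε := (Finset.abs_sum_le_sum_abs _ _).trans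
          (Finset.sum_le_sum fun j _ => hε _ _ (by rwa [add_sub_add_right_eq_sub]))
      _ = q * ε := by simp
  -- After `b q` steps the orbit has advanced by `b p + b/(L q)`: an integer plus a small drift.
  -- Each block of `q` steps therefore samples a slowly moving `q`-point orbit, and the block sums
  -- form a Riemann sum of the branch average.
  set τ : ℕ → ℝ := fun b => θ + b / (L * q) with hτ
  have hsplit : ∫ t in θ..(θ + B / (L * q)), A t =
      ∑ b ∈ Finset.range B, ∫ t in τ b..τ (b + 1), A t := by
    rw [intervalIntegral.sum_integral_adjacent_intervals fun k _ => hAc.intervalIntegrable _ _]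
    simp [hτ]
  have hφk : ∀ (k : ℤ) y, φ (y + k) = φ y := fun k y => by
    have := (show Function.Periodic φ 1 from hφ).int_mul k y
    simpa using this
  have hblock : ∀ b : ℕ, |∑ i ∈ Finset.range q,
      φ (θ + ((b * q + i : ℕ) : ℝ) * (p / q + 1 / (L * q ^ 2))) - q * (L * q) *
      ∫ t in τ b..τ (b + 1), A t| ≤ q * (2 * ε) := by
    intro b
    have h1 : |∑ i ∈ Finset.range q, φ (θ + ((b * q + i : ℕ) : ℝ) * (p / q + 1 / (L * q ^ 2))) -
        q * A (τ b)| ≤ q * ε := by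
      simp only [hA]
      rw [← mul_assoc, mul_one_div_cancel hq'.ne', one_mul, ← sum_coprime_eq hφ hq hpq,
        ← Finset.sum_sub_distrib]
      calc |∑ i ∈ Finset.range q, (φ (θ + ((b * q + i : ℕ) : ℝ) * (p / q + 1 / (L * q ^ 2))) -
            φ (τ b + i * (p / q)))|
          ≤ ∑ i ∈ Finset.range q, ε := (Finset.abs_sum_le_sum_abs _ _).trans
            (Finset.sum_le_sum fun i hi => ?_)
        _ = q * ε := by simp
      have e1 : θ + ((b * q + i : ℕ) : ℝ) * (p / q + 1 / (L * q ^ 2)) =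
          (τ b + i * (p / q) + i / (L * q ^ 2)) + ((b * p : ℤ) : ℝ) := by
        simp only [hτ]; push_cast; field_simp; ring
      rw [e1, hφk]
      refine hε _ _ ?_
      rw [add_sub_cancel_left, abs_of_nonneg (by positivity), div_le_div_iff₀ (by positivity)
        (by positivity)]
      have : (i : ℝ) ≤ q := by exact_mod_cast (Finset.mem_range.1 hi).le
      calc (i : ℝ) * (L * q) ≤ q * (L * q) := by gcongr
        _ = 1 * (L * q ^ 2) := by ring
    have hlen : τ (b + 1) - τ b = 1 / (L * q) := by simp only [hτ]; push_cast; ring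
    have h2 : |A (τ b) - (L * q) * ∫ t in τ b..τ (b + 1), A t| ≤ ε := by
      have e2 : A (τ b) - (L * q) * ∫ t in τ b..τ (b + 1), A t =
          (L * q) * ∫ t in τ b..τ (b + 1), (A (τ b) - A t) := by
        rw [intervalIntegral.integral_sub (by simp) (hAc.intervalIntegrable _ _),
          intervalIntegral.integral_const, hlen, smul_eq_mul, mul_sub]
        congr 1; field_simp
      rw [e2, abs_mul, abs_of_pos (by positivity)]
      have h3 := intervalIntegral.norm_integral_le_of_norm_le_const (a := τ b) (b := τ (b + 1))
        (C := ε) (f := fun t => A (τ b) - A t) fun t ht => hAε _ _ (by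
          have hle : τ b ≤ τ (b + 1) := by
            have : 0 ≤ 1 / ((L : ℝ) * q) := by positivity
            linarith
          rw [Set.uIoc_of_le hle] at ht
          rw [abs_sub_comm, abs_of_nonneg (by linarith [ht.1])]
          linarith [ht.2])
      rw [hlen, abs_of_pos (by positivity), Real.norm_eq_abs] at h3
      calc (L * q : ℝ) * |∫ t in τ b..τ (b + 1), (A (τ b) - A t)| ≤ (L * q) * (ε * (1 / (L * q))) := by
            gcongr
        _ = ε := by field_simp
    have h4 : |q * A (τ b) - q * (L * q) * ∫ t in τ b..τ (b + 1), A t| ≤ q * ε := by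
      rw [mul_assoc, ← mul_sub, abs_mul, abs_of_pos hq']
      gcongr
    have := abs_sub_le (∑ i ∈ Finset.range q,
      φ (θ + ((b * q + i : ℕ) : ℝ) * (p / q + 1 / (L * q ^ 2)))) (q * A (τ b))
      (q * (L * q) * ∫ t in τ b..τ (b + 1), A t)
    linarith
  rw [sum_range_mul_eq, hsplit, Finset.mul_sum, ← Finset.sum_sub_distrib]
  calc _ ≤ ∑ b ∈ Finset.range B, q * (2 * ε) :=
        (Finset.abs_sum_le_sum_abs _ _).trans (Finset.sum_le_sum fun b _ => hblock b)
    _ = B * q * (2 * ε) := by simp; ring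

/-- From averages along multiples of `q` to averages along all large times. -/
lemma abs_sum_sub_le_of_multiples {v : ℕ → ℝ} {I X M : ℝ} {q K : ℕ} (hq : 0 < q) (hK : 0 < K)
    (hv : ∀ i, |v i - I| ≤ M)
    (hX : ∀ B : ℕ, 0 < B → |∑ i ∈ Finset.range (B * q), (v i - I)| ≤ B * q * X) {N : ℕ}
    (hN : K * q ≤ N) : |(N : ℝ)⁻¹ * ∑ i ∈ Finset.range N, v i - I| ≤ X + M / K := by
  set B := N / q with hB
  set r := N % q with hr
  have hN' : N = B * q + r := by rw [hB, hr, mul_comm]; exact (Nat.div_add_mod N q).symm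
  have hrq : r < q := Nat.mod_lt _ hq
  have hBK : K ≤ B := (Nat.le_div_iff_mul_le hq).2 hN
  have hN0 : 0 < N := (Nat.mul_pos hK hq).trans_le hN
  have hN0' : (0 : ℝ) < N := by exact_mod_cast hN0
  have hM : 0 ≤ M := (abs_nonneg _).trans (hv 0)
  have hK' : (0 : ℝ) < K := by exact_mod_cast hK
  have hX0 : 0 ≤ X := by
    have h1 := (abs_nonneg _).trans (hX B (hK.trans_le hBK))
    have h2 : (0 : ℝ) < B * q := by exact_mod_cast Nat.mul_pos (hK.trans_le hBK) hq
    exact nonneg_of_mul_nonneg_right h1 h2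
  have e : (N : ℝ)⁻¹ * ∑ i ∈ Finset.range N, v i - I = (N : ℝ)⁻¹ * ∑ i ∈ Finset.range N, (v i - I) := by
    rw [Finset.sum_sub_distrib]; simp; field_simp
  rw [e, abs_mul, abs_of_pos (by positivity), inv_mul_le_iff₀ hN0']
  have h1 : |∑ i ∈ Finset.range N, (v i - I)| ≤ B * q * X + q * M := by
    rw [hN', Finset.sum_range_add]
    refine (abs_add_le _ _).trans (add_le_add (hX B (hK.trans_le hBK)) ?_)
    calc |∑ i ∈ Finset.range r, (v (B * q + i) - I)| ≤ ∑ i ∈ Finset.range r, M :=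
          (Finset.abs_sum_le_sum_abs _ _).trans (Finset.sum_le_sum fun i _ => hv _)
      _ = r * M := by simp
      _ ≤ q * M := by gcongr
  have h2 : (B * q : ℝ) ≤ N := by exact_mod_cast (by omega : B * q ≤ N)
  have h3 : (K * q : ℝ) ≤ N := by exact_mod_cast hN
  -- The incomplete last block has fewer than `q` terms, which is a share at most `1/K` of `N`.
  have h4 : (q : ℝ) * M ≤ N * (M / K) := by
    rw [mul_div_assoc', le_div_iff₀ hK']
    nlinarith
  nlinarith

/-- The conjugated translation along an orbit. -/
lemma conj_shift_iterate (H : Equiv.Perm Torus) (t θ y : ℝ) (i : ℕ) :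
    (H * shift t * H⁻¹)^[i] (H (proj (θ, y))) = H (proj (θ + i * t, y)) := by
  rw [Equiv.Perm.iterate_eq_pow, conj_pow, shift_pow]
  simp [Equiv.Perm.mul_apply, shift_proj]

lemma birkhoffAverage_conj_shift (H : Equiv.Perm Torus) (f : C(Torus, ℝ)) {p : ℤ} {q : ℕ} (hq : 0 < q)
    (hpq : IsCoprime p q) (x y : ℝ) :
    birkhoffAverage ℝ (H * shift (p / q) * H⁻¹) f q (H (proj (x, y))) = branch H f q x y := by
  rw [birkhoffAverage, birkhoffSum, branch, smul_eq_mul, one_div]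
  congr 1
  rw [← sum_coprime_eq (φ := fun t => f (H (proj (t, y))))
    (fun t => by simp only [proj_add_one_left]) hq hpq]
  simp only [conj_shift_iterate]

lemma IsGeneratingPair.surjective_left {P Q J : ℝ × ℝ → ℝ} (hG : IsGeneratingPair P Q J) (c t : ℝ) :
    ∃ Y, P (c, Y) = t := by
  obtain ⟨K, _, hK, _⟩ := exists_fibre_inverse hG.smooth_left hG.hasDerivAt_left hG.density_pos
    hG.left_add_one_snd
  exact ⟨_, hK c t⟩

/-- Orbits through the Cantor set in two successive stages have good averages at all
intermediate times. -/
lemma abs_birkhoffAverage_sub_le {P Q J : ℝ × ℝ → ℝ} {H h : Equiv.Perm Torus} {p : ℤ} {q L K N : ℕ}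
    {f : C(Torus, ℝ)} {E E' F' : ℝ → ℝ} {a σ D ε c y₀ θ : ℝ}
    (hG : IsGeneratingPair P Q J) (hh : IsGenerated h q P Q) (hq : 0 < q) (hL : 0 < L) (hK : 0 < K)
    (hpq : IsCoprime p q) (hH : Continuous H) (hhc : Continuous h)
    (hR : ∀ x y, |branch H f q x y - avg H f y| ≤ ε)
    (hmod : ∀ s t y : ℝ, |s - t| ≤ 1 / (L * q) →
      |f ((H * h) (proj (s, y))) - f ((H * h) (proj (t, y)))| ≤ ε)
    (hEd : ∀ y, HasDerivAt E (E' y) y) (hE : Continuous E') (hE0 : ∀ y, 0 ≤ E' y)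
    (hEy : ∀ y, y ≤ E y) (hEy₀ : E y₀ = y₀) (hF : ∀ y, F' y = a + (1 - a) * E' y) (ha0 : 0 ≤ a)
    (ha : a ≤ 1) (hjF : ∀ y, |J (c, y) - F' y| ≤ σ) (hσ : σ ≤ 1 / 2) (hD0 : 0 ≤ D)
    (hD : ∀ y, E' y ≠ 0 → |avg H f y - ∫ z, f z| ≤ D)
    (hθ : P (c, y₀) = q * θ) (hN : K * q ≤ N) :
    |birkhoffAverage ℝ ((H * h) * shift (p / q + 1 / (L * q ^ 2)) * (H * h)⁻¹) f N
      ((H * h) (proj (θ, c))) - ∫ z, f z| ≤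
      D + 2 * (D * σ + 2 * ‖f‖ * (a + σ)) + 3 * ε + 2 * ‖f‖ / K := by
  have hq' : (0 : ℝ) < q := by exact_mod_cast hq
  have hL' : (0 : ℝ) < L := by exact_mod_cast hL
  set I := ∫ z, f z with hI
  set φ : ℝ → ℝ := fun t => f ((H * h) (proj (t, c))) with hφ
  have hHh : Continuous (H * h) := hH.comp hhc
  have hφc : Continuous φ := (continuous_comp_proj hHh f).comp (by fun_prop)
  have hφp : ∀ x, φ (x + 1) = φ x := fun x => by simp only [hφ, proj_add_one_left]
  have hfI : ∀ z, |f z - I| ≤ 2 * ‖f‖ := fun z => by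
    have h1 := f.norm_coe_le_norm z
    have h2 := norm_integral_le_of_norm_le_const (μ := (volume : Measure Torus)) (C := ‖f‖)
      (ae_of_all _ fun z => f.norm_coe_le_norm z)
    rw [volume_real_univ, mul_one] at h2
    rw [Real.norm_eq_abs] at h1 h2
    linarith [abs_sub (f z) I]
  rw [birkhoffAverage, birkhoffSum, smul_eq_mul]
  simp only [conj_shift_iterate]
  refine abs_sum_sub_le_of_multiples hq hK (fun i => hfI _) (fun B hB => ?_) hN
  have hB' : (0 : ℝ) < B := by exact_mod_cast hB
  have h1 := abs_sum_sub_integral_le hφc hφp hq hL hpq (fun s t hst => hmod s t c hst) B θ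
  -- The heights `y₀` and `y₁` correspond to the start and the end of the sweep under `P(c, y) = q
  -- t`.
  obtain ⟨y₁, hy₁⟩ := hG.surjective_left c (q * (θ + B / (L * q)))
  have hmono : StrictMono fun y => P (c, y) :=
    strictMono_of_hasDerivAt_pos (hG.hasDerivAt_left c) fun y => hG.density_pos _
  have hτ : (0 : ℝ) < B / (L * q) := by positivity
  have hy : y₀ ≤ y₁ := by
    refine hmono.le_iff_le.1 ?_
    simp only [hθ, hy₁]
    nlinarith
  have hJ := hG.continuous_density
  have hJc := hG.continuous_slice c
  have hQ := hG.smooth_right.continuous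
  have hu := continuous_avg hH f
  have hb : Continuous fun Y => branch H f q (Q (c, Y) / q) Y :=
    (continuous_branch hH f q).comp (by fun_prop : Continuous fun Y : ℝ => (Q (c, Y) / q, Y))
  obtain ⟨br, hbr, hbe⟩ : ∃ br : ℝ → ℝ, Continuous br ∧
    ∀ y, branch H f q (Q (c, y) / q) y = br y := ⟨_, hb, fun _ => rfl⟩
  have hii : ∀ {g : ℝ → ℝ}, Continuous g → IntervalIntegrable g volume y₀ y₁ := fun hg =>
    hg.intervalIntegrable _ _
  have hint : ∫ y in y₀..y₁, J (c, y) = B / L := by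
    rw [hG.integral_density, hθ, hy₁]; field_simp; ring
  -- The substitution `t = P(c,y)/q` expresses the sweep along the circle as an integral over
  -- heights with density `J(c,·)`; the total mass is `B / L`.
  have hsub : q * ∫ t in θ..(θ + B / (L * q)), (1 / q : ℝ) * ∑ j ∈ Finset.range q, φ (t + j / q) =
      ∫ y in y₀..y₁, br y * J (c, y) := by
    have h2 := intervalIntegral.integral_comp_mul_deriv (a := y₀) (b := y₁)
      (f := fun y => P (c, y) / q) (f' := fun y => J (c, y) / q)
      (g := fun t => (1 / q : ℝ) * ∑ j ∈ Finset.range q, φ (t + j / q))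
      (fun y _ => (hG.hasDerivAt_left c y).div_const _)
      (by fun_prop : Continuous fun y => J (c, y) / q).continuousOn (by fun_prop)
    simp only [hθ, hy₁, mul_div_cancel_left₀ _ hq'.ne', Function.comp_apply] at h2
    rw [← h2, ← intervalIntegral.integral_const_mul]
    refine intervalIntegral.integral_congr fun y _ => ?_
    have h3 := branch_comp (H := H) hh f c y
    rw [← hbe, ← h3, branch]
    simp only [hφ, Equiv.Perm.mul_apply, Function.comp_apply]
    field_simp
  have h4 : |∫ y in y₀..y₁, (br y - I) * J (c, y)| ≤
      (D + 2 * (D * σ + 2 * ‖f‖ * (a + σ)) + ε) * (B / L) := by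
    have h5 := abs_integral_mul_density_le_of_mem (u := avg H f) (I := I) hEd hE hJc hE0 (hEy y₁)
      hEy₀ hy hF ha0 ha hjF hσ hD0 (fun y => abs_avg_sub_integral_le H f y) hD
    have h6 := abs_integral_le_integral hy
      (f := fun y => (br y - avg H f y) * J (c, y))
      (g := fun y => ε * J (c, y)) (by fun_prop) fun y => by
        rw [abs_mul, abs_of_pos (hG.density_pos _)]
        exact mul_le_mul_of_nonneg_right (hbe y ▸ hR _ _) (hG.density_pos _).le
    rw [intervalIntegral.integral_const_mul, hint] at h6
    rw [hint] at h5
    have e1 : ∫ y in y₀..y₁, (br y - I) * J (c, y) =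
        (∫ y in y₀..y₁, (avg H f y - I) * J (c, y)) +
        ∫ y in y₀..y₁, (br y - avg H f y) * J (c, y) := by
      rw [← intervalIntegral.integral_add (hii (by fun_prop)) (hii (by fun_prop))]
      refine intervalIntegral.integral_congr fun y _ => ?_
      ring
    rw [e1, add_mul]
    exact (abs_add_le _ _).trans (add_le_add h5 h6)
  have e2 : q * (L * q) * (∫ t in θ..(θ + B / (L * q)),
      (1 / q : ℝ) * ∑ j ∈ Finset.range q, φ (t + j / q)) - B * q * I =
      L * q * ∫ y in y₀..y₁, (br y - I) * J (c, y) := by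
    have e3 : ∀ y, (br y - I) * J (c, y) =
      br y * J (c, y) - I * J (c, y) := fun y => by ring
    simp only [e3]
    rw [intervalIntegral.integral_sub (hii (by fun_prop)) (hii (by fun_prop)),
      intervalIntegral.integral_const_mul I, hint, ← hsub]
    field_simp
  rw [Finset.sum_sub_distrib]
  simp only [Finset.sum_const, Finset.card_range, nsmul_eq_mul]
  push_cast
  have h7 : |q * (L * q) * (∫ t in θ..(θ + B / (L * q)),
      (1 / q : ℝ) * ∑ j ∈ Finset.range q, φ (t + j / q)) - B * q * I| ≤
      B * q * (D + 2 * (D * σ + 2 * ‖f‖ * (a + σ)) + ε) := by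
    rw [e2, abs_mul, abs_of_pos (by positivity)]
    calc _ ≤ L * q * ((D + 2 * (D * σ + 2 * ‖f‖ * (a + σ)) + ε) * (B / L)) := by gcongr
      _ = _ := by field_simp
  have h8 := abs_sub_le (∑ i ∈ Finset.range (B * q), φ (θ + i * (p / q + 1 / (L * q ^ 2))))
    (q * (L * q) * ∫ t in θ..(θ + B / (L * q)), (1 / q : ℝ) * ∑ j ∈ Finset.range q, φ (t + j / q))
    (B * q * I)
  calc _ ≤ B * q * (2 * ε) + B * q * (D + 2 * (D * σ + 2 * ‖f‖ * (a + σ)) + ε) :=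
        h8.trans (add_le_add h1 h7)
    _ = _ := by ring

end AbC

namespace AbC

/-! ### Efficient covers of images of neighbourhoods of the Cantor set -/

/-- `S` is covered by finitely many sets, of diameter at most `ε` and with sum of the `s`-th powers
of the diameters at most `ε`. -/
def HasCover (s ε : ℝ) (S : Set Torus) : Prop :=
  ∃ U : Finset (Set Torus), S ⊆ ⋃ u ∈ U, u ∧ (∀ u ∈ U, Metric.ediam u ≤ ENNReal.ofReal ε) ∧
    ∑ u ∈ U, Metric.ediam u ^ s ≤ ENNReal.ofReal ε

lemma HasCover.mono {s ε : ℝ} {S S' : Set Torus} (h : HasCover s ε S') (hS : S ⊆ S') :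
    HasCover s ε S := by
  obtain ⟨U, h1, h2⟩ := h
  exact ⟨U, hS.trans h1, h2⟩

/-- At scale `3 ^ (-N)` the set needs at most `3 ^ N * 2 ^ N = 6 ^ N` boxes, whose images have
diameter at most `3 K 3 ^ (-N)`. The sum of `s`-th powers is of order `(6 / 3 ^ s) ^ N`. -/
lemma exists_hasCover_of_lipschitz {W : ℝ × ℝ → Torus} {K : ℝ} (hK : 0 < K)
    (hW : ∀ x ∈ Set.Icc (0 : ℝ) 1 ×ˢ Set.Icc (0 : ℝ) 1, ∀ y ∈ Set.Icc (0 : ℝ) 1 ×ˢ Set.Icc (0 : ℝ) 1,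
      dist (W x) (W y) ≤ K * dist x y) {s ε : ℝ} (hs : 6 < (3 : ℝ) ^ s) (hs0 : 0 ≤ s) (hε : 0 < ε) :
    ∀ᶠ N : ℕ in atTop, HasCover s ε (W '' (Set.Icc (0 : ℝ) 1 ×ˢ
      {y | y ∈ Set.Icc (0 : ℝ) 1 ∧ NearCantor ((1 / 3) ^ N) y})) := by
  classical
  have h3s : (0 : ℝ) < 3 ^ s := by positivity
  have t1 : Tendsto (fun N : ℕ => 3 * K * (1 / 3 : ℝ) ^ N) atTop (𝓝 (3 * K * 0)) :=
    (tendsto_pow_atTop_nhds_zero_of_lt_one (by norm_num) (by norm_num)).const_mul _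
  have t2 : Tendsto (fun N : ℕ => (3 * K) ^ s * (6 / 3 ^ s : ℝ) ^ N) atTop (𝓝 ((3 * K) ^ s * 0)) :=
    (tendsto_pow_atTop_nhds_zero_of_lt_one (by positivity) ((div_lt_one h3s).2 hs)).const_mul _
  rw [mul_zero] at t1 t2
  filter_upwards [(tendsto_order.1 t1).2 ε hε, (tendsto_order.1 t2).2 ε hε] with N h1 h2
  obtain ⟨S, hS, hc⟩ := exists_cantor_cover N
  set l : ℝ := (1 / 3) ^ N with hl
  have hl0 : 0 < l := by positivity
  have hl3 : l * 3 ^ N = 1 := by rw [hl, ← mul_pow]; norm_num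
  set box : ℕ × ℝ → Set (ℝ × ℝ) := fun x =>
    (Set.Icc (x.1 * l) ((x.1 + 1) * l) ×ˢ Set.Icc (x.2 - l) (x.2 + 2 * l)) ∩
      Set.Icc (0 : ℝ) 1 ×ˢ Set.Icc (0 : ℝ) 1 with hbox
  have hdiam : ∀ x, Metric.ediam (W '' box x) ≤ ENNReal.ofReal (3 * K * l) := by
    intro x
    refine Metric.ediam_image_le_iff.2 fun a ha b hb => ?_
    rw [edist_dist]
    refine ENNReal.ofReal_le_ofReal ((hW a ha.2 b hb.2).trans ?_)
    have : dist a b ≤ 3 * l := by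
      obtain ⟨⟨⟨a1, a2⟩, a3, a4⟩, -⟩ := ha
      obtain ⟨⟨⟨b1, b2⟩, b3, b4⟩, -⟩ := hb
      rw [Prod.dist_eq, Real.dist_eq, Real.dist_eq]
      refine max_le (abs_le.2 ⟨?_, ?_⟩) (abs_le.2 ⟨?_, ?_⟩) <;> linarith
    nlinarith
  set U := (Finset.range (3 ^ N) ×ˢ S).image fun x => W '' box x with hU
  have hUd : ∀ u ∈ U, Metric.ediam u ≤ ENNReal.ofReal (3 * K * l) := by
    intro u hu
    obtain ⟨x, -, rfl⟩ := Finset.mem_image.1 hu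
    exact hdiam x
  refine ⟨U, ?_, fun u hu => (hUd u hu).trans (ENNReal.ofReal_le_ofReal h1.le), ?_⟩
  · rintro _ ⟨⟨X, y⟩, ⟨⟨hX0, hX1⟩, ⟨hy0, hy1⟩, hy⟩, rfl⟩
    simp only at hX0 hX1 hy0 hy1
    obtain ⟨c, hcc, hyc⟩ := hy.exists_mem_cantorSet hy0 hy1
    obtain ⟨a, ha, ha1, ha2⟩ := hc c hcc
    rw [abs_lt] at hyc
    obtain ⟨i, hi, hi1, hi2⟩ : ∃ i : ℕ, i < 3 ^ N ∧ (i : ℝ) * l ≤ X ∧ X ≤ (i + 1) * l := by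
      have hXl : 0 ≤ X / l := by positivity
      rcases lt_or_ge ⌊X / l⌋₊ (3 ^ N) with h | h
      · refine ⟨_, h, ?_, ?_⟩
        · rw [← le_div_iff₀ hl0]; exact Nat.floor_le hXl
        · rw [← div_le_iff₀ hl0]; exact (Nat.lt_floor_add_one _).le
      · have h3 : (3 ^ N : ℝ) ≤ X / l := by
          have := Nat.floor_le hXl
          have h' : ((3 ^ N : ℕ) : ℝ) ≤ ⌊X / l⌋₊ := by exact_mod_cast h
          push_cast at h'
          linarith
        rw [le_div_iff₀ hl0, mul_comm, hl3] at h3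
        have hpos : 0 < 3 ^ N := by positivity
        refine ⟨3 ^ N - 1, by omega, ?_, ?_⟩
        · rw [Nat.cast_sub hpos]; push_cast; rw [sub_mul, mul_comm, hl3]; linarith
        · rw [Nat.cast_sub hpos]; push_cast; rw [sub_add_cancel, mul_comm, hl3]; exact hX1
    refine Set.mem_biUnion (x := W '' box (i, a)) (Finset.mem_image_of_mem _
      (Finset.mem_product.2 ⟨Finset.mem_range.2 hi, ha⟩)) ?_
    exact Set.mem_image_of_mem _ ⟨⟨⟨hi1, hi2⟩, by simp only; linarith, by simp only; linarith⟩,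
      ⟨hX0, hX1⟩, ⟨hy0, hy1⟩⟩
  · have hcard : (U.card : ℝ) ≤ 6 ^ N := by
      have h3 : U.card ≤ 3 ^ N * S.card := by
        refine Finset.card_image_le.trans ?_
        rw [Finset.card_product, Finset.card_range]
      have h4 : U.card ≤ 6 ^ N := by
        calc U.card ≤ 3 ^ N * 2 ^ N := h3.trans (Nat.mul_le_mul_left _ hS)
          _ = 6 ^ N := by rw [← mul_pow]; norm_num
      exact_mod_cast h4
    calc ∑ u ∈ U, Metric.ediam u ^ s ≤ ∑ u ∈ U, ENNReal.ofReal (3 * K * l) ^ s :=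
          Finset.sum_le_sum fun u hu => ENNReal.rpow_le_rpow (hUd u hu) hs0
      _ = ENNReal.ofReal (U.card * (3 * K * l) ^ s) := by
          rw [Finset.sum_const, nsmul_eq_mul, ENNReal.ofReal_rpow_of_nonneg (by positivity) hs0,
            ENNReal.ofReal_mul (by positivity), ENNReal.ofReal_natCast]
      _ ≤ ENNReal.ofReal ε := by
          refine ENNReal.ofReal_le_ofReal (le_trans ?_ h2.le)
          have e : (6 : ℝ) ^ N * (3 * K * l) ^ s = (3 * K) ^ s * (6 / 3 ^ s) ^ N := by
            rw [Real.mul_rpow (by positivity) hl0.le, div_pow, hl, one_div, inv_pow,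
              Real.inv_rpow (by positivity), ← Real.rpow_natCast, ← Real.rpow_natCast,
              ← Real.rpow_natCast, ← Real.rpow_mul (by norm_num), ← Real.rpow_mul (by norm_num),
              mul_comm s]
            field_simp
          rw [← e]
          gcongr

lemma IsSmooth.exists_lipschitz {H : Torus → Torus} (hH : IsSmooth H) {s : Set (ℝ × ℝ)}
    (hs : Convex ℝ s) (hsc : IsCompact s) :
    ∃ K > 0, ∀ x ∈ s, ∀ y ∈ s, dist (H (proj x)) (H (proj y)) ≤ K * dist x y := by
  obtain ⟨F, hF, hl⟩ := hH
  obtain ⟨K, hK⟩ := (hF.contDiffOn (s := s)).exists_lipschitzOnWith (by simp) hs hsc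
  refine ⟨K + 1, by positivity, fun x hx y hy => ?_⟩
  rw [← hl, ← hl]
  refine (dist_proj_le _ _).trans ((hK.dist_le_mul x hx y hy).trans ?_)
  exact mul_le_mul_of_nonneg_right (by simp) dist_nonneg

/-- The set of `H (X, Y)` with `R (Y - c)` close to `q X` for a point `c` near the Cantor set has
efficient covers. -/
lemma exists_hasCover_shear {H : Torus → Torus} (hH : IsSmooth H) {R R' : ℝ → ℝ} {δ : ℝ}
    (hR : ContDiff ℝ ∞ R) (hRd : ∀ y, HasDerivAt R (R' y) y) (hδ : 0 < δ) (hRδ : ∀ y, δ ≤ R' y)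
    (hR1 : ∀ y, R (y + 1) = R y + 1) (q : ℕ) {s ε : ℝ} (hs : 6 < (3 : ℝ) ^ s) (hs0 : 0 ≤ s)
    (hε : 0 < ε) :
    ∀ᶠ N : ℕ in atTop, HasCover s ε {z | ∃ c X Y, z = H (proj (X, Y)) ∧
      NearCantor ((1 / 3) ^ N / 2) c ∧ |q * X - R (Y - c)| ≤ δ * ((1 / 3) ^ N / 2)} := by
  have hR' : Continuous R' := (contDiff_of_hasDerivAt hR hRd).continuous
  obtain ⟨Φ₀, hΦ₀, hΦ1, -⟩ := exists_fibre_inverse (G := fun z => R z.2) (J := fun z => R' z.2)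
    (hR.comp contDiff_snd) (fun _ y => hRd y) (fun z => hδ.trans_le (hRδ _)) (fun _ y => hR1 y)
  set Φ : ℝ → ℝ := fun t => Φ₀ (0, t) with hΦ
  have hRΦ : ∀ t, R (Φ t) = t := hΦ1 0
  have hexp : ∀ x y, δ * |x - y| ≤ |R x - R y| := by
    have hd : ∀ y, HasDerivAt (fun y => R y - δ * y) (R' y - δ) y := fun y => by
      simpa using (hRd y).fun_sub ((hasDerivAt_id y).const_mul δ)
    have hm : Monotone fun y => R y - δ * y :=
      monotone_of_deriv_nonneg (fun y => (hd y).differentiableAt) fun y => by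
        rw [(hd y).deriv]; linarith [hRδ y]
    intro x y
    rcases le_total x y with h | h
    · have := hm h
      simp only at this
      rw [abs_of_nonpos (by linarith), abs_of_nonpos (by nlinarith)]; linarith
    · have := hm h
      simp only at this
      rw [abs_of_nonneg (by linarith), abs_of_nonneg (by nlinarith)]; linarith
  have hΦL : ∀ s t, |Φ s - Φ t| ≤ δ⁻¹ * |s - t| := fun s t => by
    have := hexp (Φ s) (Φ t)
    rw [hRΦ, hRΦ] at this
    rw [inv_mul_eq_div, le_div_iff₀ hδ]; linarith
  have hΦc : Continuous Φ := hΦ₀.continuous.comp (by fun_prop)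
  have hRk : ∀ (k : ℤ) y, R (y + k) = R y + k := fun k y => by
    have : Function.Periodic (fun y => R y - y) 1 := fun y => by simp only [hR1]; ring
    have := this.int_mul k y
    simp only [mul_one] at this
    linarith
  have hΦk : ∀ (k : ℤ) t, Φ (t + k) = Φ t + k := fun k t => by
    have h1 := hexp (Φ (t + k)) (Φ t + k)
    rw [hRΦ, hRk, hRΦ, sub_self, abs_zero] at h1
    have : |Φ (t + k) - (Φ t + k)| ≤ 0 := by nlinarith [abs_nonneg (Φ (t + k) - (Φ t + k))]
    exact sub_eq_zero.1 (abs_nonpos_iff.1 this)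
  -- With `Φ` the inverse of `R`, this shear straightens the set: `Y - Φ(q X)` is close to `c`,
  -- since `R` expands by at least `δ`. Its Lipschitz constant depends only on `δ` and `q`, not on
  -- `N`.
  set w : ℝ × ℝ → ℝ × ℝ := fun z => (z.1, z.2 + Φ (q * z.1)) with hw
  have hwc : Continuous w := by fun_prop
  set I2 := Set.Icc (0 : ℝ) 1 ×ˢ Set.Icc (0 : ℝ) 1 with hI2
  have hI2c : IsCompact I2 := isCompact_Icc.prod isCompact_Icc
  obtain ⟨r, hr⟩ := (hI2c.image hwc).isBounded.subset_closedBall 0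
  obtain ⟨K, hK0, hK⟩ := hH.exists_lipschitz (convex_closedBall (0 : ℝ × ℝ) r)
    (isCompact_closedBall _ _)
  have hwL : ∀ x y, dist (w x) (w y) ≤ (1 + δ⁻¹ * q) * dist x y := by
    intro x y
    have hx1 : |x.1 - y.1| ≤ dist x y := by rw [Prod.dist_eq, Real.dist_eq]; exact le_max_left _ _
    have hx2 : |x.2 - y.2| ≤ dist x y := by
      rw [Prod.dist_eq, Real.dist_eq, Real.dist_eq]; exact le_max_right _ _
    have hq0 : (0 : ℝ) ≤ δ⁻¹ * q := by positivity
    rw [Prod.dist_eq (x := w x), Real.dist_eq, Real.dist_eq]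
    refine max_le ?_ ?_
    · simp only [hw]; nlinarith [dist_nonneg (x := x) (y := y)]
    · simp only [hw]
      have h1 := hΦL (q * x.1) (q * y.1)
      rw [← mul_sub, abs_mul, Nat.abs_cast] at h1
      have h2 : δ⁻¹ * (q * |x.1 - y.1|) ≤ δ⁻¹ * q * dist x y := by
        rw [← mul_assoc]; exact mul_le_mul_of_nonneg_left hx1 hq0
      rw [add_sub_add_comm]
      linarith [abs_add_le (x.2 - y.2) (Φ (q * x.1) - Φ (q * y.1))]
  have hWL : ∀ x ∈ I2, ∀ y ∈ I2, dist (H (proj (w x))) (H (proj (w y))) ≤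
      K * (1 + δ⁻¹ * q) * dist x y := by
    intro x hx y hy
    refine (hK _ (hr ⟨x, hx, rfl⟩) _ (hr ⟨y, hy, rfl⟩)).trans ?_
    rw [mul_assoc]
    exact mul_le_mul_of_nonneg_left (hwL x y) hK0.le
  filter_upwards [exists_hasCover_of_lipschitz (W := fun x => H (proj (w x)))
    (by positivity) hWL hs hs0 hε] with N hN
  refine hN.mono ?_
  rintro _ ⟨c, X, Y, rfl, ⟨c₀, hc₀, hcc⟩, hX⟩
  have h1 : |Y - c - Φ (q * X)| ≤ (1 / 3) ^ N / 2 := by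
    have h2 := hexp (Y - c) (Φ (q * X))
    rw [hRΦ, abs_sub_comm (R (Y - c))] at h2
    have := h2.trans hX
    exact le_of_mul_le_mul_left this hδ
  have hnear : NearCantor ((1 / 3) ^ N) (Y - Φ (q * X)) := by
    refine ⟨c₀, hc₀, ?_⟩
    rw [show Y - Φ (q * X) - c₀ = (Y - c - Φ (q * X)) + (c - c₀) by ring]
    linarith [abs_add_le (Y - c - Φ (q * X)) (c - c₀)]
  have hX0 : Φ (q * Int.fract X) = Φ (q * X) - q * (⌊X⌋ : ℝ) := by
    have := hΦk (q * ⌊X⌋) (q * Int.fract X)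
    push_cast at this
    rw [← mul_add, Int.fract_add_floor] at this
    rw [this]; ring
  refine ⟨(Int.fract X, Int.fract (Y - Φ (q * Int.fract X))),
    ⟨⟨Int.fract_nonneg _, (Int.fract_lt_one _).le⟩, ⟨Int.fract_nonneg _, (Int.fract_lt_one _).le⟩, ?_⟩, ?_⟩
  · simp only
    rw [nearCantor_fract, hX0, show Y - (Φ (q * X) - q * (⌊X⌋ : ℝ)) =
      Y - Φ (q * X) + ((q * ⌊X⌋ : ℤ) : ℝ) by push_cast; ring, nearCantor_add_int]
    exact hnear
  · simp only [hw]
    congr 1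
    refine proj_eq_iff.2 ⟨-⌊X⌋, -⌊Y - Φ (q * Int.fract X)⌋, ?_, ?_⟩
    · push_cast; simp only [Int.fract]; ring
    · push_cast; simp only [Int.fract]; ring

/-! ### The dimension of the Cantor set -/

/-- The differing digits contribute `2 * 3 ^ (-(n+1))`, and the later digits can take back at most
half of that. -/
lemma one_div_three_pow_le_abs_ofDigits {a b : ℕ → Fin 3} {n : ℕ} (h : ∀ i < n, a i = b i)
    (ha : a n = 2) (hb : b n = 0) : (1 / 3 : ℝ) ^ (n + 1) ≤ |Real.ofDigits a - Real.ofDigits b| := by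
  rw [Real.ofDigits_eq_sum_add_ofDigits a (n + 1), Real.ofDigits_eq_sum_add_ofDigits b (n + 1),
    Finset.sum_range_succ, Finset.sum_range_succ]
  have : ∑ i ∈ Finset.range n, Real.ofDigitsTerm a i = ∑ i ∈ Finset.range n, Real.ofDigitsTerm b i :=
    Finset.sum_congr rfl fun i hi => by simp [Real.ofDigitsTerm, h i (Finset.mem_range.mp hi)]
  rw [this]
  have h1 := Real.ofDigits_nonneg fun i => a (i + (n + 1))
  have h2 := Real.ofDigits_le_one fun i => b (i + (n + 1))
  refine le_trans ?_ (le_abs_self _)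
  generalize (∑ i ∈ Finset.range n, Real.ofDigitsTerm b i) = S
  generalize Real.ofDigits (fun i => a (i + (n + 1))) = A at *
  generalize Real.ofDigits (fun i => b (i + (n + 1))) = B at *
  have hp : (0 : ℝ) < (1 / 3) ^ (n + 1) := by positivity
  have e : (((3 : ℕ) : ℝ) ^ (n + 1))⁻¹ = (1 / 3) ^ (n + 1) := by rw [one_div, inv_pow]; norm_num
  simp only [Real.ofDigitsTerm, ha, hb, e]
  generalize (1 / 3 : ℝ) ^ (n + 1) = p at *
  have h3 := mul_nonneg hp.le h1
  have h4 := mul_nonneg hp.le (sub_nonneg.2 h2)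
  norm_num
  nlinarith

/-- The point of the Cantor set with ternary digits `2` and `0`, as prescribed by `b`. -/
noncomputable def cantorPoint (b : ℕ → Bool) : ℝ :=
  Real.ofDigits (fun i => cond (b i) (2 : Fin 3) 0)

/-- The number with binary digits prescribed by `b`. -/
noncomputable def binaryValue (b : ℕ → Bool) : ℝ :=
  Real.ofDigits (fun i => cond (b i) (1 : Fin 2) 0)

lemma cantorPoint_mem (b : ℕ → Bool) : cantorPoint b ∈ cantorSet :=
  ofDigits_bool_to_fin_three_mem_cantorSet b

/-- This is the Hölder continuity of the Cantor function. If the sequences first differ at `n`, the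
binary values differ by at most `2 ^ (-n)` and the ternary points by at least `3 ^ (-(n+1))`; the
exponent turns `3` into `2`. -/
lemma abs_binaryValue_sub_le (b b' : ℕ → Bool) :
    |binaryValue b - binaryValue b'| ≤ 2 * |cantorPoint b - cantorPoint b'| ^ Real.logb 3 2 := by
  classical
  have hlog : 0 < Real.logb 3 2 := Real.logb_pos (by norm_num) (by norm_num)
  by_cases hbb : b = b'
  · simp [hbb, hlog.ne']
  · obtain ⟨n, hn, hmin⟩ : ∃ n, b n ≠ b' n ∧ ∀ i < n, b i = b' i := by
      have hex : ∃ n, b n ≠ b' n := Function.ne_iff.1 hbb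
      exact ⟨Nat.find hex, Nat.find_spec hex, fun i hi => not_not.1 (Nat.find_min hex hi)⟩
    have h1 : |binaryValue b - binaryValue b'| ≤ ((2 : ℕ) ^ n : ℝ)⁻¹ :=
      Real.abs_ofDigits_sub_ofDigits_le fun i hi => by rw [hmin i hi]
    have h2 : (1 / 3 : ℝ) ^ (n + 1) ≤ |cantorPoint b - cantorPoint b'| := by
      cases hb : b n <;> cases hb' : b' n
      · exact absurd (hb.trans hb'.symm) hn
      · rw [abs_sub_comm]
        exact one_div_three_pow_le_abs_ofDigits (fun i hi => by rw [hmin i hi]) (by simp [hb'])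
          (by simp [hb])
      · exact one_div_three_pow_le_abs_ofDigits (fun i hi => by rw [hmin i hi]) (by simp [hb])
          (by simp [hb'])
      · exact absurd (hb.trans hb'.symm) hn
    have h3 : ((1 / 3 : ℝ) ^ (n + 1)) ^ Real.logb 3 2 = (1 / 2) ^ (n + 1) := by
      rw [← Real.rpow_natCast, ← Real.rpow_mul (by norm_num), mul_comm, Real.rpow_mul (by norm_num),
        one_div, Real.inv_rpow (by norm_num), Real.rpow_logb (by norm_num) (by norm_num)
        (by norm_num), Real.rpow_natCast, one_div]
    have h4 := Real.rpow_le_rpow (by positivity) h2 hlog.le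
    rw [h3] at h4
    refine h1.trans ?_
    rw [pow_succ] at h4
    push_cast
    rw [← inv_pow]
    norm_num at h4 ⊢
    linarith

/-- The Cantor function maps a part of the set onto `[0,1]`, and a Hölder map with exponent `s`
multiplies dimension by at most `1/s`. -/
lemma logb_le_dimH_cantor :
    ENNReal.ofReal (Real.logb 3 2) ≤ dimH ({(0 : UnitAddCircle)} ×ˢ cantorCircle) := by
  set s := Real.logb 3 2 with hs
  have hlog : 0 < s := Real.logb_pos (by norm_num) (by norm_num)
  -- Division by `3` keeps the points within half a turn of each other, so the circle distance is
  -- the distance in `ℝ`.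
  set ψ : (ℕ → Bool) → Torus := fun b => proj (0, cantorPoint b / 3) with hψ
  have hsub : Set.range ψ ⊆ {(0 : UnitAddCircle)} ×ˢ cantorCircle := by
    rintro _ ⟨b, rfl⟩
    exact ⟨by simp [hψ, proj], _, div_three_mem_cantorSet (cantorPoint_mem b), rfl⟩
  have hdist : ∀ b b', dist (ψ b) (ψ b') = |cantorPoint b - cantorPoint b'| / 3 := by
    intro b b'
    have h0 := cantorSet_subset_unitInterval (cantorPoint_mem b)
    have h1 := cantorSet_subset_unitInterval (cantorPoint_mem b')
    rw [Prod.dist_eq]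
    simp only [hψ, proj, dist_self]
    rw [max_eq_right dist_nonneg, dist_eq_norm, ← AddCircle.coe_sub,
      (AddCircle.norm_coe_eq_abs_iff 1 one_ne_zero).2]
    · rw [← sub_div, abs_div, abs_of_pos (by norm_num : (0 : ℝ) < 3)]
    · rw [← sub_div, abs_div, abs_of_pos (by norm_num : (0 : ℝ) < 3), abs_one]
      have : |cantorPoint b - cantorPoint b'| ≤ 1 := by
        rw [abs_le]; constructor <;> linarith [h0.1, h0.2, h1.1, h1.2]
      linarith
  have hmain : ∀ b b', |binaryValue b - binaryValue b'| ≤ 2 * 3 ^ s * dist (ψ b) (ψ b') ^ s := by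
    intro b b'
    rw [hdist, mul_assoc, ← Real.mul_rpow (by norm_num) (by positivity),
      mul_div_cancel₀ _ (by norm_num)]
    exact abs_binaryValue_sub_le b b'
  -- The choice of preimage is harmless: by `hmain`, sequences with the same image have the same
  -- binary value.
  set g : Torus → ℝ := fun z => binaryValue (Function.invFun ψ z) with hg
  have hgψ : ∀ b, g (ψ b) = binaryValue b := by
    intro b
    have h1 := Function.invFun_eq (f := ψ) ⟨b, rfl⟩
    have h2 := hmain (Function.invFun ψ (ψ b)) b
    rw [h1, dist_self, Real.zero_rpow hlog.ne', mul_zero] at h2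
    exact sub_eq_zero.1 (abs_nonpos_iff.1 h2)
  have hC : (0 : ℝ) ≤ 2 * 3 ^ s := by positivity
  have hhold : HolderOnWith (2 * 3 ^ s : ℝ).toNNReal s.toNNReal g (Set.range ψ) := by
    rintro _ ⟨b, rfl⟩ _ ⟨b', rfl⟩
    rw [hgψ, hgψ, edist_dist, edist_dist, Real.dist_eq, Real.coe_toNNReal _ hlog.le,
      ENNReal.ofReal_rpow_of_nonneg dist_nonneg hlog.le]
    change _ ≤ ENNReal.ofReal _ * _
    rw [← ENNReal.ofReal_mul hC]
    exact ENNReal.ofReal_le_ofReal (hmain b b')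
  have hdim := hhold.dimH_image_le (Real.toNNReal_pos.2 hlog)
  have himg : Set.Icc (0 : ℝ) 1 ⊆ g '' Set.range ψ := by
    intro t ht
    obtain ⟨a, -, rfl⟩ := Real.ofDigits_SurjOn (b := 2) (by norm_num) ht
    refine ⟨_, ⟨fun i => decide (a i = 1), rfl⟩, ?_⟩
    rw [hgψ, binaryValue]
    congr 1
    funext i
    rcases (by omega : a i = 0 ∨ a i = 1) with h | h <;> simp [h]
  have h1 : (1 : ENNReal) ≤ dimH (g '' Set.range ψ) := by
    have h2 : dimH (Set.Icc (0 : ℝ) 1) = 1 := by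
      rw [Real.dimH_of_nonempty_interior (by rw [interior_Icc]; exact ⟨1 / 2, by norm_num⟩)]
      simp
    rw [← h2]
    exact dimH_mono himg
  change _ ≤ _ / ENNReal.ofReal s at hdim
  have h4 := h1.trans hdim
  rw [ENNReal.le_div_iff_mul_le (Or.inl (by simpa using hlog)) (Or.inl ENNReal.ofReal_ne_top),
    one_mul] at h4
  exact h4.trans (dimH_mono hsub)

end AbC

namespace AbC

/-! ### The inductive construction -/

/-- The accuracy of the `n`-th step. -/
noncomputable def tol (n : ℕ) : ℝ := (1 / 4) ^ (n + 4)

/-- The weight of the horizontal rotation in the `n`-th step. -/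
noncomputable def weight (n : ℕ) : ℝ := 1 / (n + 2)

/-- The allowed distance between the fibre averages of `n`-th step and the original ones. -/
noncomputable def drift (n : ℕ) : ℝ := 1 / 2 - (1 / 2) ^ n / 2

/-- The exponent of the covers in the `n`-th step. -/
noncomputable def coverExponent (n : ℕ) : ℝ := 1 + Real.logb 3 2 + 1 / (n + 1)

lemma tol_pos (n : ℕ) : 0 < tol n := by unfold tol; positivity

lemma tol_le (n : ℕ) : tol n ≤ (1 / 2) ^ n / 256 := by
  unfold tol
  have h : (1 / 4 : ℝ) ^ n ≤ (1 / 2) ^ n := pow_le_pow_left₀ (by norm_num) (by norm_num) n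
  rw [pow_add]
  norm_num at h ⊢
  linarith

lemma tol_le_half (n : ℕ) : tol n ≤ 1 / 256 := by
  have h : (1 / 2 : ℝ) ^ n ≤ 1 := pow_le_one₀ (by norm_num) (by norm_num)
  linarith [tol_le n]

lemma weight_pos (n : ℕ) : 0 < weight n := by unfold weight; positivity

lemma weight_le_one (n : ℕ) : weight n ≤ 1 := by
  unfold weight
  rw [div_le_one (by positivity)]
  have : (0 : ℝ) ≤ n := n.cast_nonneg
  linarith

/-- One step costs `6 tol n` in the bulk: one `tol n` from the branch averages and five from the
integral estimate. -/
lemma drift_add_le (n : ℕ) : drift n + 6 * tol n ≤ drift (n + 1) := by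
  have := tol_le n
  have h : (0 : ℝ) < (1 / 2) ^ n := by positivity
  unfold drift
  rw [pow_succ]
  linarith

lemma drift_nonneg (n : ℕ) : 0 ≤ drift n := by
  have h : (1 / 2 : ℝ) ^ n ≤ 1 := pow_le_one₀ (by norm_num) (by norm_num)
  unfold drift
  linarith

lemma coverExponent_nonneg (n : ℕ) : 0 ≤ coverExponent n := by
  have : 0 < Real.logb 3 2 := Real.logb_pos (by norm_num) (by norm_num)
  unfold coverExponent
  positivity

lemma six_lt_rpow_coverExponent (n : ℕ) : 6 < (3 : ℝ) ^ coverExponent n := by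
  have h : (3 : ℝ) ^ (1 + Real.logb 3 2) = 6 := by
    rw [Real.rpow_add (by norm_num), Real.rpow_one,
      Real.rpow_logb (by norm_num) (by norm_num) (by norm_num)]
    norm_num
  rw [← h]
  refine Real.rpow_lt_rpow_of_exponent_lt (by norm_num) ?_
  unfold coverExponent
  have : (0 : ℝ) < 1 / (n + 1) := by positivity
  linarith

/-- `R` is a degree one diffeomorphism of the circle, with derivative `R'`, which moves most points
slowly. -/
structure IsFastRotation (δ r M : ℝ) (R R' : ℝ → ℝ) : Prop where
  contDiff : ContDiff ℝ ∞ R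
  hasDerivAt : ∀ y, HasDerivAt R (R' y) y
  add_one : ∀ y, R (y + 1) = R y + 1
  map_zero : R 0 = 0
  deriv_zero : R' 0 = 1
  le_deriv : ∀ y, δ ≤ R' y
  deriv_eq : ∀ y : ℝ, (∀ k : ℤ, r ≤ |y - k|) → R' y = δ
  deriv_le : ∀ y, R' y ≤ M

lemma exists_isFastRotation {δ r : ℝ} (hδ : 0 < δ) (hδ1 : δ < 1) (hr : 0 < r) :
    ∃ M R R', 0 ≤ M ∧ IsFastRotation δ r M R R' := by
  obtain ⟨R, R', h1, h2, h3, h4, h5, h6, h7⟩ := exists_fast_rotation hδ hδ1 hr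
  obtain ⟨M, hM0, hM⟩ := exists_abs_le_of_periodic (contDiff_of_hasDerivAt h1 h2).continuous
    (derivative_add_one h2 h3)
  exact ⟨M, R, R', hM0, h1, h2, h3, h4, h5, h6, h7, fun y => (le_abs_self _).trans (hM y)⟩

/-- The data of a step of the construction: a conjugacy, a rotation number `p / q`, and the radius
of a neighbourhood of the Cantor set. -/
structure Stage where
  conjugacy : Equiv.Perm Torus
  p : ℤ
  q : ℕ
  radius : ℝ

/-- The diffeomorphism of a step of the construction. -/
noncomputable def Stage.map (s : Stage) : Equiv.Perm Torus :=
  s.conjugacy * shift (s.p / s.q) * s.conjugacy⁻¹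

/-- The image of a neighbourhood of the Cantor circles. -/
def Stage.tube (s : Stage) : Set Torus :=
  {z | ∃ θ c, NearCantor s.radius c ∧ z = s.conjugacy (proj (θ, c))}

/-- The requirements on a step of the construction. -/
structure IsAdmissible (f : ℕ → C(Torus, ℝ)) (M : ℕ → ℝ) (n : ℕ) (s : Stage) : Prop where
  q_pos : 0 < s.q
  coprime : IsCoprime s.p (s.q : ℤ)
  diffeo : IsAreaPreservingDiffeo s.conjugacy
  fixes : ∀ c ∈ cantorLift, s.conjugacy (proj (0, c)) = proj (0, c)
  branch_close : ∀ j ≤ n + 1, ∀ x y,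
    |branch s.conjugacy (f j) s.q x y - avg s.conjugacy (f j) y| ≤ tol n
  bulk : ∀ y, ¬ NearCantor s.radius y →
    |avg s.conjugacy (f 0) y - Real.cos (2 * Real.pi * y)| ≤ drift n ∧
    |avg s.conjugacy (f 1) y - Real.sin (2 * Real.pi * y)| ≤ drift n
  volume_le : volume ({y | NearCantor s.radius y} ∩ Set.Icc 0 1) ≤
    ENNReal.ofReal (tol n / (2 * (M n + 1)))

/-- The relations between successive steps of the construction. -/
structure IsSuccessor (f : ℕ → C(Torus, ℝ)) (n : ℕ) (s s' : Stage) : Prop where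
  conjugacy_eq : ∃ h, IsAreaPreservingDiffeo h ∧ Commute h (shift (s.p / s.q)) ∧
    s'.conjugacy = s.conjugacy * h
  rotation_eq : ∃ L : ℕ, 1 < L ∧ s'.p = L * s.q * s.p + 1 ∧ s'.q = L * s.q ^ 2
  close_lift : ∀ G₀ : ℝ × ℝ → ℝ × ℝ, ContDiff ℝ ∞ G₀ → IsLift G₀ s.map →
    ∃ G, ContDiff ℝ ∞ G ∧ IsLift G s'.map ∧
      ∀ k ≤ n, ∀ z, ‖iteratedFDeriv ℝ k G z - iteratedFDeriv ℝ k G₀ z‖ ≤ (1 / 2) ^ n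
  close_lift_symm : ∀ G₀ : ℝ × ℝ → ℝ × ℝ, ContDiff ℝ ∞ G₀ → IsLift G₀ s.map.symm →
    ∃ G, ContDiff ℝ ∞ G ∧ IsLift G s'.map.symm ∧
      ∀ k ≤ n, ∀ z, ‖iteratedFDeriv ℝ k G z - iteratedFDeriv ℝ k G₀ z‖ ≤ (1 / 2) ^ n
  close_iterates : ∀ i ≤ (n + 1) * s.q, ∀ x, dist ((s'.map ^ i) x) ((s.map ^ i) x) ≤ (1 / 2) ^ n
  contraction : ∀ j ≤ n + 1, ∀ D : ℝ,
    (∀ y ∈ cantorLift, |avg s.conjugacy (f j) y - ∫ z, f j z| ≤ D) →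
    ∀ y ∈ cantorLift, |avg s'.conjugacy (f j) y - ∫ z, f j z| ≤ (1 - weight n) * D + 3 * tol n
  birkhoff : ∀ j ≤ n + 1, ∀ D : ℝ,
    (∀ y ∈ cantorLift, |avg s.conjugacy (f j) y - ∫ z, f j z| ≤ D) →
    ∀ c ∈ cantorLift, ∀ y ∈ cantorLift, ∀ θ θ' : ℝ,
      s'.conjugacy (proj (θ, c)) = s.conjugacy (proj (θ', y)) → ∀ N, (n + 1) * s.q ≤ N →
      |birkhoffAverage ℝ s'.map (f j) N (s'.conjugacy (proj (θ, c))) - ∫ z, f j z| ≤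
        3 * D + 8 * tol n + 4 * ‖f j‖ * weight n + 2 * ‖f j‖ / (n + 1)
  cover : HasCover (coverExponent n) ((1 / 2) ^ n) s'.tube

/-- The conjugacy of a step of the construction, together with the functions that define it. -/
structure IsBlock (f : ℕ → C(Torus, ℝ)) (R R' : ℝ → ℝ) (n : ℕ) (s : Stage) (ρ σ : ℝ)
    (h : Equiv.Perm Torus) (P Q J : ℝ × ℝ → ℝ) (E E' F' : ℝ → ℝ) : Prop where
  pair : IsGeneratingPair P Q J
  generated : IsGenerated h s.q P Q
  diffeo : IsAreaPreservingDiffeo h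
  commute : ∀ p : ℤ, Commute h (shift (p / s.q))
  hasDerivAt : ∀ y, HasDerivAt E (E' y) y
  continuous_deriv : Continuous E'
  add_one : ∀ y, E (y + 1) = E y + 1
  deriv_nonneg : ∀ y, 0 ≤ E' y
  le_self : ∀ y, y ≤ E y
  eq_self : ∀ y ∈ cantorLift, E y = y
  mix : ∀ y, F' y = weight n + (1 - weight n) * E' y
  near : ∀ y, E' y ≠ 0 → ∃ c ∈ cantorLift, ∀ j ≤ n + 1,
    |avg s.conjugacy (f j) y - avg s.conjugacy (f j) c| ≤ tol n
  diagonal : ∀ c ∈ cantorLift, P (c, c) = 0 ∧ Q (c, c) = 0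
  density_cantor : ∀ c ∈ cantorLift, ∀ Y, |J (c, Y) - F' Y| ≤ σ
  density_bulk : ∀ c, ¬ NearCantor ρ c → ∀ Y, |J (c, Y) - R' (Y - c)| ≤ σ
  sigma_le : σ ≤ tol n
  sigma_norm_le : ∀ j ≤ n + 1, 2 * ‖f j‖ * σ ≤ tol n
  cover : HasCover (coverExponent n) ((1 / 2) ^ n)
    {z | ∃ θ c, NearCantor ρ c ∧ z = (s.conjugacy * h) (proj (θ, c))}

lemma exists_common_modulus {H : Torus → Torus} (hH : Continuous H) (f : ℕ → C(Torus, ℝ)) (n : ℕ)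
    {ε : ℝ} (hε : 0 < ε) : ∃ η > 0, ∀ j ≤ n, ∀ x y : ℝ × ℝ, dist x y < η →
      |f j (H (proj x)) - f j (H (proj y))| ≤ ε := by
  induction n with
  | zero =>
    obtain ⟨η, hη, h⟩ := exists_modulus hH (f 0) hε
    exact ⟨η, hη, fun j hj => by obtain rfl := Nat.le_zero.1 hj; exact h⟩
  | succ n ih =>
    obtain ⟨η, hη, h⟩ := exists_modulus hH (f (n + 1)) hε
    obtain ⟨η', hη', h'⟩ := ih
    refine ⟨min η η', lt_min hη hη', fun j hj x y hxy => ?_⟩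
    rcases Nat.le_succ_iff.1 hj with hj | rfl
    · exact h' j hj x y (hxy.trans_le (min_le_right _ _))
    · exact h x y (hxy.trans_le (min_le_left _ _))

lemma exists_common_bound (f : ℕ → C(Torus, ℝ)) (n : ℕ) : ∃ B, 0 ≤ B ∧ ∀ j ≤ n, ‖f j‖ ≤ B :=
  ⟨∑ j ∈ Finset.range (n + 1), ‖f j‖, by positivity, fun j hj =>
    Finset.single_le_sum (f := fun j => ‖f j‖) (fun _ _ => norm_nonneg _)
      (Finset.mem_range.2 (Nat.lt_succ_of_le hj))⟩

/-- The order of choices matters. The modulus of the old averages gives the width for `E`; the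
cover, whose shear depends only on `R`, the old conjugacy and `q`, gives the scale `N` and the
radius `ρ`; only then is the precision `σ` fixed, fine enough relative to `ρ` for the tube to lie in
the covered set. -/
lemma exists_isBlock {f : ℕ → C(Torus, ℝ)} {R R' : ℝ → ℝ} {M : ℕ → ℝ} {n : ℕ} {s : Stage}
    (hs : IsAdmissible f M n s) (hR : IsFastRotation (tol n) (tol n / 8) (M n) R R') {ρ₀ : ℝ}
    (hρ₀ : 0 < ρ₀) :
    ∃ ρ σ h P Q J E E' F', ρ ≤ ρ₀ ∧ IsBlock f R R' n s ρ σ h P Q J E E' F' := by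
  have hHc := hs.diffeo.smooth.continuous
  have htol := tol_pos n
  obtain ⟨w, hw, hmod⟩ := exists_common_modulus hHc f (n + 1) htol
  obtain ⟨E, E', hE, hEd, hE1, hE0, hEy, hEC, hEw⟩ := exists_monotone_tangent hw
  have hw0 := weight_pos n
  have hw1 := weight_le_one n
  obtain ⟨N, hcov, hNρ⟩ := ((exists_hasCover_shear hs.diffeo.smooth hR.contDiff hR.hasDerivAt htol
    hR.le_deriv hR.add_one s.q (six_lt_rpow_coverExponent n) (coverExponent_nonneg n)
    (by positivity : (0 : ℝ) < (1 / 2) ^ n)).and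
    ((tendsto_order.1 (tendsto_pow_atTop_nhds_zero_of_lt_one (by norm_num : (0 : ℝ) ≤ 1 / 3)
      (by norm_num))).2 ρ₀ hρ₀)).exists
  set ρ : ℝ := (1 / 3) ^ N / 2 with hρ
  have hρ0 : 0 < ρ := by positivity
  obtain ⟨B, hB0, hB⟩ := exists_common_bound f (n + 1)
  -- The first bound absorbs the norms of the test functions; the second is the tolerance `δ ρ`,
  -- with `δ = tol n`, required by `exists_hasCover_shear`.
  set σ := min (tol n / (2 * B + 1)) (tol n * ρ) with hσ
  have hσ0 : 0 < σ := by positivity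
  have hσ1 : σ ≤ tol n / (2 * B + 1) := min_le_left _ _
  rw [le_div_iff₀ (by positivity)] at hσ1
  have hFd : ∀ y, HasDerivAt (fun y => weight n * y + (1 - weight n) * E y)
      (weight n + (1 - weight n) * E' y) y := fun y => by
    have h1 := ((hasDerivAt_id y).const_mul (weight n)).fun_add ((hEd y).const_mul (1 - weight n))
    simpa using h1
  obtain ⟨P, Q, J, hG, hdiag, hJF, hJR, hQR⟩ := exists_generatingPair
    (F := fun y => weight n * y + (1 - weight n) * E y)
    (F' := fun y => weight n + (1 - weight n) * E' y) (by fun_prop)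
    hFd
    (fun y => by rw [hE1]; ring) hw0
    (fun y => by nlinarith [hE0 y]) (fun y hy => by rw [(hEC y hy).2]; ring) hR.contDiff
    hR.hasDerivAt hR.add_one htol hR.le_deriv hR.map_zero hR.deriv_zero hρ0 hσ0
  obtain ⟨h, hh, hcomm, hgen⟩ := hG.exists_diffeo hs.q_pos
  have hq : (0 : ℝ) < s.q := by exact_mod_cast hs.q_pos
  refine ⟨ρ, σ, h, P, Q, J, E, E', _, ?_, hG, hgen, hh, hcomm, hEd,
    (contDiff_of_hasDerivAt hE hEd).continuous, hE1, hE0, hEy, fun y hy => (hEC y hy).1,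
    fun y => rfl, ?_, hdiag, hJF, hJR, ?_, ?_, ?_⟩
  · have : (0 : ℝ) < (1 / 3) ^ N := by positivity
    linarith
  · intro y hy
    obtain ⟨c, hc, hyc⟩ := hEw y hy
    exact ⟨c, hc, fun j hj => abs_avg_sub_avg_le hHc (hmod j hj) hyc⟩
  · nlinarith
  · intro j hj
    nlinarith [hB j hj]
  · refine hcov.mono ?_
    rintro _ ⟨θ, c, hc, rfl⟩
    obtain ⟨Y, hY⟩ := hG.surjective_left c (s.q * θ)
    refine ⟨c, Q (c, Y) / s.q, Y, ?_, hc, ?_⟩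
    · have := hgen c Y 0
      rw [hY, Int.cast_zero, add_zero, add_zero, mul_div_cancel_left₀ _ hq.ne'] at this
      rw [Equiv.Perm.mul_apply, this]
    · rw [mul_div_cancel₀ _ hq.ne']
      exact (hQR c Y).trans (min_le_right _ _)

/-! ### Consequences of the block estimates for circle averages and orbits -/

section Block

variable {f : ℕ → C(Torus, ℝ)} {R R' : ℝ → ℝ} {M : ℕ → ℝ} {n : ℕ} {s : Stage} {ρ σ : ℝ}
  {h : Equiv.Perm Torus} {P Q J : ℝ × ℝ → ℝ} {E E' F' : ℝ → ℝ}

lemma IsBlock.abs_avg_sub_integral_le_of_deriv_ne_zero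
    (hb : IsBlock f R R' n s ρ σ h P Q J E E' F') {j : ℕ} (hj : j ≤ n + 1) {D : ℝ}
    (hD : ∀ y ∈ cantorLift, |avg s.conjugacy (f j) y - ∫ z, f j z| ≤ D) {y : ℝ} (hy : E' y ≠ 0) :
    |avg s.conjugacy (f j) y - ∫ z, f j z| ≤ D + tol n := by
  obtain ⟨c, hc, h1⟩ := hb.near y hy
  have h2 := h1 j hj
  have h3 := hD c hc
  rw [abs_le] at *
  constructor <;> linarith

lemma IsBlock.fixes (hb : IsBlock f R R' n s ρ σ h P Q J E E' F') {c : ℝ} (hc : c ∈ cantorLift) :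
    h (proj (0, c)) = proj (0, c) := by
  have := hb.generated c c 0
  rw [(hb.diagonal c hc).1, (hb.diagonal c hc).2] at this
  simpa using this

/-- The contraction on the Cantor circles: the three `tol n` come from the branch averages, the
oscillation of the averages near the Cantor set, and the precision `σ`. -/
lemma IsBlock.abs_avg_sub_integral_le (hs : IsAdmissible f M n s)
    (hb : IsBlock f R R' n s ρ σ h P Q J E E' F') {j : ℕ} (hj : j ≤ n + 1) {D : ℝ}
    (hD : ∀ y ∈ cantorLift, |avg s.conjugacy (f j) y - ∫ z, f j z| ≤ D) {c : ℝ}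
    (hc : c ∈ cantorLift) :
    |avg (s.conjugacy * h) (f j) c - ∫ z, f j z| ≤ (1 - weight n) * D + 3 * tol n := by
  have hHc := hs.diffeo.smooth.continuous
  have h1 := abs_avg_comp_sub_le hb.pair hb.generated hs.q_pos hHc hb.diffeo.smooth.continuous
    (hs.branch_close j hj) c
  have hE1 : ∫ y in (0 : ℝ)..1, E' y = 1 := by
    have := hb.add_one 0
    rw [zero_add] at this
    rw [intervalIntegral.integral_eq_sub_of_hasDerivAt (fun y _ => hb.hasDerivAt y)
      (hb.continuous_deriv.intervalIntegrable _ _), this]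
    ring
  have h2 := abs_integral_mul_density_le (continuous_avg hHc (f j)) (integral_avg hs.diffeo (f j))
    hb.continuous_deriv (hb.pair.continuous_slice c) hb.deriv_nonneg hE1 hb.mix (weight_le_one n)
    (hb.pair.integral_density_one c) (hb.density_cantor c hc)
    (AbC.abs_avg_sub_integral_le s.conjugacy (f j))
    fun y => hb.abs_avg_sub_integral_le_of_deriv_ne_zero hj hD
  have h3 := hb.sigma_norm_le j hj
  have h4 : (1 - weight n) * (D + tol n) ≤ (1 - weight n) * D + tol n := by
    nlinarith [weight_pos n, tol_pos n]
  have h5 := abs_sub_le (avg (s.conjugacy ∘ h) (f j) c)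
    (∫ Y in (0 : ℝ)..1, avg s.conjugacy (f j) Y * J (c, Y)) (∫ z, f j z)
  change |avg (s.conjugacy ∘ h) (f j) c - ∫ z, f j z| ≤ _
  linarith

/-- It is applied with `φ` the cosine and the sine. The neighbourhood of the previous stage is so
small in measure that even the peak `M n` of the density contributes at most `tol n`. -/
lemma IsBlock.bulk (hs : IsAdmissible f M n s) (hM : 0 ≤ M n)
    (hR : IsFastRotation (tol n) (tol n / 8) (M n) R R')
    (hb : IsBlock f R R' n s ρ σ h P Q J E E' F') {j : ℕ} (hj : j ≤ n + 1) {φ : ℝ → ℝ}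
    (hφ : Continuous φ) (hφp : ∀ y, φ (y + 1) = φ y) (hφ1 : ∀ y, |φ y| ≤ 1)
    (hφl : ∀ x y, |φ x - φ y| ≤ 2 * Real.pi * |x - y|) (hf : ∀ x y, f j (proj (x, y)) = φ y)
    (hu : ∀ y, ¬ NearCantor s.radius y → |avg s.conjugacy (f j) y - φ y| ≤ drift n) {c : ℝ}
    (hc : ¬ NearCantor ρ c) : |avg (s.conjugacy * h) (f j) c - φ c| ≤ drift (n + 1) := by
  have hHc := hs.diffeo.smooth.continuous
  have h1 := abs_avg_comp_sub_le hb.pair hb.generated hs.q_pos hHc hb.diffeo.smooth.continuous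
    (hs.branch_close j hj) c
  have hR' : Continuous R' := (contDiff_of_hasDerivAt hR.contDiff hR.hasDerivAt).continuous
  have hR1 : ∫ y in (0 : ℝ)..1, R' (y - c) = 1 := by
    have := hR.add_one (0 - c)
    rw [intervalIntegral.integral_eq_sub_of_hasDerivAt (f := fun y => R (y - c))
      (fun y _ => (hR.hasDerivAt (y - c)).comp_sub_const y c)
      ((hR'.comp (by fun_prop)).intervalIntegrable _ _),
      show (1 : ℝ) - c = 0 - c + 1 by ring, this]
    ring
  have hf1 : ∀ z, |f j z| ≤ 1 := fun z => by
    obtain ⟨⟨x, y⟩, rfl⟩ := proj_surjective z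
    rw [hf]; exact hφ1 y
  have hu1 : ∀ y, |avg s.conjugacy (f j) y| ≤ 1 := fun y => by
    have := intervalIntegral.norm_integral_le_of_norm_le_const (a := 0) (b := 1) (C := 1)
      (f := fun x => f j (s.conjugacy (proj (x, y)))) fun x _ => hf1 _
    simpa [avg] using this
  have ht := tol_pos n
  have h2 := abs_integral_mul_density_sub_le (continuous_avg hHc (f j)) hφ hφp hφ1 hφl hu1
    (hb.pair.continuous_slice c) (fun y => (hb.pair.density_pos _).le)
    (hb.pair.integral_density_one c) hR' hR1 ht.le (fun y => ht.le.trans (hR.le_deriv y))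
    (by positivity) hR.deriv_eq hR.deriv_le (hb.density_bulk c hc) (drift_nonneg n) hu
    (by positivity) hs.volume_le
  have h3 : 2 * (M n + σ) * (tol n / (2 * (M n + 1))) ≤ tol n := by
    rw [mul_div_assoc', div_le_iff₀ (by positivity)]
    nlinarith [hb.sigma_le, tol_le_half n]
  have h4 : 2 * Real.pi * (tol n / 8) ≤ tol n := by
    nlinarith [Real.pi_lt_four]
  have h5 := abs_sub_le (avg (s.conjugacy ∘ h) (f j) c)
    (∫ Y in (0 : ℝ)..1, avg s.conjugacy (f j) Y * J (c, Y)) (φ c)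
  have h6 := hb.sigma_le
  have h7 := drift_add_le n
  change |avg (s.conjugacy ∘ h) (f j) c - φ c| ≤ _
  linarith

lemma IsBlock.abs_birkhoffAverage_sub_integral_le (hs : IsAdmissible f M n s)
    (hb : IsBlock f R R' n s ρ σ h P Q J E E' F') {L : ℕ} (hL : 0 < L)
    (hmod : ∀ j ≤ n + 1, ∀ x y : ℝ × ℝ, dist x y ≤ 1 / (L * s.q) →
      |f j ((s.conjugacy * h) (proj x)) - f j ((s.conjugacy * h) (proj y))| ≤ tol n) {j : ℕ}
    (hj : j ≤ n + 1) {D : ℝ}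
    (hD : ∀ y ∈ cantorLift, |avg s.conjugacy (f j) y - ∫ z, f j z| ≤ D) {c y θ θ' : ℝ}
    (hc : c ∈ cantorLift) (hy : y ∈ cantorLift)
    (hz : (s.conjugacy * h) (proj (θ, c)) = s.conjugacy (proj (θ', y))) {N : ℕ}
    (hN : (n + 1) * s.q ≤ N) :
    |birkhoffAverage ℝ ((s.conjugacy * h) * shift (s.p / s.q + 1 / (L * s.q ^ 2)) *
      (s.conjugacy * h)⁻¹) (f j) N ((s.conjugacy * h) (proj (θ, c))) - ∫ z, f j z| ≤
      3 * D + 8 * tol n + 4 * ‖f j‖ * weight n + 2 * ‖f j‖ / (n + 1) := by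
  have hq : (0 : ℝ) < s.q := by exact_mod_cast hs.q_pos
  have ht := tol_pos n
  have hD0 : 0 ≤ D := (abs_nonneg _).trans (hD c hc)
  obtain ⟨Y, hY⟩ := hb.pair.surjective_left c (s.q * θ)
  -- The hypothesis that the point also lies on a Cantor circle of the previous stage says that the
  -- orbit starts at a height `Y` in the Cantor set, where `E Y = Y`.
  have hYC : Y ∈ cantorLift := by
    have h1 := hb.generated c Y 0
    rw [hY, Int.cast_zero, add_zero, add_zero, mul_div_cancel_left₀ _ hq.ne'] at h1
    rw [Equiv.Perm.mul_apply, h1] at hz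
    obtain ⟨k, l, h2, h3⟩ := proj_eq_iff.1 (s.conjugacy.injective hz)
    simp only at h3
    rw [h3]
    exact (add_int_mem_cantorLift l).2 hy
  have hσ := hb.sigma_le
  have ht1 := tol_le_half n
  have key := abs_birkhoffAverage_sub_le (K := n + 1) hb.pair hb.generated hs.q_pos hL
    n.succ_pos hs.coprime hs.diffeo.smooth.continuous hb.diffeo.smooth.continuous
    (hs.branch_close j hj) (fun x t y hxt => hmod j hj (x, y) (t, y) (by
      rw [Prod.dist_eq, dist_self, Real.dist_eq, max_eq_left (abs_nonneg _)]; exact hxt))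
    hb.hasDerivAt hb.continuous_deriv hb.deriv_nonneg hb.le_self (hb.eq_self Y hYC) hb.mix
    (weight_pos n).le (weight_le_one n) (hb.density_cantor c hc) (by linarith)
    (by positivity : 0 ≤ D + tol n)
    (fun y => hb.abs_avg_sub_integral_le_of_deriv_ne_zero hj hD) hY hN
  refine key.trans ?_
  have h1 := hb.sigma_norm_le j hj
  -- With `σ ≤ 1` and `2 ‖f j‖ σ ≤ tol n`, the errors add up to `3 (D + tol n) + 2 tol n + 3 tol n`
  -- plus the two terms in `‖f j‖`.
  have h2 : (D + tol n) * σ ≤ D + tol n := by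
    have : σ ≤ 1 := by linarith
    nlinarith
  push_cast
  nlinarith

end Block

end AbC

namespace AbC

/-! ### The group of area-preserving diffeomorphisms -/

lemma IsSmooth.comp {f g : Torus → Torus} (hf : IsSmooth f) (hg : IsSmooth g) : IsSmooth (f ∘ g) := by
  obtain ⟨F, hF, hFl⟩ := hf
  obtain ⟨G, hG, hGl⟩ := hg
  exact ⟨F ∘ G, hF.comp hG, fun x => by
    rw [Function.comp_apply, Function.comp_apply, hFl, hGl]⟩

lemma isSmooth_shift (t : ℝ) : IsSmooth (shift t) :=
  ⟨fun x => (x.1 + t, x.2), by fun_prop, fun x => (shift_proj t x.1 x.2).symm⟩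

lemma isAreaPreservingDiffeo_one : IsAreaPreservingDiffeo 1 where
  smooth := ⟨id, contDiff_id, fun _ => rfl⟩
  smooth_symm := ⟨id, contDiff_id, fun _ => rfl⟩
  measurePreserving := MeasurePreserving.id _

lemma IsAreaPreservingDiffeo.mul {f g : Equiv.Perm Torus} (hf : IsAreaPreservingDiffeo f)
    (hg : IsAreaPreservingDiffeo g) : IsAreaPreservingDiffeo (f * g) where
  smooth := hf.smooth.comp hg.smooth
  smooth_symm := hg.smooth_symm.comp hf.smooth_symm
  measurePreserving := hf.measurePreserving.comp hg.measurePreserving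

lemma IsAreaPreservingDiffeo.inv {f : Equiv.Perm Torus} (hf : IsAreaPreservingDiffeo f) :
    IsAreaPreservingDiffeo f⁻¹ where
  smooth := hf.smooth_symm
  smooth_symm := hf.smooth
  measurePreserving := MeasurePreserving.symm
    (⟨f, hf.smooth.continuous.measurable, hf.smooth_symm.continuous.measurable⟩ : Torus ≃ᵐ Torus)
    hf.measurePreserving

lemma isAreaPreservingDiffeo_shift (t : ℝ) : IsAreaPreservingDiffeo (shift t) where
  smooth := isSmooth_shift t
  smooth_symm := by
    rw [show (shift t).symm = shift (-t) from shift_inv t]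
    exact isSmooth_shift _
  measurePreserving :=
    (measurePreserving_add_right (volume : Measure UnitAddCircle) (t : UnitAddCircle)).prod
      (MeasurePreserving.id volume)

lemma Stage.isAreaPreservingDiffeo_map {s : Stage} (hs : IsAreaPreservingDiffeo s.conjugacy) :
    IsAreaPreservingDiffeo s.map :=
  (hs.mul (isAreaPreservingDiffeo_shift _)).mul hs.inv

/-! ### The steps of the construction -/

lemma abs_cos_sub_cos_le (x y : ℝ) :
    |Real.cos (2 * Real.pi * x) - Real.cos (2 * Real.pi * y)| ≤ 2 * Real.pi * |x - y| := by
  have := Real.abs_cos_sub_cos_le (2 * Real.pi * x) (2 * Real.pi * y)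
  rwa [← mul_sub, abs_mul, abs_of_pos Real.two_pi_pos] at this

lemma abs_sin_sub_sin_le (x y : ℝ) :
    |Real.sin (2 * Real.pi * x) - Real.sin (2 * Real.pi * y)| ≤ 2 * Real.pi * |x - y| := by
  have := Real.abs_sin_sub_sin_le (2 * Real.pi * x) (2 * Real.pi * y)
  rwa [← mul_sub, abs_mul, abs_of_pos Real.two_pi_pos] at this

/-- The radius is taken small for the volume condition, with the bound `M (n + 1)` of the next
rotation known in advance; after the conjugacy is built, all remaining conditions hold for large
`L`. -/
lemma exists_successor {f : ℕ → C(Torus, ℝ)} {R R' : ℝ → ℝ} {M : ℕ → ℝ} {n : ℕ} {s : Stage}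
    (hf0 : ∀ x y, f 0 (proj (x, y)) = Real.cos (2 * Real.pi * y))
    (hf1 : ∀ x y, f 1 (proj (x, y)) = Real.sin (2 * Real.pi * y)) (hM : ∀ n, 0 ≤ M n)
    (hR : IsFastRotation (tol n) (tol n / 8) (M n) R R') (hs : IsAdmissible f M n s) :
    ∃ s', IsAdmissible f M (n + 1) s' ∧ IsSuccessor f n s s' := by
  have ht := tol_pos (n + 1)
  have hM1 := hM (n + 1)
  obtain ⟨ρ₀, hρ₀, hvol⟩ := exists_small_nearCantor
    (by positivity : 0 < tol (n + 1) / (2 * (M (n + 1) + 1)))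
  obtain ⟨ρ, σ, h, P, Q, J, E, E', F', hρ, hb⟩ := exists_isBlock hs hR hρ₀
  set H' := s.conjugacy * h with hH'
  have hH'd : IsAreaPreservingDiffeo H' := hs.diffeo.mul hb.diffeo
  have hq := hs.q_pos
  have hq' : (0 : ℝ) < s.q := by exact_mod_cast hq
  set α : ℝ := s.p / s.q with hα
  -- Since `h` commutes with the translation, the old map is conjugated by `H'` too; old and new
  -- maps then differ only in the translation.
  have hmap : s.map = H' * shift α * H'⁻¹ := by
    rw [Stage.map, hH', mul_inv_rev, mul_assoc s.conjugacy h, (hb.commute s.p).eq]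
    group
  have hpos : (0 : ℝ) < (1 / 2) ^ n := by positivity
  obtain ⟨η, hη, hmod⟩ := exists_common_modulus hH'd.smooth.continuous f (n + 1) (tol_pos n)
  obtain ⟨η', hη', hmod'⟩ := exists_common_modulus hH'd.smooth.continuous f (n + 2) ht
  have hlim : ∀ c : ℝ, Tendsto (fun L : ℕ => 1 / (L * c)) atTop (𝓝 0) := fun c => by
    have := (tendsto_one_div_atTop_nhds_zero_nat (𝕜 := ℝ)).mul_const (1 / c)
    rw [zero_mul] at this
    exact this.congr fun L => by rw [div_mul_div_comm, one_mul]
  have hlimα : Tendsto (fun L : ℕ => α + 1 / (L * (s.q : ℝ) ^ 2)) atTop (𝓝 α) := by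
    simpa using (hlim ((s.q : ℝ) ^ 2)).const_add α
  -- Large `L` gives closeness of lifts, of inverse lifts and of the first `(n + 1) q` iterates, the
  -- modulus at scale `1/(L q)` for the orbit estimate, and at scale `1/(L q²)` for the branch
  -- averages of the next stage.
  obtain ⟨L, hL1, hA, hA', hB, hC, hD⟩ := ((eventually_gt_atTop 1).and
    ((hlimα.eventually (eventually_close_lift hH'd.smooth hH'd.smooth_symm α n hpos)).and
    ((hlimα.neg.eventually (eventually_close_lift hH'd.smooth hH'd.smooth_symm (-α) n hpos)).and
    ((hlimα.eventually (eventually_dist_iterate_le hH'd.smooth.continuous α ((n + 1) * s.q)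
      hpos)).and
    (((tendsto_order.1 (hlim s.q)).2 η hη).and
      ((tendsto_order.1 (hlim ((s.q : ℝ) ^ 2))).2 η' hη')))))).exists
  have hL : 0 < L := by omega
  have hL' : (0 : ℝ) < L := by exact_mod_cast hL
  set s' : Stage := ⟨H', L * s.q * s.p + 1, L * s.q ^ 2, ρ⟩ with hs'
  have hrot : ((s'.p : ℝ) / s'.q) = α + 1 / (L * (s.q : ℝ) ^ 2) := by
    simp only [hs', hα]
    push_cast
    field_simp
  have hmap' : s'.map = H' * shift (α + 1 / (L * (s.q : ℝ) ^ 2)) * H'⁻¹ := by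
    rw [← hrot]; rfl
  have hsymm : ∀ t, (H' * shift t * H'⁻¹).symm = H' * shift (-t) * H'⁻¹ := fun t => by
    change (H' * shift t * H'⁻¹)⁻¹ = _
    rw [← shift_inv]
    group
  have hcos : ∀ y, Real.cos (2 * Real.pi * (y + 1)) = Real.cos (2 * Real.pi * y) := fun y => by
    rw [mul_add, mul_one, Real.cos_add_two_pi]
  have hsin : ∀ y, Real.sin (2 * Real.pi * (y + 1)) = Real.sin (2 * Real.pi * y) := fun y => by
    rw [mul_add, mul_one, Real.sin_add_two_pi]
  refine ⟨s', ⟨?_, ?_, hH'd, ?_, ?_, ?_, ?_⟩, ⟨⟨h, hb.diffeo, hb.commute s.p, rfl⟩,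
    ⟨L, hL1, rfl, rfl⟩, ?_, ?_, ?_, ?_, ?_, hb.cover⟩⟩
  · simp only [hs']; positivity
  · simp only [hs']
    -- Bézout: `(1 - Lqp)(1 + Lqp) + (Lp²)(Lq²) = 1`.
    refine ⟨1 - L * s.q * s.p, L * s.p ^ 2, ?_⟩
    push_cast
    ring
  · intro c hc
    simp only [hs', hH', Equiv.Perm.mul_apply]
    rw [hb.fixes hc, hs.fixes c hc]
  · intro j hj x y
    refine abs_branch_sub_le_of_modulus hH'd.smooth.continuous (by simp only [hs']; positivity)
      (fun t t' y htt => hmod' j hj _ _ ?_) x y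
    rw [Prod.dist_eq, dist_self, Real.dist_eq, max_eq_left (abs_nonneg _)]
    refine htt.trans_lt ?_
    simp only [hs']
    push_cast
    exact hD
  · intro y hy
    exact ⟨hb.bulk hs (hM n) hR (Nat.zero_le _) (by fun_prop) hcos
        (fun y => Real.abs_cos_le_one _) abs_cos_sub_cos_le hf0 (fun y hy => (hs.bulk y hy).1) hy,
      hb.bulk hs (hM n) hR (by omega) (by fun_prop) hsin
        (fun y => Real.abs_sin_le_one _) abs_sin_sub_sin_le hf1 (fun y hy => (hs.bulk y hy).2) hy⟩
  · exact hvol ρ hρ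
  · intro G₀ h1 h2
    rw [hmap] at h2
    rw [hmap']
    exact hA G₀ h1 h2
  · intro G₀ h1 h2
    rw [hmap, hsymm] at h2
    rw [hmap', hsymm]
    exact hA' G₀ h1 h2
  · intro i hi x
    rw [hmap, hmap']
    exact hB i hi x
  · intro j hj D hD y hy
    exact hb.abs_avg_sub_integral_le hs hj hD hy
  · intro j hj D hD c hc y hy θ θ' hz N hN
    rw [hmap']
    exact hb.abs_birkhoffAverage_sub_integral_le hs hL
      (fun j hj x y hxy => hmod j hj x y (hxy.trans_lt hC)) hj hD hc hy hz hN

/-- With the identity as conjugacy the bulk averages are exact, matching `drift 0 = 0`; only `q` has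
to be large. -/
lemma exists_initial_stage {f : ℕ → C(Torus, ℝ)} {M : ℕ → ℝ}
    (hf0 : ∀ x y, f 0 (proj (x, y)) = Real.cos (2 * Real.pi * y))
    (hf1 : ∀ x y, f 1 (proj (x, y)) = Real.sin (2 * Real.pi * y)) (hM : ∀ n, 0 ≤ M n) :
    ∃ s, s.conjugacy = 1 ∧ IsAdmissible f M 0 s := by
  have ht := tol_pos 0
  have hM0 := hM 0
  obtain ⟨ρ, -, hvol⟩ := exists_small_nearCantor (by positivity : 0 < tol 0 / (2 * (M 0 + 1)))
  obtain ⟨η, hη, hmod⟩ := exists_common_modulus (H := (1 : Equiv.Perm Torus)) continuous_id f 1 ht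
  obtain ⟨q, hq, hqη⟩ := ((eventually_gt_atTop 0).and
    ((tendsto_order.1 (tendsto_one_div_atTop_nhds_zero_nat (𝕜 := ℝ))).2 η hη)).exists
  refine ⟨⟨1, 1, q, ρ⟩, rfl, hq, isCoprime_one_left, isAreaPreservingDiffeo_one, fun _ _ => rfl, ?_,
    ?_, hvol ρ le_rfl⟩
  · intro j hj x y
    refine abs_branch_sub_le_of_modulus continuous_id hq (fun t t' y htt => hmod j hj _ _ ?_) x y
    rw [Prod.dist_eq, dist_self, Real.dist_eq, max_eq_left (abs_nonneg _)]
    exact htt.trans_lt hqη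
  · intro y _
    simp [avg, hf0, hf1, drift]

end AbC

namespace AbC

/-! ### The limit of the construction -/

/-- A sequence of successive steps of the construction. -/
structure IsConstruction (f : ℕ → C(Torus, ℝ)) (M : ℕ → ℝ) (s : ℕ → Stage) : Prop where
  conjugacy_zero : (s 0).conjugacy = 1
  admissible : ∀ n, IsAdmissible f M n (s n)
  successor : ∀ n, IsSuccessor f n (s n) (s (n + 1))

lemma exists_isConstruction {f : ℕ → C(Torus, ℝ)}
    (hf0 : ∀ x y, f 0 (proj (x, y)) = Real.cos (2 * Real.pi * y))
    (hf1 : ∀ x y, f 1 (proj (x, y)) = Real.sin (2 * Real.pi * y)) :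
    ∃ M s, (∀ n, 0 ≤ M n) ∧ IsConstruction f M s := by
  have ht := tol_pos
  choose M R R' hM hR using fun n => exists_isFastRotation (ht n)
    (by linarith [tol_le_half n] : tol n < 1) (by linarith [ht n] : 0 < tol n / 8)
  obtain ⟨s₀, hs₀, hs₀'⟩ := exists_initial_stage hf0 hf1 hM
  choose F hF using fun (n : ℕ) (s : {s // IsAdmissible f M n s}) =>
    exists_successor hf0 hf1 hM (hR n) s.2
  let s : ∀ n, {s // IsAdmissible f M n s} := fun n =>
    Nat.rec (motive := fun n => {s // IsAdmissible f M n s}) ⟨s₀, hs₀'⟩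
      (fun n s => ⟨F n s, (hF n s).1⟩) n
  exact ⟨M, fun n => (s n).1, hM, hs₀, fun n => (s n).2, fun n => (hF n (s n)).2⟩

section Construction

variable {f : ℕ → C(Torus, ℝ)} {M : ℕ → ℝ} {s : ℕ → Stage}

lemma IsConstruction.two_mul_q_le (hs : IsConstruction f M s) (n : ℕ) :
    2 * (s n).q ≤ (s (n + 1)).q := by
  obtain ⟨L, hL, -, h⟩ := (hs.successor n).rotation_eq
  have hq := (hs.admissible n).q_pos
  rw [h]
  nlinarith [Nat.mul_le_mul hL (Nat.le_self_pow two_ne_zero (s n).q)]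

lemma IsConstruction.lt_q (hs : IsConstruction f M s) (n : ℕ) : n < (s n).q := by
  induction n with
  | zero => exact (hs.admissible 0).q_pos
  | succ n ih => have := hs.two_mul_q_le n; omega

lemma IsConstruction.monotone_q (hs : IsConstruction f M s) : Monotone fun n => (s n).q :=
  monotone_nat_of_le_succ fun n => by have := hs.two_mul_q_le n; omega

lemma IsConstruction.tendsto_q (hs : IsConstruction f M s) :
    Tendsto (fun n => (s n).q) atTop atTop :=
  tendsto_atTop_mono (fun n => (hs.lt_q n).le) tendsto_id

lemma IsConstruction.exists_limit (hs : IsConstruction f M s) :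
    ∃ T : Equiv.Perm Torus, IsAreaPreservingDiffeo T ∧
      TendstoSmooth (fun n => (s n).map) T ∧ TendstoSmooth (fun n => (s n).map.symm) T.symm ∧
      ∀ n, ∀ i ≤ (n + 1) * (s n).q, ∀ x,
        dist ((T ^ i) x) (((s n).map ^ i) x) ≤ 2 * (1 / 2) ^ n := by
  obtain ⟨T, h1, h2, h3, h4⟩ := exists_limit_diffeo (T := fun n => (s n).map)
    (fun n => Stage.isAreaPreservingDiffeo_map (hs.admissible n).diffeo)
    (fun n => (hs.successor n).close_lift) fun n => (hs.successor n).close_lift_symm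
  refine ⟨T, h1, h2, h3, fun n i hi x => ?_⟩
  -- A later step controls at least as many iterates, as the range `(m + 1) q_m` grows, so the
  -- geometric errors telescope.
  have h5 : ∀ k, dist (((s (n + k)).map ^ i) x) (((s n).map ^ i) x) ≤
      2 * (1 / 2) ^ n - 2 * (1 / 2) ^ (n + k) := by
    intro k
    induction k with
    | zero => simp
    | succ k ih =>
      have h6 := (hs.successor (n + k)).close_iterates i (hi.trans (Nat.mul_le_mul (by omega)
        (hs.monotone_q (by omega)))) x
      have h7 := dist_triangle (((s (n + k + 1)).map ^ i) x) (((s (n + k)).map ^ i) x)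
        (((s n).map ^ i) x)
      rw [← add_assoc, pow_succ]
      linarith
  refine le_of_tendsto ((h4 i x).dist tendsto_const_nhds) ?_
  filter_upwards [eventually_ge_atTop n] with m hm
  obtain ⟨k, rfl⟩ := Nat.exists_eq_add_of_le hm
  have : (0 : ℝ) < (1 / 2) ^ (n + k) := by positivity
  linarith [h5 k]

lemma abs_birkhoffAverage_sub_le_of_pow {T S : Equiv.Perm Torus} {g : C(Torus, ℝ)} {N : ℕ}
    {x : Torus} {ε : ℝ} (hε : 0 ≤ ε) (h : ∀ i < N, |g ((T ^ i) x) - g ((S ^ i) x)| ≤ ε) :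
    |birkhoffAverage ℝ T g N x - birkhoffAverage ℝ S g N x| ≤ ε := by
  rcases Nat.eq_zero_or_pos N with rfl | hN
  · simpa using hε
  have hN' : (0 : ℝ) < N := by exact_mod_cast hN
  rw [birkhoffAverage, birkhoffAverage, smul_eq_mul, smul_eq_mul, ← mul_sub, abs_mul,
    abs_of_pos (by positivity), inv_mul_le_iff₀ hN', birkhoffSum, birkhoffSum,
    ← Finset.sum_sub_distrib]
  refine (Finset.abs_sum_le_sum_abs _ _).trans ?_
  refine (Finset.sum_le_card_nsmul _ _ ε fun i hi => ?_).trans (by simp)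
  rw [Equiv.Perm.iterate_eq_pow, Equiv.Perm.iterate_eq_pow]
  exact h i (Finset.mem_range.1 hi)

/-- A diffeomorphism is close to the steps of a construction. -/
def IsLimit (s : ℕ → Stage) (T : Equiv.Perm Torus) : Prop :=
  ∀ n, ∀ i ≤ (n + 1) * (s n).q, ∀ x, dist ((T ^ i) x) (((s n).map ^ i) x) ≤ 2 * (1 / 2) ^ n

lemma IsLimit.eventually_abs_birkhoffAverage_sub_le {T : Equiv.Perm Torus} (hT : IsLimit s T)
    (g : C(Torus, ℝ)) {ε : ℝ} (hε : 0 < ε) : ∀ᶠ n in atTop, ∀ N ≤ (n + 1) * (s n).q, ∀ x,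
      |birkhoffAverage ℝ T g N x - birkhoffAverage ℝ (s n).map g N x| ≤ ε := by
  obtain ⟨η, hη, hu⟩ := Metric.uniformContinuous_iff.1
    (CompactSpace.uniformContinuous_of_continuous g.continuous) ε hε
  have hlim : Tendsto (fun n : ℕ => 2 * (1 / 2 : ℝ) ^ n) atTop (𝓝 (2 * 0)) :=
    (tendsto_pow_atTop_nhds_zero_of_lt_one (by norm_num) (by norm_num)).const_mul 2
  rw [mul_zero] at hlim
  filter_upwards [(tendsto_order.1 hlim).2 η hη] with n hn N hN x
  exact abs_birkhoffAverage_sub_le_of_pow hε.le fun i hi =>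
    (hu ((hT n i (hi.le.trans hN) x).trans_lt hn)).le

lemma add_two_mul_tol_le (n : ℕ) : 3 * (n + 2) * tol n ≤ (1 / 2) ^ (n + 1) := by
  have h1 : (n : ℝ) + 1 ≤ 2 ^ n := by exact_mod_cast Nat.lt_two_pow_self (n := n)
  have h2 : (1 : ℝ) ≤ 2 ^ n := one_le_pow₀ (by norm_num)
  have h3 : (2 : ℝ) ^ n * (1 / 4) ^ n = (1 / 2) ^ n := by rw [← mul_pow]; norm_num
  have h4 : (0 : ℝ) < (1 / 4) ^ n := by positivity
  unfold tol
  rw [pow_add, pow_succ (1 / 2 : ℝ) n, ← h3]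
  nlinarith

/-- The weight `1/(n+2)` is exactly what turns a bound `C/(n+1)` into `C/(n+2)`. The term `1 -
(1/2)^n` in the numerator absorbs the accumulated tolerances, and `j + 1` makes the trivial bound
start the induction at `n = j`. -/
lemma IsConstruction.abs_avg_sub_integral_le (hs : IsConstruction f M s) (j : ℕ) {n : ℕ}
    (hn : j ≤ n) : ∀ y ∈ cantorLift, |avg (s n).conjugacy (f j) y - ∫ z, f j z| ≤
      ((j + 1) * (2 * ‖f j‖) + 1 - (1 / 2) ^ n) / (n + 1) := by
  induction n, hn using Nat.le_induction with
  | base =>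
    intro y _
    refine (AbC.abs_avg_sub_integral_le _ _ y).trans ?_
    rw [le_div_iff₀ (by positivity)]
    have h : (1 / 2 : ℝ) ^ j ≤ 1 := pow_le_one₀ (by norm_num) (by norm_num)
    linarith
  | succ n hn ih =>
    intro y hy
    refine ((hs.successor n).contraction j (by omega) _ ih y hy).trans ?_
    have h1 := add_two_mul_tol_le n
    have e : ∀ C : ℝ, (1 - weight n) * (C / (n + 1)) = C / (n + 2) := fun C => by
      unfold weight
      have : (n : ℝ) + 2 ≠ 0 := by positivity
      field_simp
      ring
    rw [e, Nat.cast_succ, le_div_iff₀ (by positivity), add_mul, add_assoc (n : ℝ) 1 1,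
      one_add_one_eq_two, div_mul_cancel₀ _ (by positivity)]
    rw [pow_succ] at h1 ⊢
    linarith

/-- Every large time `N` lies between `(n + 1) q_n` and `(n + 2) q_{n+1}` for some large `n`. Up to
the upper end `T` follows the map of stage `n + 1`, and from the lower end on that map has good
averages. -/
lemma IsConstruction.tendsto_birkhoffAverage (hs : IsConstruction f M s) {T : Equiv.Perm Torus}
    (hT : IsLimit s T) {x : Torus}
    (hx : ∀ᶠ n in atTop, ∃ θ, ∃ c ∈ cantorLift, x = (s n).conjugacy (proj (θ, c))) (j : ℕ) :
    Tendsto (fun N => birkhoffAverage ℝ T (f j) N x) atTop (𝓝 (∫ z, f j z)) := by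
  set C := (j + 1) * (2 * ‖f j‖) + 1 with hC
  have hb : Tendsto (fun n : ℕ => 3 * (C * (1 / ((n : ℝ) + 1))) + 8 * ((1 / 2) ^ n / 256) +
      4 * ‖f j‖ * (1 / ((n : ℝ) + 1)) + 2 * ‖f j‖ * (1 / ((n : ℝ) + 1))) atTop
      (𝓝 (3 * (C * 0) + 8 * (0 / 256) + 4 * ‖f j‖ * 0 + 2 * ‖f j‖ * 0)) := by
    have h1 := tendsto_one_div_add_atTop_nhds_zero_nat (𝕜 := ℝ)
    have h2 := tendsto_pow_atTop_nhds_zero_of_lt_one (by norm_num : (0 : ℝ) ≤ 1 / 2) (by norm_num)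
    exact ((((h1.const_mul C).const_mul 3).add ((h2.div_const 256).const_mul 8)).add
      (h1.const_mul _)).add (h1.const_mul _)
  rw [show 3 * (C * 0) + 8 * (0 / 256) + 4 * ‖f j‖ * 0 + 2 * ‖f j‖ * 0 = 0 by ring] at hb
  rw [Metric.tendsto_atTop]
  intro ε hε
  obtain ⟨n₁, hn₁⟩ := eventually_atTop.1 (((tendsto_order.1 hb).2 (ε / 2) (half_pos hε)).and
    ((eventually_ge_atTop j).and (hx.and (((tendsto_add_atTop_nat 1).eventually hx).and
    ((tendsto_add_atTop_nat 1).eventually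
      (hT.eventually_abs_birkhoffAverage_sub_le (f j) (by positivity : 0 < ε / 4)))))))
  refine ⟨(n₁ + 1) * (s n₁).q, fun N hN => ?_⟩
  have hlarge : ∀ n, n < (n + 1) * (s n).q := fun n => by
    have := (hs.admissible n).q_pos
    nlinarith
  -- The search may stop at `N` because `n < (n + 1) q_n`, so every admissible index is below `N`.
  set n := Nat.findGreatest (fun n => (n + 1) * (s n).q ≤ N) N with hn
  have hn₁N : n₁ ≤ N := (hlarge n₁).le.trans hN
  have hn1 : (n + 1) * (s n).q ≤ N := Nat.findGreatest_spec (P := fun n => (n + 1) * (s n).q ≤ N) hn₁N hN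
  have hn2 : n₁ ≤ n := Nat.le_findGreatest hn₁N hN
  have hn3 : N ≤ (n + 1 + 1) * (s (n + 1)).q := by
    by_contra! hlt
    exact Nat.findGreatest_is_greatest (P := fun n => (n + 1) * (s n).q ≤ N) (n := N)
      (k := n + 1) (by omega) ((hlarge (n + 1)).le.trans hlt.le) hlt.le
  obtain ⟨h1, h2, ⟨θ', y, hy, hxy⟩, ⟨θ, c, hc, hxc⟩, h5⟩ := hn₁ n hn2
  have h6 := h5 N hn3 x
  have h7 := (hs.successor n).birkhoff j (by omega) _ (hs.abs_avg_sub_integral_le j h2) c hc y hy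
    θ θ' (hxc.symm.trans hxy) N hn1
  rw [← hxc] at h7
  have h8 : (C - (1 / 2) ^ n) / ((n : ℝ) + 1) ≤ C * (1 / ((n : ℝ) + 1)) := by
    rw [mul_one_div]
    gcongr
    have : (0 : ℝ) < (1 / 2) ^ n := by positivity
    linarith
  have h9 : weight n ≤ 1 / ((n : ℝ) + 1) := by
    unfold weight
    gcongr
    norm_num
  have h10 := mul_le_mul_of_nonneg_left h9 (by positivity : 0 ≤ 4 * ‖f j‖)
  have h11 := tol_le n
  have h12 : 2 * ‖f j‖ / ((n : ℝ) + 1) = 2 * ‖f j‖ * (1 / ((n : ℝ) + 1)) := by rw [mul_one_div]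
  rw [Real.dist_eq]
  have h13 := abs_sub_le (birkhoffAverage ℝ T (f j) N x)
    (birkhoffAverage ℝ (s (n + 1)).map (f j) N x) (∫ z, f j z)
  linarith

lemma mem_genericPoints_of_dense {T : Equiv.Perm Torus} {x : Torus} (hf : DenseRange f)
    (h : ∀ j, Tendsto (fun N => birkhoffAverage ℝ T (f j) N x) atTop (𝓝 (∫ z, f j z))) :
    x ∈ genericPoints T := by
  intro g
  rw [Metric.tendsto_atTop]
  intro ε hε
  obtain ⟨j, hj⟩ := hf.exists_dist_lt g (by positivity : 0 < ε / 4)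
  obtain ⟨N₀, hN₀⟩ := Metric.tendsto_atTop.1 (h j) (ε / 4) (by positivity)
  refine ⟨N₀, fun N hN => ?_⟩
  have h1 := hN₀ N hN
  have hz : ∀ z, |g z - f j z| ≤ ε / 4 := fun z =>
    (ContinuousMap.dist_apply_le_dist z).trans hj.le
  have h2 : |birkhoffAverage ℝ T g N x - birkhoffAverage ℝ T (f j) N x| ≤ ε / 4 := by
    rcases Nat.eq_zero_or_pos N with rfl | hN
    · simpa using (by positivity : 0 ≤ ε / 4)
    have hN' : (0 : ℝ) < N := by exact_mod_cast hN
    rw [birkhoffAverage, birkhoffAverage, smul_eq_mul, smul_eq_mul, ← mul_sub, abs_mul,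
      abs_of_pos (by positivity), inv_mul_le_iff₀ hN', birkhoffSum, birkhoffSum,
      ← Finset.sum_sub_distrib]
    refine (Finset.abs_sum_le_sum_abs _ _).trans ?_
    exact (Finset.sum_le_card_nsmul _ _ (ε / 4) fun i hi => hz _).trans (by simp)
  have hint : ∀ u : C(Torus, ℝ), Integrable u := fun u =>
    u.continuous.integrable_of_hasCompactSupport (HasCompactSupport.of_compactSpace _)
  have h3 : |(∫ z, f j z) - ∫ z, g z| ≤ ε / 4 := by
    rw [← integral_sub (hint _) (hint _)]
    have := norm_integral_le_of_norm_le_const (μ := (volume : Measure Torus)) (C := ε / 4)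
      (f := fun z => f j z - g z) (ae_of_all _ fun z => by
        rw [Real.norm_eq_abs, abs_sub_comm]; exact hz z)
    rwa [volume_real_univ, mul_one] at this
  rw [Real.dist_eq] at h1 ⊢
  have h4 := abs_sub_le (birkhoffAverage ℝ T g N x) (birkhoffAverage ℝ T (f j) N x) (∫ z, g z)
  have h5 := abs_sub_le (birkhoffAverage ℝ T (f j) N x) (∫ z, f j z) (∫ z, g z)
  linarith

/-- The average of the stage map at time `q_n` is a branch average, which outside the tube is close
to the cosine, respectively sine, of the height. For a generic point both would be close to zero at
the same height. -/
lemma IsConstruction.eventually_mem_tube (hs : IsConstruction f M s) {T : Equiv.Perm Torus}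
    (hT : IsLimit s T) (hf0 : ∀ x y, f 0 (proj (x, y)) = Real.cos (2 * Real.pi * y))
    (hf1 : ∀ x y, f 1 (proj (x, y)) = Real.sin (2 * Real.pi * y)) {x : Torus}
    (hx : x ∈ genericPoints T) : ∀ᶠ n in atTop, x ∈ (s n).tube := by
  have hI0 : ∫ z, f 0 z = 0 := by
    rw [integral_torus (f 0).continuous]
    simp [hf0]
  have hI1 : ∫ z, f 1 z = 0 := by
    rw [integral_torus (f 1).continuous]
    simp [hf1]
  have h0 := (hx (f 0)).comp hs.tendsto_q
  have h1 := (hx (f 1)).comp hs.tendsto_q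
  rw [hI0] at h0
  rw [hI1] at h1
  filter_upwards [Metric.tendsto_nhds.1 h0 (1 / 32) (by norm_num),
    Metric.tendsto_nhds.1 h1 (1 / 32) (by norm_num),
    hT.eventually_abs_birkhoffAverage_sub_le (f 0) (by norm_num : (0 : ℝ) < 1 / 32),
    hT.eventually_abs_birkhoffAverage_sub_le (f 1) (by norm_num : (0 : ℝ) < 1 / 32)]
    with n h2 h3 h4 h5
  obtain ⟨⟨θ, y⟩, hz⟩ := proj_surjective ((s n).conjugacy.symm x)
  have hxz : (s n).conjugacy (proj (θ, y)) = x := by rw [hz, Equiv.apply_symm_apply]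
  by_contra hn
  have hy : ¬ NearCantor (s n).radius y := fun h => hn ⟨θ, y, h, hxz.symm⟩
  have ha := hs.admissible n
  have hq : (s n).q ≤ (n + 1) * (s n).q := Nat.le_mul_of_pos_left _ n.succ_pos
  have key : ∀ j ≤ n + 1, birkhoffAverage ℝ (s n).map (f j) (s n).q x =
      branch (s n).conjugacy (f j) (s n).q θ y := fun j _ => by
    rw [← hxz]
    exact birkhoffAverage_conj_shift _ _ ha.q_pos ha.coprime _ _
  have h6 := h4 _ hq x
  have h7 := h5 _ hq x
  rw [key 0 (by omega)] at h6
  rw [key 1 (by omega)] at h7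
  have h8 := ha.branch_close 0 (by omega) θ y
  have h9 := ha.branch_close 1 (by omega) θ y
  obtain ⟨h10, h11⟩ := ha.bulk y hy
  have h12 : drift n ≤ 1 / 2 := by
    have : (0 : ℝ) < (1 / 2) ^ n := by positivity
    unfold drift
    linarith
  have h13 := tol_le_half n
  simp only [Function.comp_apply, Real.dist_eq, sub_zero] at h2 h3
  -- The sum `1/2 + 1/256 + 1/32 + 1/32` is below `3/5`, and `2 (3/5)² < 1` contradicts the
  -- Pythagorean identity.
  have hc : |Real.cos (2 * Real.pi * y)| ≤ 3 / 5 := by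
    rw [abs_lt] at h2
    rw [abs_le] at *
    constructor <;> linarith
  have hs' : |Real.sin (2 * Real.pi * y)| ≤ 3 / 5 := by
    rw [abs_lt] at h3
    rw [abs_le] at *
    constructor <;> linarith
  have h14 := Real.cos_sq_add_sin_sq (2 * Real.pi * y)
  have h15 := sq_le_sq' (abs_le.1 hc).1 (abs_le.1 hc).2
  have h16 := sq_le_sq' (abs_le.1 hs').1 (abs_le.1 hs').2
  linarith

end Construction

end AbC

namespace AbC

/-! ### Measure and dimension of the set of generic points -/

/-- The conjugacy preserves area, so the tube has the measure of a product of the full circle with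
the projected neighbourhood. -/
lemma Stage.volume_tube_le {s : Stage} (hs : IsAreaPreservingDiffeo s.conjugacy) :
    volume s.tube ≤ volume ({y | NearCantor s.radius y} ∩ Set.Icc 0 1) := by
  set V : Set UnitAddCircle := (fun y : ℝ => (y : UnitAddCircle)) '' {y | NearCantor s.radius y}
    with hV
  have hVo : IsOpen V := QuotientAddGroup.isOpenMap_coe _ (isOpen_nearCantor _)
  have htube : s.tube = ⇑(s.conjugacy⁻¹) ⁻¹' (Set.univ ×ˢ V) := by
    ext z
    constructor
    · rintro ⟨θ, c, hc, rfl⟩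
      refine ⟨Set.mem_univ _, c, hc, ?_⟩
      simp [proj]
    · rintro ⟨-, c, hc, hcz⟩
      obtain ⟨θ, hθ⟩ := QuotientAddGroup.mk_surjective (s.conjugacy⁻¹ z).1
      refine ⟨θ, c, hc, ?_⟩
      rw [show proj (θ, c) = s.conjugacy⁻¹ z from Prod.ext hθ hcz]
      simp
  have hpre : (fun y : ℝ => (y : UnitAddCircle)) ⁻¹' V = {y | NearCantor s.radius y} := by
    ext y
    constructor
    · rintro ⟨c, hc, hcy⟩
      obtain ⟨k, hk⟩ := coe_eq_coe_iff.1 hcy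
      rw [Set.mem_ofPred_eq] at hc ⊢
      rw [hk] at hc
      exact (nearCantor_add_int k).1 hc
    · exact fun h => ⟨y, h, rfl⟩
  rw [htube, hs.inv.measurePreserving.measure_preimage
    (MeasurableSet.univ.prod hVo.measurableSet).nullMeasurableSet, Measure.volume_eq_prod,
    Measure.prod_prod, UnitAddCircle.measure_univ, one_mul,
    ← (UnitAddCircle.measurePreserving_mk 0).measure_preimage hVo.measurableSet.nullMeasurableSet,
    Measure.restrict_apply (hVo.measurableSet.preimage (AddCircle.measurable_mk')), hpre, zero_add]
  exact measure_mono (Set.inter_subset_inter_right _ Set.Ioc_subset_Icc_self)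

/-- Above `d` the exponent eventually exceeds `e n`. The covering sets have diameter at most one, so
a larger exponent only decreases the sums, and the Hausdorff measure is zero. -/
lemma dimH_le_of_hasCover {S : Set Torus} {e : ℕ → ℝ} {d : ℝ} (he : Tendsto e atTop (𝓝 d))
    (hS : ∀ᶠ n in atTop, HasCover (e n) ((1 / 2) ^ n) S) : dimH S ≤ ENNReal.ofReal d := by
  refine dimH_le fun d' hd' => ?_
  by_contra! hlt
  rw [ENNReal.ofReal, ENNReal.coe_lt_coe] at hlt
  have hlt' : d < d' := (Real.le_coe_toNNReal d).trans_lt hlt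
  obtain ⟨m, hm⟩ := eventually_atTop.1 (hS.and ((tendsto_order.1 he).2 d' hlt'))
  choose U hU1 hU2 hU3 using fun n => (hm (n + m) (by omega)).1
  have hlim : Tendsto (fun n => ENNReal.ofReal ((1 / 2) ^ (n + m))) atTop (𝓝 0) := by
    rw [← ENNReal.ofReal_zero]
    exact ENNReal.tendsto_ofReal ((tendsto_add_atTop_iff_nat m).2
      (tendsto_pow_atTop_nhds_zero_of_lt_one (by norm_num) (by norm_num)))
  have hle : ∀ n, ∑ i : U n, Metric.ediam (i : Set Torus) ^ (d' : ℝ) ≤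
      ENNReal.ofReal ((1 / 2) ^ (n + m)) := by
    intro n
    rw [Finset.sum_coe_sort (U n) fun u => Metric.ediam u ^ (d' : ℝ)]
    refine (Finset.sum_le_sum fun u hu => ?_).trans (hU3 n)
    refine ENNReal.rpow_le_rpow_of_exponent_ge ((hU2 n u hu).trans ?_)
      (hm (n + m) (by omega)).2.le
    rw [← ENNReal.ofReal_one]
    exact ENNReal.ofReal_le_ofReal (pow_le_one₀ (by norm_num) (by norm_num))
  have h1 := Measure.hausdorffMeasure_le_liminf_sum (ι := fun n => U n) (d' : ℝ) S _ hlim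
    (fun n i => (i : Set Torus)) (Eventually.of_forall fun n i => hU2 n i i.2)
    (Eventually.of_forall fun n => by
      refine (hU1 n).trans fun x hx => ?_
      obtain ⟨u, hu, hxu⟩ := Set.mem_iUnion₂.1 hx
      exact Set.mem_iUnion.2 ⟨⟨u, hu⟩, hxu⟩)
  have h2 := h1.trans ((liminf_le_liminf (Eventually.of_forall hle)).trans hlim.liminf_eq.le)
  rw [hd'] at h2
  exact ENNReal.top_ne_zero (le_zero_iff.1 h2)

section Construction

variable {f : ℕ → C(Torus, ℝ)} {M : ℕ → ℝ} {s : ℕ → Stage}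

lemma IsConstruction.volume_iInter_tube (hM : ∀ n, 0 ≤ M n) (hs : IsConstruction f M s) (m : ℕ) :
    volume (⋂ n ≥ m, (s n).tube) = 0 := by
  have hlim : Tendsto (fun n : ℕ => ENNReal.ofReal ((1 / 2) ^ n)) atTop (𝓝 0) := by
    rw [← ENNReal.ofReal_zero]
    exact ENNReal.tendsto_ofReal
      (tendsto_pow_atTop_nhds_zero_of_lt_one (by norm_num) (by norm_num))
  refine le_zero_iff.1 (ge_of_tendsto hlim ?_)
  filter_upwards [eventually_ge_atTop m] with n hn
  refine (measure_mono (Set.iInter₂_subset n hn)).trans ?_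
  refine ((Stage.volume_tube_le (hs.admissible n).diffeo).trans (hs.admissible n).volume_le).trans
    (ENNReal.ofReal_le_ofReal ?_)
  have h1 := tol_le n
  have h2 := tol_pos n
  have h3 := hM n
  rw [div_le_iff₀ (by positivity)]
  nlinarith

lemma IsConstruction.dimH_iInter_tube_le (hs : IsConstruction f M s) (m : ℕ) :
    dimH (⋂ n ≥ m, (s n).tube) ≤ ENNReal.ofReal (1 + Real.logb 3 2) := by
  refine dimH_le_of_hasCover (e := coverExponent) ?_ ?_
  · have h := (tendsto_one_div_add_atTop_nhds_zero_nat (𝕜 := ℝ)).const_add (1 + Real.logb 3 2)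
    rw [add_zero] at h
    exact h
  · filter_upwards [eventually_ge_atTop m] with n hn
    exact (hs.successor n).cover.mono (Set.iInter₂_subset (n + 1) (by omega))

/-- A dense sequence with the cosine and sine of the height put in front, so that they are test
functions at every stage. -/
lemma exists_testFunctions : ∃ f : ℕ → C(Torus, ℝ), DenseRange f ∧
    (∀ x y, f 0 (proj (x, y)) = Real.cos (2 * Real.pi * y)) ∧
    ∀ x y, f 1 (proj (x, y)) = Real.sin (2 * Real.pi * y) := by
  have hc : Continuous fun z : Torus => ((AddCircle.toCircle z.2 : Circle) : ℂ) :=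
    continuous_subtype_val.comp (AddCircle.continuous_toCircle.comp continuous_snd)
  let f : ℕ → C(Torus, ℝ) := fun n => match n with
    | 0 => ⟨_, Complex.continuous_re.comp hc⟩
    | 1 => ⟨_, Complex.continuous_im.comp hc⟩
    | n + 2 => TopologicalSpace.denseSeq C(Torus, ℝ) n
  have hexp : ∀ y : ℝ, ((AddCircle.toCircle (y : UnitAddCircle) : Circle) : ℂ) =
      Complex.exp ((2 * Real.pi * y : ℝ) * Complex.I) := fun y => by
    rw [AddCircle.toCircle_apply_mk, Circle.coe_exp, div_one]
  refine ⟨f, (TopologicalSpace.denseRange_denseSeq C(Torus, ℝ)).mono ?_, fun x y => ?_, fun x y => ?_⟩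
  · rintro _ ⟨n, rfl⟩
    exact ⟨n + 2, rfl⟩
  · change (((AddCircle.toCircle (y : UnitAddCircle) : Circle) : ℂ)).re = _
    rw [hexp, Complex.exp_ofReal_mul_I_re]
  · change (((AddCircle.toCircle (y : UnitAddCircle) : Circle) : ℂ)).im = _
    rw [hexp, Complex.exp_ofReal_mul_I_im]

/-- The conjugacies between successive steps of the construction. -/
noncomputable def conjugacies (s : ℕ → Stage) (n : ℕ) : Equiv.Perm Torus :=
  (s n).conjugacy⁻¹ * (s (n + 1)).conjugacy

lemma IsConstruction.conj_conjugacies (hs : IsConstruction f M s) (n : ℕ) :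
    conj (conjugacies s) n = (s n).conjugacy := by
  induction n with
  | zero => exact hs.conjugacy_zero.symm
  | succ n ih => rw [conj, ih, conjugacies, mul_inv_cancel_left]

lemma IsConstruction.isApproxByConj (hs : IsConstruction f M s) {T : Equiv.Perm Torus}
    (hT : TendstoSmooth (fun n => (s n).map) T)
    (hT' : TendstoSmooth (fun n => (s n).map.symm) T.symm) : IsApproxByConj (conjugacies s) T := by
  choose L hL hp hq using fun n => (hs.successor n).rotation_eq
  have hh : ∀ n, IsAreaPreservingDiffeo (conjugacies s n) ∧
      Commute (conjugacies s n) (shift ((s n).p / (s n).q)) := fun n => by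
    obtain ⟨h, h1, h2, h3⟩ := (hs.successor n).conjugacy_eq
    rw [conjugacies, h3, inv_mul_cancel_left]
    exact ⟨h1, h2⟩
  have hmap : ∀ n, conj (conjugacies s) n * shift ((s n).p / (s n).q) *
      (conj (conjugacies s) n)⁻¹ = (s n).map := fun n => by rw [hs.conj_conjugacies]; rfl
  -- Only the product `k n * l n` matters, so it is taken as `L n * 1`.
  refine ⟨fun n => (s n).p, fun n => (s n).q, L, fun _ => 1, (hs.admissible 0).q_pos,
    (hs.admissible 0).coprime, fun n => ⟨by have := hL n; omega, one_pos⟩, fun n => ?_,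
    fun n => ?_, fun n => (hh n).1, fun n => (hh n).2, ?_, ?_⟩
  · simp [hp n]
  · simp [hq n]
  · simpa only [hmap] using hT
  · simpa only [hmap] using hT'

lemma IsConstruction.mem_liminf_iff (hs : IsConstruction f M s) {x : Torus} :
    x ∈ liminf (fun n => conj (conjugacies s) n '' (Set.univ ×ˢ cantorCircle)) atTop ↔
      ∀ᶠ n in atTop, ∃ θ, ∃ c ∈ cantorLift, x = (s n).conjugacy (proj (θ, c)) := by
  rw [mem_liminf_iff_eventually_mem]
  refine eventually_congr (Eventually.of_forall fun n => ?_)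
  rw [hs.conj_conjugacies]
  constructor
  · rintro ⟨z, ⟨-, hz⟩, rfl⟩
    obtain ⟨⟨θ, c⟩, rfl⟩ := proj_surjective z
    exact ⟨θ, c, hz, rfl⟩
  · rintro ⟨θ, c, hc, rfl⟩
    exact ⟨proj (θ, c), ⟨Set.mem_univ _, hc⟩, rfl⟩

end Construction

end AbC

/-! ### Assembly of the theorem -/

theorem theoremC :
    ∃ (h : ℕ → Equiv.Perm AbC.Torus) (T : Equiv.Perm AbC.Torus),
      AbC.IsAreaPreservingDiffeo T ∧
      AbC.IsApproxByConj h T ∧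
      volume (AbC.genericPoints T) = 0 ∧
      ENNReal.ofReal (Real.logb 3 2) ≤ dimH (AbC.genericPoints T) ∧
      dimH (AbC.genericPoints T) ≤ ENNReal.ofReal (1 + Real.logb 3 2) ∧
      {(0 : UnitAddCircle)} ×ˢ AbC.cantorCircle ⊆
        liminf (fun n => AbC.conj h n '' (Set.univ ×ˢ AbC.cantorCircle)) atTop ∧
      liminf (fun n => AbC.conj h n '' (Set.univ ×ˢ AbC.cantorCircle)) atTop ⊆
        AbC.genericPoints T := by
  obtain ⟨f, hf, hf0, hf1⟩ := AbC.exists_testFunctions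
  obtain ⟨M, s, hM, hs⟩ := AbC.exists_isConstruction hf0 hf1
  obtain ⟨T, hTd, hT, hT', hlim⟩ := hs.exists_limit
  -- Only countably many intersections of tubes are involved, so null measure and the dimension
  -- bound pass to the union.
  have hsub : AbC.genericPoints T ⊆ ⋃ m, ⋂ n ≥ m, (s n).tube := fun x hx => by
    obtain ⟨m, hm⟩ := eventually_atTop.1 (hs.eventually_mem_tube hlim hf0 hf1 hx)
    exact Set.mem_iUnion.2 ⟨m, Set.mem_iInter₂.2 hm⟩
  have h0 : {(0 : UnitAddCircle)} ×ˢ AbC.cantorCircle ⊆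
      liminf (fun n => AbC.conj (AbC.conjugacies s) n '' (Set.univ ×ˢ AbC.cantorCircle)) atTop := by
    rintro ⟨_, _⟩ ⟨rfl, c, hc, rfl⟩
    refine hs.mem_liminf_iff.2 (Eventually.of_forall fun n => ?_)
    have hc' := AbC.cantorSet_subset_lift hc
    exact ⟨0, c, hc', ((hs.admissible n).fixes c hc').symm⟩
  have h1 : liminf (fun n => AbC.conj (AbC.conjugacies s) n '' (Set.univ ×ˢ AbC.cantorCircle)) atTop ⊆
      AbC.genericPoints T := fun x hx =>
    AbC.mem_genericPoints_of_dense hf fun j =>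
      hs.tendsto_birkhoffAverage hlim (hs.mem_liminf_iff.1 hx) j
  refine ⟨AbC.conjugacies s, T, hTd, hs.isApproxByConj hT hT', ?_, ?_, ?_, h0, h1⟩
  · exact measure_mono_null hsub (measure_iUnion_null (hs.volume_iInter_tube hM))
  · exact AbC.logb_le_dimH_cantor.trans (dimH_mono (h0.trans h1))
  · refine (dimH_mono hsub).trans ?_
    rw [dimH_iUnion]
    exact iSup_le hs.dimH_iInter_tube_le
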